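/- **Corollary (Multiplexed sparse data-lookup oracle with dirty qubits).** Model: circuits consist of the Clifford gates Hadamard, $S$, CNOT, of Toffoli gates, and of single-qubit computational-basis measurements on whose outcomes all later operations may depend; the Toffoli count is the worst case over outcomes. A circuit implements an isometry if, for every sequence of outcomes, it maps each input of the stated form (and hence each superposition) exactly to the intended output, up to a scalar depending only on the outcomes. Clean qubits start and end in $|0\rangle$. Write $[m]=\{0,\dots,m-1\}$. Let $J,K,b\ge 0$ be integers, $K_j\le K$ for $j\in[J]$, let $x_{j,k}\in\{0,1\}^b$ for $j\in[J]$, $k\in[K_j]$, and put $Q=\sum_{j\in[J]}K_j$, $w=\lceil\log_2 Q\rceil$ (with $\lceil \log_2 0\rceil:=0$). For $d,n\ge 0$ let $$\mathrm{DataDirty}_{d,w,n}=\min\Big\{d,\ \tfrac{2d}{1+\mu}+4\mu w\Big\},\qquad \mathrm{UDataDirty}_{d,w,n}=\min\Big\{d,\ \tfrac{2d}{1+\mu}+4\mu\Big\},$$ where $\mu$ ranges over the integers $1\le\mu\le n/w$ such that $1+\mu$ is a power of two (no such $\mu$ if $w=0$). There are an absolute constant $C$ and constants $c_\mu$ depending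 only on $\mu$, with $c_\mu=0$ whenever $1+\mu$ is a power of two, such that the following holds for all such data, every integer $\lambda\ge 0$ with $n=1+b(1+\lambda)$, and every integer $\mu\in[0,\lambda]$. Besides the registers of $\lceil\log_2J\rceil$, $\lceil\log_2K\rceil$ and $b$ qubits for $j$, $k$ and the data, and a register of $w$ qubits, initially and finally $|0\rangle$, for the flat index $q\in[Q]$, use exactly $$\max\big(\lceil\log_2Q\rceil,\lceil\log_2J\rceil\big)+\lambda b+c_\mu$$ clean ancillary qubits and no other qubits. Then: 1. (Computation) $|j\rangle|k\rangle|z\rangle\mapsto|j\rangle|k\rangle|z\oplus x_{j,k}\rangle$ (for all $j\in[J]$, $k\in[K_j]$, $z\in\{0,1\}^b$) can be implemented with at most $$\mathrm{DataDirty}_{J,w,n}+\mathrm{UDataDirty}_{J,w,n}+\Big(\frac{Q}{1+\mu}+\mu b\Big)+2w+C+c_\mu w$$ Toffoli gates. 2. (Uncomputation) $|j\rangle|k\rangle|x_{j,k}\rangle\mapsto|j\rangle|k\rangle|0\rangle$ (for all $j\in[J]$, $k\in[K_j]$) can be implemented with at most $$\mathrm{DataDirty}_{J,w,n}+\mathrm{UDataDirty}_{J,w,n}+\Big(\frac{Q}{1+\mu}+\mu\Big)+2w+C+c_\mu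 w$$ Toffoli gates. In particular $\mu$ may be chosen optimally in $[0,\lambda]$. -/

import Mathlib

/-! ### States and gates on qubits labelled by a finite type -/

/-- State vectors (not necessarily normalised) of qubits labelled by `ι`, given by their
amplitudes in the computational basis. -/
abbrev QState (ι : Type) : Type := (ι → Bool) → ℂ

/-- The computational basis state `|v⟩`. -/
noncomputable def ket {ι : Type} [Fintype ι] [DecidableEq ι] (v : ι → Bool) : QState ι :=
  Pi.single v 1

/-- The elementary gates: the Clifford generators Hadamard, `S` and CNOT (control first), and the
Toffoli gate (the two controls first). -/
inductive Gate (ι : Type) : Type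
  | had (i : ι)
  | phase (i : ι)
  | cnot (c t : ι) (h : c ≠ t)
  | toffoli (c₁ c₂ t : ι) (h₁₂ : c₁ ≠ c₂) (h₁ : c₁ ≠ t) (h₂ : c₂ ≠ t)

/-- The unitary of a gate. The maps `|v⟩ ↦ |v'⟩` of CNOT and Toffoli are involutions on basis
states, so acting by precomposition on amplitudes is the usual action. -/
noncomputable def Gate.apply {ι : Type} [DecidableEq ι] : Gate ι → QState ι →ₗ[ℂ] QState ι
  | .had i =>
    { toFun := fun ψ v => ((Real.sqrt 2 : ℝ) : ℂ)⁻¹ *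
        (ψ (Function.update v i false) +
          (if v i then -1 else 1) * ψ (Function.update v i true))
      map_add' := by intro ψ φ; funext v; simp only [Pi.add_apply]; ring
      map_smul' := by
        intro a ψ; funext v; simp only [Pi.smul_apply, smul_eq_mul, RingHom.id_apply]; ring }
  | .phase i =>
    { toFun := fun ψ v => (if v i then Complex.I else 1) * ψ v
      map_add' := by intro ψ φ; funext v; simp only [Pi.add_apply]; ring
      map_smul' := by
        intro a ψ; funext v; simp only [Pi.smul_apply, smul_eq_mul, RingHom.id_apply]; ring }
  | .cnot c t _ =>
    { toFun := fun ψ v => ψ (Function.update v t (xor (v t) (v c)))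
      map_add' := by intro ψ φ; rfl
      map_smul' := by intro a ψ; rfl }
  | .toffoli c₁ c₂ t _ _ _ =>
    { toFun := fun ψ v => ψ (Function.update v t (xor (v t) (v c₁ && v c₂)))
      map_add' := by intro ψ φ; rfl
      map_smul' := by intro a ψ; rfl }

/-- The number of Toffoli gates in a single gate. -/
def Gate.toffoliCount {ι : Type} : Gate ι → ℕ
  | .toffoli _ _ _ _ _ _ => 1
  | _ => 0

/-- The (unnormalised) projection onto outcome `o` of a computational-basis measurement of
qubit `i`. -/
noncomputable def outcomeProj {ι : Type} (i : ι) (o : Bool) : QState ι →ₗ[ℂ] QState ι where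
  toFun := fun ψ v => if v i = o then ψ v else 0
  map_add' := by intro ψ φ; funext v; by_cases h : v i = o <;> simp [h]
  map_smul' := by intro a ψ; funext v; by_cases h : v i = o <;> simp [h]

/-! ### Adaptive quantum circuits -/

/-- Circuits with gates and computational-basis measurements; everything after a measurement may
depend on its outcome (classical feed-forward). -/
inductive QCircuit (ι : Type) : Type
  | done
  | gate (g : Gate ι) (rest : QCircuit ι)
  | measure (i : ι) (next : Bool → QCircuit ι)

/-- The Toffoli count of a circuit, in the worst case over the measurement outcomes. -/
def QCircuit.toffoliCount {ι : Type} : QCircuit ι → ℕ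
  | .done => 0
  | .gate g rest => g.toffoliCount + rest.toffoliCount
  | .measure _ next => max (next false).toffoliCount (next true).toffoliCount

/-- The Kraus operators of a circuit, one for each sequence of measurement outcomes. -/
noncomputable def QCircuit.kraus {ι : Type} [DecidableEq ι] :
    QCircuit ι → List (QState ι →ₗ[ℂ] QState ι)
  | .done => [LinearMap.id]
  | .gate g rest => rest.kraus.map fun A => A ∘ₗ g.apply
  | .measure i next =>
      ((next false).kraus.map fun A => A ∘ₗ outcomeProj i false) ++
        ((next true).kraus.map fun A => A ∘ₗ outcomeProj i true)

/-- The circuit carries out, exactly, the isometry `|inp a⟩ ↦ |out a⟩` on the span of the basis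
states `|inp a⟩`: whatever the measurement outcomes are, the final state is the intended one, up to
a scalar that depends on the outcomes only (so superpositions, also those entangled with other
systems, are mapped correctly). -/
def QCircuit.Implements {ι A : Type} [Fintype ι] [DecidableEq ι] (c : QCircuit ι)
    (inp out : A → ι → Bool) : Prop :=
  ∀ T ∈ c.kraus, ∃ α : ℂ, ∀ a : A, T (ket (inp a)) = α • ket (out a)

/-! ### The multiplexed sparse data-lookup oracle -/

/-- The qubits: a register for `j ∈ [J]`, one for `k ∈ [K]`, the `b`-qubit data register,
the register of `⌈log₂ Q⌉` qubits for the flat index `q ∈ [Q]`, and `clean` further clean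
ancillary qubits. There are no other (in particular no other dirty) qubits. -/
abbrev LookupQubits (J K b Q clean : ℕ) : Type :=
  Fin (Nat.clog 2 J) ⊕ Fin (Nat.clog 2 K) ⊕ Fin b ⊕ Fin (Nat.clog 2 Q) ⊕ Fin clean

/-- The basis label with `j`, `k` in binary (bit `i` has weight `2 ^ i`) in the index registers,
`z` in the data register and `0` in all other qubits. -/
def lookupLabel {J K b Q clean : ℕ} (j k : ℕ) (z : Fin b → Bool) :
    LookupQubits J K b Q clean → Bool :=
  Sum.elim (fun i => j.testBit i) <| Sum.elim (fun i => k.testBit i) <|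
    Sum.elim z <| Sum.elim (fun _ => false) (fun _ => false)

/-- The computation `|j⟩|k⟩|z⟩ ↦ |j⟩|k⟩|z ⊕ x_{j,k}⟩` for `j ∈ [J]`, `k ∈ [K_j]` and every `z`,
with all ancillary qubits starting and ending in `|0⟩`. -/
def ComputesLookup {J b : ℕ} {Ks : Fin J → ℕ} (x : (j : Fin J) → Fin (Ks j) → Fin b → Bool)
    {K Q clean : ℕ} (c : QCircuit (LookupQubits J K b Q clean)) : Prop :=
  c.Implements (A := (Σ j : Fin J, Fin (Ks j)) × (Fin b → Bool))
    (fun a => lookupLabel a.1.1 a.1.2 a.2)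
    (fun a => lookupLabel a.1.1 a.1.2 fun i => xor (a.2 i) (x a.1.1 a.1.2 i))

/-- The uncomputation `|j⟩|k⟩|x_{j,k}⟩ ↦ |j⟩|k⟩|0⟩` for `j ∈ [J]`, `k ∈ [K_j]`,
with all ancillary qubits starting and ending in `|0⟩`. -/
def UncomputesLookup {J b : ℕ} {Ks : Fin J → ℕ} (x : (j : Fin J) → Fin (Ks j) → Fin b → Bool)
    {K Q clean : ℕ} (c : QCircuit (LookupQubits J K b Q clean)) : Prop :=
  c.Implements (A := Σ j : Fin J, Fin (Ks j))
    (fun a => lookupLabel a.1 a.2 (x a.1 a.2))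
    (fun a => lookupLabel a.1 a.2 fun _ => false)

/-! ### Cost functions -/

/-- `m` is a power of two. -/
def IsPowTwo (m : ℕ) : Prop := ∃ i : ℕ, m = 2 ^ i

/-- Toffoli cost of clean-qubit lookup of `d` strings of `b` bits with `μ` duplicates of the
output register. -/
noncomputable def cleanCost (d b μ : ℕ) : ℝ := (d : ℝ) / (1 + μ) + μ * b

/-- Toffoli cost of clean-qubit uncomputation of a lookup of `d` strings, parameter `μ`. -/
noncomputable def cleanUncost (d μ : ℕ) : ℝ := (d : ℝ) / (1 + μ) + μ

open Classical in
/-- The admissible numbers `μ ≥ 1` of duplicates of a `w`-qubit output register when `n` dirty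
qubits are available: `μ * w ≤ n`, and `1 + μ` is a power of two. -/
noncomputable def dirtyChoices (w n : ℕ) : Finset ℕ :=
  (Finset.Icc 1 (n / w)).filter fun μ => IsPowTwo (1 + μ)

/-- Toffoli cost of lookup of `d` strings of `w` bits with `n` dirty qubits: the minimum of `d` and
of `2 d / (1 + μ) + 4 μ w` over the admissible `μ`. -/
noncomputable def dirtyCost (d w n : ℕ) : ℝ :=
  (dirtyChoices w n).fold min (d : ℝ) fun μ : ℕ => 2 * (d : ℝ) / (1 + μ) + 4 * μ * w

/-- Toffoli cost of uncomputation of a lookup of `d` strings of `w` bits with `n` dirty qubits: the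
minimum of `d` and of `2 d / (1 + μ) + 4 μ` over the admissible `μ`. -/
noncomputable def dirtyUncost (d w n : ℕ) : ℝ :=
  (dirtyChoices w n).fold min (d : ℝ) fun μ : ℕ => 2 * (d : ℝ) / (1 + μ) + 4 * μ

/-!
The oracle is reduced to lookups addressed by a single number. If `s j` is the number of entries in
the rows before row `j`, then `(j, k) ↦ s j + k` is a bijection of the index pairs with `[Q]`
(`Lookup.rowStart_add`). So one looks up `s j` from `j`, adds `k`, looks up the data from the flat
index, subtracts `k` and erases `s j` (`Lookup.exists_conj_flatIndex`).

A lookup `|h, l⟩|z⟩ ↦ |h, l⟩|z + x⟩` with `x = x_{h,l}` is, up to Hadamard gates on the target, the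
phase `(-1) ^ (z · x)`, and circuits are described by the relation `QCircuit.Acts`: basis labels are
mapped to basis labels with a sign that is a Boolean function. There are `m` registers, the target
and `m - 1` others, and `l < m`. Controlled swaps, here in the form of a network of *splits*, move
the contents of the target to register `l`; unary iteration over `h` then applies phases that are
linear in the contents of all registers, and the network is undone.

* If the other registers are clean, the network costs one Toffoli gate per bit and register, and it
  is undone by measurements, without Toffoli gates (`LookupLayout.toffoliCount_phaseClean`).
* If they are dirty, the network is reversed gate by gate, and a phase that depends on their
  contents is left over. All operations are linear in the contents of the registers, so this phase
  does not depend on `z`; a second pass with target `0` cancels it. The lookup for `j` therefore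
  costs twice as much, but it borrows the data register and the ancillas that are reserved for the
  lookup of the data (`Lookup.exists_row_xor`).

Unary iteration over `L` values uses `L - 1` Toffoli gates, as each AND is erased by a measurement.

To uncompute a looked-up word, one measures its qubits in the `X` basis; what remains is a sign that
is a function of the address (`QCircuit.acts_eraseAll`), that is, a lookup of single bits. This is
done for `s j` (`Lookup.exists_erase_row`), and for the data in the second part.

It remains to split the flat index into `h` and `l`. If the number of registers is a power of two,
these are its high and low bits; otherwise they are the quotient and the remainder of a long
division, which takes `O(log Q)` Toffoli gates and finitely many ancillas, with constants that
depend on the divisor only (`Lookup.exists_flatAddress`). If the number of words is smaller than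
that of registers, some registers are not used, and the bounds hold all the more.
-/

set_option linter.unusedSectionVars false
set_option linter.unusedSimpArgs false

open Function

/-! ### Circuits acting on basis states up to signs -/

namespace QCircuit

variable {ι : Type}

/-- Sequential composition: every branch of the first circuit is followed by the second one. -/
def seq : QCircuit ι → QCircuit ι → QCircuit ι
  | .done, d => d
  | .gate g rest, d => .gate g (rest.seq d)
  | .measure i next, d => .measure i fun o => (next o).seq d

instance : Append (QCircuit ι) := ⟨seq⟩

theorem toffoliCount_append (c d : QCircuit ι) :
    (c ++ d).toffoliCount = c.toffoliCount + d.toffoliCount := by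
  change (c.seq d).toffoliCount = _
  induction c with
  | done => simp [seq, toffoliCount]
  | gate g rest ih => simp [seq, toffoliCount, ih, add_assoc]
  | measure i next ih => simp only [seq, toffoliCount, ih]; omega

variable [DecidableEq ι]

theorem mem_kraus_append {c d : QCircuit ι} {T : QState ι →ₗ[ℂ] QState ι} :
    T ∈ (c ++ d).kraus → ∃ A ∈ c.kraus, ∃ B ∈ d.kraus, T = B ∘ₗ A := by
  change T ∈ (c.seq d).kraus → _
  induction c generalizing T with
  | done => intro h; exact ⟨LinearMap.id, by simp [kraus], T, h, rfl⟩
  | gate g rest ih =>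
    intro h
    simp only [seq, kraus, List.mem_map] at h
    obtain ⟨T', hT', rfl⟩ := h
    obtain ⟨A, hA, B, hB, rfl⟩ := ih hT'
    exact ⟨A ∘ₗ g.apply, by simpa [kraus] using ⟨A, hA, rfl⟩, B, hB, rfl⟩
  | measure i next ih =>
    intro h
    simp only [seq, kraus, List.mem_map, List.mem_append] at h
    rcases h with ⟨T', hT', rfl⟩ | ⟨T', hT', rfl⟩
    · obtain ⟨A, hA, B, hB, rfl⟩ := ih _ hT'
      exact ⟨A ∘ₗ outcomeProj i false, by
        simp only [kraus, List.mem_map, List.mem_append]; exact .inl ⟨A, hA, rfl⟩, B, hB, rfl⟩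
    · obtain ⟨A, hA, B, hB, rfl⟩ := ih _ hT'
      exact ⟨A ∘ₗ outcomeProj i true, by
        simp only [kraus, List.mem_map, List.mem_append]; exact .inr ⟨A, hA, rfl⟩, B, hB, rfl⟩

end QCircuit

/-- The sign `(-1) ^ s`. -/
def bsign (s : Bool) : ℂ := if s then -1 else 1

theorem bsign_add (s t : Bool) : bsign (s + t) = bsign s * bsign t := by
  cases s <;> cases t <;> simp [bsign, HAdd.hAdd, Add.add]

@[simp] theorem bsign_zero : bsign 0 = 1 := rfl

variable {ι A : Type} [Fintype ι] [DecidableEq ι]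

/-- The circuit maps `|inp a⟩` to `(-1) ^ φ a • |out a⟩` for every `a`, up to a scalar that depends
on the measurement outcomes only. Signs live in the Boolean ring `Bool`, whose addition is `xor`. -/
def QCircuit.Acts (c : QCircuit ι) (inp out : A → ι → Bool) (φ : A → Bool) : Prop :=
  ∀ T ∈ c.kraus, ∃ α : ℂ, ∀ a : A, T (ket (inp a)) = (α * bsign (φ a)) • ket (out a)

namespace QCircuit

theorem Acts.implements {c : QCircuit ι} {inp out : A → ι → Bool} (h : c.Acts inp out 0) :
    c.Implements inp out := by
  intro T hT
  obtain ⟨α, hα⟩ := h T hT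
  exact ⟨α, fun a => by simp [hα a]⟩

theorem Acts.congr {c : QCircuit ι} {inp inp' out out' : A → ι → Bool} {φ φ' : A → Bool}
    (h : c.Acts inp out φ) (hi : ∀ a, inp' a = inp a) (ho : ∀ a, out' a = out a)
    (hφ : ∀ a, φ' a = φ a) : c.Acts inp' out' φ' := by
  obtain rfl : inp' = inp := funext hi
  obtain rfl : out' = out := funext ho
  obtain rfl : φ' = φ := funext hφ
  exact h

theorem Acts.reindex {B : Type} {c : QCircuit ι} {inp out : A → ι → Bool} {φ : A → Bool}
    (h : c.Acts inp out φ) (f : B → A) :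
    c.Acts (fun b => inp (f b)) (fun b => out (f b)) (fun b => φ (f b)) := by
  intro T hT
  obtain ⟨α, hα⟩ := h T hT
  exact ⟨α, fun b => hα (f b)⟩

theorem acts_done {inp : A → ι → Bool} : (done : QCircuit ι).Acts inp inp 0 := by
  intro T hT
  simp only [kraus, List.mem_singleton] at hT
  subst hT
  exact ⟨1, fun a => by simp⟩

theorem Acts.append {c d : QCircuit ι} {inp mid out : A → ι → Bool} {φ ψ : A → Bool}
    (hc : c.Acts inp mid φ) (hd : d.Acts mid out ψ) :
    (c ++ d).Acts inp out (fun a => φ a + ψ a) := by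
  intro T hT
  obtain ⟨T₁, h₁, T₂, h₂, rfl⟩ := mem_kraus_append hT
  obtain ⟨α, hα⟩ := hc T₁ h₁
  obtain ⟨β, hβ⟩ := hd T₂ h₂
  refine ⟨α * β, fun a => ?_⟩
  rw [LinearMap.comp_apply, hα, map_smul, hβ, smul_smul, bsign_add]
  ring_nf

/-- Composition of circuits that produce no signs. -/
theorem Acts.append₀ {c d : QCircuit ι} {inp mid out : A → ι → Bool}
    (hc : c.Acts inp mid 0) (hd : d.Acts mid out 0) : (c ++ d).Acts inp out 0 :=
  (hc.append hd).congr (fun _ => rfl) (fun _ => rfl) (fun _ => rfl)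

/-! ### Elementary gates and gadgets -/

/-- The circuit consisting of a single gate. -/
def single (g : Gate ι) : QCircuit ι := .gate g .done

theorem mem_kraus_single {g : Gate ι} {T : QState ι →ₗ[ℂ] QState ι}
    (h : T ∈ (single g).kraus) : T = g.apply := by
  simp only [single, kraus, List.map_cons, List.map_nil, List.mem_singleton] at h
  rw [h]; rfl

/-- The CNOT gate; the degenerate case `c = t` is given the value `done`. -/
def cnot (c t : ι) : QCircuit ι := if h : c ≠ t then single (.cnot c t h) else .done

/-- The Toffoli gate; degenerate cases are given the value `done`. -/
def tof (c₁ c₂ t : ι) : QCircuit ι :=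
  if h : c₁ ≠ c₂ ∧ c₁ ≠ t ∧ c₂ ≠ t then single (.toffoli c₁ c₂ t h.1 h.2.1 h.2.2) else .done

/-- Pauli `Z`, as `S * S`. -/
def z (i : ι) : QCircuit ι := single (.phase i) ++ single (.phase i)

/-- Conjugation of a circuit by a Hadamard gate on `d`. -/
def conjH (d : ι) (c : QCircuit ι) : QCircuit ι := single (.had d) ++ c ++ single (.had d)

/-- Pauli `X`, as `H * Z * H`. -/
def x (i : ι) : QCircuit ι := conjH i (z i)

/-- The controlled `Z` gate. -/
def cz (i j : ι) : QCircuit ι := conjH j (cnot i j)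

theorem toffoliCount_cnot (c t : ι) : (cnot c t).toffoliCount = 0 := by
  unfold cnot; split <;> rfl

theorem toffoliCount_tof (c₁ c₂ t : ι) : (tof c₁ c₂ t).toffoliCount ≤ 1 := by
  unfold tof
  split
  · exact le_refl _
  · exact Nat.zero_le _

theorem toffoliCount_conjH (d : ι) (c : QCircuit ι) :
    (conjH d c).toffoliCount = c.toffoliCount := by
  simp [conjH, toffoliCount_append, single, toffoliCount, Gate.toffoliCount]

theorem toffoliCount_x (i : ι) : (x i).toffoliCount = 0 := toffoliCount_conjH i _

theorem toffoliCount_cz (i j : ι) : (cz i j).toffoliCount = 0 := by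
  simp [cz, toffoliCount_conjH, toffoliCount_cnot]

theorem ket_comp_involutive {σ : (ι → Bool) → ι → Bool} (hσ : Involutive σ) (v : ι → Bool) :
    (fun u => ket v (σ u)) = ket (σ v) := by
  funext u
  simp only [ket, Pi.single_apply]
  congr 1
  exact propext ⟨fun h => by rw [← h, hσ], fun h => by rw [h, hσ]⟩

theorem acts_cnot {c t : ι} (h : c ≠ t) (inp : A → ι → Bool) :
    (cnot c t).Acts inp (fun a => update (inp a) t (inp a t + inp a c)) 0 := by
  intro T hT
  rw [cnot, dif_pos h] at hT
  rw [mem_kraus_single hT]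
  refine ⟨1, fun a => ?_⟩
  have hσ : Involutive fun v : ι → Bool => update v t (xor (v t) (v c)) := by
    intro v
    simp [update_of_ne h]
  rw [Pi.zero_apply, bsign_zero, mul_one, one_smul]
  exact ket_comp_involutive hσ (inp a)

theorem acts_tof {c₁ c₂ t : ι} (h : c₁ ≠ c₂) (h₁ : c₁ ≠ t) (h₂ : c₂ ≠ t) (inp : A → ι → Bool) :
    (tof c₁ c₂ t).Acts inp (fun a => update (inp a) t (inp a t + inp a c₁ * inp a c₂)) 0 := by
  intro T hT
  rw [tof, dif_pos ⟨h, h₁, h₂⟩] at hT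
  rw [mem_kraus_single hT]
  refine ⟨1, fun a => ?_⟩
  have hσ : Involutive fun v : ι → Bool => update v t (xor (v t) (v c₁ && v c₂)) := by
    intro v
    simp [update_of_ne h₁, update_of_ne h₂]
  rw [Pi.zero_apply, bsign_zero, mul_one, one_smul]
  exact ket_comp_involutive hσ (inp a)

theorem acts_z (i : ι) (inp : A → ι → Bool) : (z i).Acts inp inp (fun a => inp a i) := by
  have hp (v : ι → Bool) :
      (Gate.phase i).apply (ket v) = (if v i then Complex.I else 1) • ket v := by
    funext u
    simp only [Gate.apply, LinearMap.coe_mk, AddHom.coe_mk, ket, Pi.single_apply, Pi.smul_apply,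
      smul_eq_mul]
    by_cases h : u = v <;> simp [h]
  intro T hT
  obtain ⟨T₁, h₁, T₂, h₂, rfl⟩ := mem_kraus_append hT
  rw [mem_kraus_single h₁, mem_kraus_single h₂]
  refine ⟨1, fun a => ?_⟩
  rw [LinearMap.comp_apply, hp, map_smul, hp, smul_smul]
  congr 1
  cases h : inp a i <;> simp [bsign, h]

/-- The state of `|v⟩` with qubit `d` replaced by `(|0⟩ + (-1) ^ s |1⟩) / √2`. -/
noncomputable def hadKet (d : ι) (v : ι → Bool) (s : Bool) : QState ι :=
  ((Real.sqrt 2 : ℝ) : ℂ)⁻¹ • (ket (update v d false) + bsign s • ket (update v d true))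

theorem had_ket (d : ι) (v : ι → Bool) : (Gate.had d).apply (ket v) = hadKet d v (v d) := by
  funext u
  simp only [Gate.apply, LinearMap.coe_mk, AddHom.coe_mk, hadKet, ket, Pi.single_apply,
    Pi.smul_apply, Pi.add_apply, smul_eq_mul, update_eq_iff, eq_update_iff]
  by_cases h : ∀ w, w ≠ d → u w = v w
  · cases hu : u d <;> cases hv : v d <;> simp [h, bsign]
  · simp [h]

theorem had_hadKet (d : ι) (v : ι → Bool) (s : Bool) :
    (Gate.had d).apply (hadKet d v s) = ket (update v d s) := by
  have h2 : ((Real.sqrt 2 : ℝ) : ℂ)⁻¹ * ((Real.sqrt 2 : ℝ) : ℂ)⁻¹ = 1 / 2 := by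
    rw [← mul_inv, ← Complex.ofReal_mul, Real.mul_self_sqrt (by norm_num)]; norm_num
  rw [hadKet, map_smul, map_add, map_smul, had_ket, had_ket]
  simp only [hadKet, update_idem, update_self]
  generalize ((Real.sqrt 2 : ℝ) : ℂ)⁻¹ = κ at h2
  cases s
  · simp only [bsign, Bool.false_eq_true, if_false, if_true, one_smul, neg_smul]
    trans (2 * (κ * κ)) • ket (update v d false)
    · module
    · rw [h2]; norm_num
  · simp only [bsign, Bool.false_eq_true, if_false, if_true, one_smul, neg_smul]
    trans (2 * (κ * κ)) • ket (update v d true)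
    · module
    · rw [h2]; norm_num

/-- A phase linear in qubit `d` becomes, between two Hadamard gates on `d`, an addition to `d`. -/
theorem Acts.conjH {c : QCircuit ι} {d : ι} {inp out : A → ι → Bool} {φ y : A → Bool}
    (h : c.Acts (fun p : A × Bool => update (inp p.1) d p.2)
      (fun p => update (out p.1) d p.2) (fun p => φ p.1 + p.2 * y p.1)) :
    (conjH d c).Acts inp (fun a => update (out a) d (inp a d + y a)) φ := by
  intro T hT
  obtain ⟨T₁₂, h₁₂, T₃, h₃, rfl⟩ := mem_kraus_append hT
  obtain ⟨T₁, h₁, T₂, h₂, rfl⟩ := mem_kraus_append h₁₂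
  obtain ⟨α, hα⟩ := h T₂ h₂
  refine ⟨α, fun a => ?_⟩
  have h0 := hα (a, false)
  have h1 := hα (a, true)
  have key : T₂ (hadKet d (inp a) (inp a d)) =
      (α * bsign (φ a)) • hadKet d (out a) (inp a d + y a) := by
    simp only at h0 h1
    rw [hadKet, map_smul, map_add, map_smul, h0, h1, hadKet]
    have e0 : φ a + false * y a = φ a := by cases φ a <;> rfl
    have e1 : φ a + true * y a = φ a + y a := rfl
    rw [e0, e1, bsign_add, bsign_add]
    module
  rw [LinearMap.comp_apply, LinearMap.comp_apply, mem_kraus_single h₁, mem_kraus_single h₃,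
    had_ket, key, map_smul, had_hadKet]

/-- An addition to qubit `d` becomes, between two Hadamard gates on `d`, a phase. -/
theorem Acts.conjH_dual {c : QCircuit ι} {d : ι} {inp out : A → ι → Bool} {φ y : A → Bool}
    (h : c.Acts (fun p : A × Bool => update (inp p.1) d p.2)
      (fun p => update (out p.1) d (p.2 + y p.1)) (fun p => φ p.1)) :
    (QCircuit.conjH d c).Acts inp (fun a => update (out a) d (inp a d))
      (fun a => φ a + inp a d * y a) := by
  intro T hT
  obtain ⟨T₁₂, h₁₂, T₃, h₃, rfl⟩ := mem_kraus_append hT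
  obtain ⟨T₁, h₁, T₂, h₂, rfl⟩ := mem_kraus_append h₁₂
  obtain ⟨α, hα⟩ := h T₂ h₂
  refine ⟨α, fun a => ?_⟩
  have h0 := hα (a, false)
  have h1 := hα (a, true)
  have key : T₂ (hadKet d (inp a) (inp a d)) =
      (α * bsign (φ a + inp a d * y a)) • hadKet d (out a) (inp a d) := by
    simp only at h0 h1
    rw [hadKet, map_smul, map_add, map_smul, h0, h1, hadKet, bsign_add]
    cases y a
    · have e0 : false + false = false := rfl
      have e1 : true + false = true := rfl
      have e2 : inp a d * false = false := by cases inp a d <;> rfl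
      rw [e0, e1, e2]
      simp only [bsign, Bool.false_eq_true, if_false, if_true]
      module
    · have e0 : false + true = true := rfl
      have e1 : true + true = false := rfl
      have e2 : inp a d * true = inp a d := by cases inp a d <;> rfl
      rw [e0, e1, e2]
      cases inp a d
      · simp only [bsign, Bool.false_eq_true, if_false, if_true]
        module
      · simp only [bsign, Bool.false_eq_true, if_false, if_true]
        module
  rw [LinearMap.comp_apply, LinearMap.comp_apply, mem_kraus_single h₁, mem_kraus_single h₃,
    had_ket, key, map_smul, had_hadKet]

theorem acts_x (i : ι) (inp : A → ι → Bool) :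
    (x i).Acts inp (fun a => update (inp a) i (!inp a i)) 0 := by
  refine (Acts.conjH (out := inp) (y := fun _ => true) (φ := 0)
    ((acts_z i _).congr (fun _ => rfl) (fun _ => rfl) ?_)).congr (fun _ => rfl) ?_ (fun _ => rfl)
  · rintro ⟨a, o⟩
    cases o <;> simp <;> rfl
  · intro a
    cases h : inp a i <;> rfl

theorem acts_cz {i j : ι} (h : i ≠ j) (inp : A → ι → Bool) :
    (cz i j).Acts inp inp (fun a => inp a i * inp a j) := by
  refine (Acts.conjH_dual (out := inp) (y := fun a => inp a i) (φ := 0)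
    ((acts_cnot h _).congr (fun _ => rfl) ?_ (fun _ => rfl))).congr (fun _ => rfl) ?_ ?_
  · rintro ⟨a, o⟩
    simp [update_of_ne h]
  · simp
  · intro a
    simp [mul_comm]

/-- Measurement of qubit `d` in the `X` basis and reset to `|0⟩`, followed by a circuit that may
depend on the outcome. -/
def eraseX (d : ι) (cont : Bool → QCircuit ι) : QCircuit ι :=
  .gate (.had d) (.measure d fun o => (if o then x d else .done) ++ cont o)

theorem toffoliCount_eraseX {d : ι} {cont : Bool → QCircuit ι} {n : ℕ}
    (h : ∀ o, (cont o).toffoliCount ≤ n) : (eraseX d cont).toffoliCount ≤ n := by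
  simp only [eraseX, toffoliCount, toffoliCount_append, Gate.toffoliCount]
  have h0 := h false
  have h1 := h true
  simp [toffoliCount_x, toffoliCount, h0, h1]

/-- Outcome `o` of the measurement in the `X` basis leaves the phase `(-1) ^ (o * s)` where `s` is
the erased bit; it remains to remove that phase. -/
theorem Acts.eraseX {d : ι} {cont : Bool → QCircuit ι} {inp out : A → ι → Bool} {φ : A → Bool}
    (h : ∀ o, (cont o).Acts (fun a => update (inp a) d false) out
      (fun a => φ a + o * inp a d)) : (QCircuit.eraseX d cont).Acts inp out φ := by
  have hproj (v : ι → Bool) (o s : Bool) : outcomeProj d o (hadKet d v s) =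
      (((Real.sqrt 2 : ℝ) : ℂ)⁻¹ * bsign (o * s)) • ket (update v d o) := by
    have hp (v : ι → Bool) : outcomeProj d o (ket v) = if v d = o then ket v else 0 := by
      funext u
      simp only [outcomeProj, LinearMap.coe_mk, AddHom.coe_mk, ket, Pi.single_apply]
      by_cases h : u = v
      · subst h; by_cases h : u d = o <;> simp [h]
      · by_cases h' : v d = o <;> simp [h, h']
    rw [hadKet, map_smul, map_add, map_smul, hp, hp]
    have e0 : false * s = false := rfl
    have e1 : true * s = s := by cases s <;> rfl
    cases o
    · simp [e0, bsign]
    · simp [e1, smul_smul]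
  intro T hT
  have key : ∃ o, ∃ B ∈ ((if o then x d else .done) ++ cont o).kraus,
      T = (B ∘ₗ outcomeProj d o) ∘ₗ (Gate.had d).apply := by
    simp only [QCircuit.eraseX, kraus, List.map_append, List.map_map, List.mem_append,
      List.mem_map, comp_apply] at hT
    rcases hT with ⟨B, hB, rfl⟩ | ⟨B, hB, rfl⟩
    · exact ⟨false, B, hB, rfl⟩
    · exact ⟨true, B, hB, rfl⟩
  obtain ⟨o, B, hB, rfl⟩ := key
  have hreset : (if o then x d else .done : QCircuit ι).Acts (fun a => update (inp a) d o)
      (fun a => update (inp a) d false) 0 := by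
    cases o
    · exact acts_done
    · exact (acts_x d _).congr (fun _ => rfl) (fun a => by simp) (fun _ => rfl)
  obtain ⟨β, hβ⟩ := (hreset.append (h o)) B hB
  refine ⟨((Real.sqrt 2 : ℝ) : ℂ)⁻¹ * β, fun a => ?_⟩
  rw [LinearMap.comp_apply, LinearMap.comp_apply, had_ket, hproj, map_smul, hβ, smul_smul]
  congr 1
  have hz : (0 : A → Bool) a + (φ a + o * inp a d) = φ a + o * inp a d := by simp
  have hs : bsign (o * inp a d) * bsign (o * inp a d) = 1 := by
    cases o * inp a d <;> simp [bsign]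
  simp only [hz, bsign_add]
  linear_combination ((Real.sqrt 2 : ℝ) : ℂ)⁻¹ * β * bsign (φ a) * hs

/-- Erasure of a qubit that holds the conjunction of two others, without Toffoli gates. -/
def unAnd (c₁ c₂ t : ι) : QCircuit ι := eraseX t fun o => if o then cz c₁ c₂ else .done

theorem toffoliCount_unAnd (c₁ c₂ t : ι) : (unAnd c₁ c₂ t).toffoliCount = 0 := by
  refine Nat.le_zero.1 (toffoliCount_eraseX ?_)
  rintro (_ | _)
  · exact le_refl _
  · exact (toffoliCount_cz c₁ c₂).le

theorem acts_unAnd {c₁ c₂ t : ι} (h : c₁ ≠ c₂) (h₁ : c₁ ≠ t) (h₂ : c₂ ≠ t) {inp : A → ι → Bool}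
    (ht : ∀ a, inp a t = inp a c₁ * inp a c₂) :
    (unAnd c₁ c₂ t).Acts inp (fun a => update (inp a) t false) 0 := by
  refine Acts.eraseX ?_
  rintro (_ | _)
  · exact acts_done.congr (fun _ => rfl) (fun _ => rfl) (fun a => by cases inp a t <;> rfl)
  · refine (acts_cz h _).congr (fun _ => rfl) (fun _ => rfl) (fun a => ?_)
    simp only [Pi.zero_apply, zero_add, update_of_ne h₁, update_of_ne h₂, ht a]
    exact one_mul (inp a c₁ * inp a c₂)

end QCircuit

/-! ### Linear phases and unary iteration -/

/-- The linear functional with coefficients `W` on bit strings over the field with two elements. -/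
def wsum (W v : ι → Bool) : Bool := ∑ r, W r * v r

theorem wsum_update_right (W v : ι → Bool) (r : ι) (y : Bool) :
    wsum W (update v r y) = wsum W v + W r * (v r + y) := by
  have h (v : ι → Bool) : wsum W v = W r * v r + ∑ s ∈ Finset.univ.erase r, W s * v s :=
    (Finset.add_sum_erase _ _ (Finset.mem_univ r)).symm
  rw [h, h v, update_self, Finset.sum_congr rfl fun s hs => by
    rw [update_of_ne (Finset.ne_of_mem_erase hs)]]
  generalize W r = a
  generalize v r = b
  generalize (∑ s ∈ Finset.univ.erase r, W s * v s : Bool) = c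
  revert a b c y
  decide

theorem wsum_comm (W v : ι → Bool) : wsum W v = wsum v W := by simp [wsum, mul_comm]

theorem wsum_update_left (W v : ι → Bool) (r : ι) (y : Bool) :
    wsum (update W r y) v = wsum W v + (W r + y) * v r := by
  rw [wsum_comm, wsum_update_right, wsum_comm, mul_comm]

theorem wsum_add_right (W v v' : ι → Bool) : wsum W (v + v') = wsum W v + wsum W v' := by
  simp [wsum, mul_add, Finset.sum_add_distrib]

theorem wsum_update_of_false {W : ι → Bool} {r : ι} (h : W r = false) (v : ι → Bool) (y : Bool) :
    wsum W (update v r y) = wsum W v := by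
  rw [wsum_update_right, h]
  exact (congrArg _ (zero_mul (v r + y))).trans (add_zero (wsum W v))

/-- A linear functional evaluated on a string that it meets only in the qubits `out i`. -/
theorem wsum_eq_sum {b : ℕ} {W v : ι → Bool} {out : Fin b → ι} (hout : Injective out)
    (h : ∀ r, r ∉ Set.range out → W r = true → v r = false) :
    wsum W v = ∑ i, W (out i) * v (out i) := by
  refine (Fintype.sum_of_injective out hout _ _ (fun r hr => ?_) fun _ => rfl).symm
  cases hW : W r
  · exact zero_mul (v r)
  · rw [h r hr hW]; rfl

theorem mod_two_pow_succ_of_testBit {h d : ℕ} :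
    h % 2 ^ (d + 1) = h % 2 ^ d + if h.testBit d then 2 ^ d else 0 := by
  rw [Nat.testBit_eq_decide_div_mod_eq, pow_succ, Nat.mod_mul]
  rcases Nat.mod_two_eq_zero_or_one (h / 2 ^ d) with h0 | h0 <;> simp [h0]

namespace QCircuit

/-- The value of an optional control qubit; an absent control counts as `1`. -/
def ctrlVal (u : Option ι) (v : ι → Bool) : Bool := u.elim true v

/-- `Z` gates on the listed qubits, optionally controlled. -/
def condZs (u : Option ι) : List ι → QCircuit ι
  | [] => .done
  | r :: l => u.elim (z r) (fun c => cz c r) ++ condZs u l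

theorem toffoliCount_condZs (u : Option ι) (l : List ι) : (condZs u l).toffoliCount = 0 := by
  induction l with
  | nil => rfl
  | cons r l ih =>
    rw [condZs, toffoliCount_append, ih]
    cases u
    · rfl
    · exact toffoliCount_cz _ _

theorem acts_condZs (u : Option ι) (l : List ι) (h : ∀ r ∈ l, u ≠ some r) (inp : A → ι → Bool) :
    (condZs u l).Acts inp inp (fun a => ctrlVal u (inp a) * (l.map (inp a)).sum) := by
  induction l with
  | nil => exact acts_done.congr (fun _ => rfl) (fun _ => rfl) fun a => by simp
  | cons r l ih =>
    have ih := ih fun r hr => h r (List.mem_cons_of_mem _ hr)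
    have h1 : (u.elim (z r) (fun c => cz c r)).Acts inp inp
        (fun a => ctrlVal u (inp a) * inp a r) := by
      cases u with
      | none =>
        exact (acts_z r inp).congr (fun _ => rfl) (fun _ => rfl) fun a => one_mul (inp a r)
      | some c => exact acts_cz (fun hc => h r List.mem_cons_self (congrArg some hc)) inp
    refine (h1.append ih).congr (fun _ => rfl) (fun _ => rfl) fun a => ?_
    rw [List.map_cons, List.sum_cons, mul_add]

/-- The optionally controlled phase `(-1) ^ wsum W v`. -/
noncomputable def condPhase (u : Option ι) (W : ι → Bool) : QCircuit ι :=
  condZs u (Finset.univ.filter fun r => W r = true).toList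

theorem acts_condPhase (u : Option ι) (W : ι → Bool) (h : ∀ c, u = some c → W c = false)
    (inp : A → ι → Bool) :
    (condPhase u W).Acts inp inp (fun a => ctrlVal u (inp a) * wsum W (inp a)) := by
  refine (acts_condZs u _ (fun r hr hu => ?_) inp).congr (fun _ => rfl) (fun _ => rfl) fun a => ?_
  · have := h r hu
    simp [this] at hr
  · rw [Finset.sum_map_toList, Finset.sum_filter, wsum]
    congr 1
    refine Finset.sum_congr rfl fun r _ => ?_
    cases W r
    · exact zero_mul (inp a r)
    · exact one_mul (inp a r)

/-- Unary iteration: for the number `h < 2 ^ d` in the qubits `addr i`, `i < d`, it applies the phase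
`wsum (Y (off + h))`, optionally controlled. Only `off + h < L` is provided for; a level of the
binary tree all of whose right half is beyond `L` costs nothing. The ancillas `anc i` hold
conjunctions of the control with address bits. -/
noncomputable def select (addr anc : ℕ → ι) (L : ℕ) (Y : ℕ → ι → Bool) :
    ℕ → Option ι → ℕ → QCircuit ι
  | 0, u, off => condPhase u (Y off)
  | d + 1, u, off =>
    if off + 2 ^ d < L then
      match u with
      | none =>
        select addr anc L Y d (some (addr d)) (off + 2 ^ d) ++ x (addr d) ++
          select addr anc L Y d (some (addr d)) off ++ x (addr d)
      | some u =>
        tof u (addr d) (anc d) ++ select addr anc L Y d (some (anc d)) (off + 2 ^ d) ++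
          cnot u (anc d) ++ select addr anc L Y d (some (anc d)) off ++
          cnot u (anc d) ++ unAnd u (addr d) (anc d)
    else select addr anc L Y d u off

variable {addr anc : ℕ → ι} {L : ℕ} {Y : ℕ → ι → Bool}

theorem select_zero (u : Option ι) (off : ℕ) :
    select addr anc L Y 0 u off = condPhase u (Y off) := rfl

/-- The tree of a unary iteration has one Toffoli gate for each inner node with two children. -/
theorem toffoliCount_select (d : ℕ) (u : Option ι) {off : ℕ} (h : off < L) :
    (select addr anc L Y d u off).toffoliCount + 1 ≤ min (2 ^ d) (L - off) := by
  induction d generalizing u off with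
  | zero =>
    rw [select_zero, condPhase, toffoliCount_condZs]
    omega
  | succ d ih =>
    rw [select.eq_def]
    have hp : 2 ^ (d + 1) = 2 ^ d + 2 ^ d := by ring
    dsimp only
    split
    next hlt =>
      cases u with
      | none =>
        have h1 := ih (some (addr d)) hlt
        have h2 := ih (some (addr d)) h
        simp only [toffoliCount_append, toffoliCount_x]
        omega
      | some u =>
        have h1 := ih (some (anc d)) hlt
        have h2 := ih (some (anc d)) h
        have h3 := toffoliCount_tof u (addr d) (anc d)
        simp only [toffoliCount_append, toffoliCount_cnot, toffoliCount_unAnd]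
        omega
    next hlt =>
      have h1 := ih u h
      omega

/-- If the control is off, all ancillas stay `0`, and the range of `h` does not matter. -/
theorem acts_select_some {d : ℕ} {u : ι} {off : ℕ} {inp : A → ι → Bool} {h : A → ℕ}
    (hu : ∀ i < d, u ≠ addr i ∧ u ≠ anc i)
    (hne : ∀ i < d, ∀ j < d, addr i ≠ anc j)
    (hanc : ∀ j < d, ∀ i < j, anc i ≠ anc j)
    (hYu : ∀ k, Y k u = false) (hYanc : ∀ k, ∀ i < d, Y k (anc i) = false)
    (h_addr : ∀ a, ∀ i < d, inp a (addr i) = (h a).testBit i)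
    (h_anc : ∀ a, ∀ i < d, inp a (anc i) = false)
    (h_lt : ∀ a, inp a u = true → off + h a % 2 ^ d < L) :
    (select addr anc L Y d (some u) off).Acts inp inp
      (fun a => inp a u * wsum (Y (off + h a % 2 ^ d)) (inp a)) := by
  induction d generalizing u off inp with
  | zero =>
    refine (acts_condPhase (some u) (Y off) (fun c hc => ?_) inp).congr (fun _ => rfl)
      (fun _ => rfl) fun a => ?_
    · cases hc; exact hYu off
    · simp [ctrlVal, Nat.mod_one]
  | succ d ih =>
    rw [select]
    obtain ⟨hua, huc⟩ := hu d d.lt_succ_self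
    have hac := hne d d.lt_succ_self d d.lt_succ_self
    split
    next hlt =>
      have IH := fun (off : ℕ) (inp : A → ι → Bool)
        (h1 : ∀ a, ∀ i < d, inp a (addr i) = (h a).testBit i)
        (h2 : ∀ a, ∀ i < d, inp a (anc i) = false) =>
        ih (u := anc d) (off := off) (inp := inp)
          (fun i hi => ⟨(hne i (by omega) d (by omega)).symm, (hanc d (by omega) i hi).symm⟩)
          (fun i hi j hj => hne i (by omega) j (by omega))
          (fun j hj i hi => hanc j (by omega) i hi)
          (fun k => hYanc k d (by omega)) (fun k i hi => hYanc k i (by omega)) h1 h2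
      have e_addr (y : A → Bool) (a : A) (i : ℕ) (hi : i < d) :
          update (inp a) (anc d) (y a) (addr i) = (h a).testBit i := by
        rw [update_of_ne (hne i (by omega) d (by omega)), h_addr a i (by omega)]
      have e_anc (y : A → Bool) (a : A) (i : ℕ) (hi : i < d) :
          update (inp a) (anc d) (y a) (anc i) = false := by
        rw [update_of_ne (hanc d (by omega) i hi), h_anc a i (by omega)]
      have s1 := acts_tof hua huc hac inp
      have s2 := IH (off + 2 ^ d) _ (e_addr fun a => inp a (anc d) + inp a u * inp a (addr d))
        (e_anc _) (fun a ha => by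
          rw [update_self, h_anc a d (by omega), h_addr a d (by omega)] at ha
          have : inp a u = true ∧ (h a).testBit d = true := by
            revert ha
            generalize inp a u = s
            generalize (h a).testBit d = t
            revert s t
            decide
          have hl := h_lt a this.1
          rw [mod_two_pow_succ_of_testBit, if_pos this.2] at hl
          omega)
      have s3 := acts_cnot huc
        (fun a => update (inp a) (anc d) (inp a (anc d) + inp a u * inp a (addr d)))
      have s3' := s3.congr (out' := fun a => update (inp a) (anc d)
          (inp a (anc d) + inp a u * inp a (addr d) + inp a u)) (fun _ => rfl)
        (fun a => by simp [update_of_ne huc]) (fun _ => rfl)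
      have s4 := IH off _ (e_addr fun a => inp a (anc d) + inp a u * inp a (addr d) + inp a u)
        (e_anc _) (fun a ha => by
          rw [update_self, h_anc a d (by omega), h_addr a d (by omega)] at ha
          have : inp a u = true ∧ (h a).testBit d = false := by
            revert ha
            generalize inp a u = s
            generalize (h a).testBit d = t
            revert s t
            decide
          have hl := h_lt a this.1
          rw [mod_two_pow_succ_of_testBit, if_neg (by simp [this.2])] at hl
          omega)
      have s5 := (acts_cnot huc (fun a => update (inp a) (anc d)
          (inp a (anc d) + inp a u * inp a (addr d) + inp a u))).congr
        (out' := fun a => update (inp a) (anc d) (inp a u * inp a (addr d))) (fun _ => rfl)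
        (fun a => by
          simp only [update_self, update_of_ne huc, update_idem, h_anc a d d.lt_succ_self]
          congr 1
          generalize inp a u = s
          generalize inp a (addr d) = t
          revert s t
          decide) (fun _ => rfl)
      have s6 := (acts_unAnd hua huc hac
        (inp := fun a => update (inp a) (anc d) (inp a u * inp a (addr d)))
        (fun a => by simp [update_of_ne hua, update_of_ne huc, update_of_ne hac])).congr
        (out' := inp) (fun _ => rfl)
        (fun a => by simp [← h_anc a d d.lt_succ_self]) (fun _ => rfl)
      refine (((((s1.append s2).append s3').append s4).append s5).append s6).congr (fun _ => rfl)
        (fun _ => rfl) fun a => ?_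
      have hY (k : ℕ) (y : Bool) : wsum (Y k) (update (inp a) (anc d) y) = wsum (Y k) (inp a) :=
        wsum_update_of_false (hYanc k d (by omega)) _ _
      simp only [hY, update_self, Pi.zero_apply, h_anc a d d.lt_succ_self, h_addr a d d.lt_succ_self]
      rw [mod_two_pow_succ_of_testBit]
      cases hb : (h a).testBit d
      · rw [if_neg (by simp), add_zero]
        generalize wsum _ (inp a) = p
        generalize wsum _ (inp a) = q
        generalize inp a u = s
        revert p q s
        decide
      · rw [if_pos rfl, show off + 2 ^ d + h a % 2 ^ d = off + (h a % 2 ^ d + 2 ^ d) by ring]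
        generalize wsum _ (inp a) = p
        generalize wsum _ (inp a) = q
        generalize inp a u = s
        revert p q s
        decide
    next hlt =>
      have hb (a : A) (ha : inp a u = true) : h a % 2 ^ (d + 1) = h a % 2 ^ d := by
        have hl := h_lt a ha
        rw [mod_two_pow_succ_of_testBit] at hl ⊢
        split at hl
        · omega
        · rename_i hb
          rw [if_neg hb, add_zero]
      refine (ih (off := off) (inp := inp) (fun i hi => hu i (by omega))
        (fun i hi j hj => hne i (by omega) j (by omega))
        (fun j hj i hi => hanc j (by omega) i hi) hYu (fun k i hi => hYanc k i (by omega))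
        (fun a i hi => h_addr a i (by omega)) (fun a i hi => h_anc a i (by omega))
        (fun a ha => hb a ha ▸ h_lt a ha)).congr (fun _ => rfl) (fun _ => rfl) fun a => ?_
      cases ha : inp a u
      · exact (zero_mul (wsum _ (inp a))).trans (zero_mul (wsum _ (inp a))).symm
      · rw [hb a ha]

/-- Without a control, the top address bit controls the two halves, so that an iteration over `d`
bits needs `d - 1` ancillas. -/
theorem acts_select_none {d : ℕ} {off : ℕ} {inp : A → ι → Bool} {h : A → ℕ}
    (haddr : ∀ j < d, ∀ i < j, addr i ≠ addr j)
    (hne : ∀ i < d, ∀ j, j + 1 < d → addr i ≠ anc j)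
    (hanc : ∀ j, j + 1 < d → ∀ i < j, anc i ≠ anc j)
    (hYaddr : ∀ k, ∀ i < d, Y k (addr i) = false)
    (hYanc : ∀ k i, i + 1 < d → Y k (anc i) = false)
    (h_addr : ∀ a, ∀ i < d, inp a (addr i) = (h a).testBit i)
    (h_anc : ∀ a i, i + 1 < d → inp a (anc i) = false)
    (h_lt : ∀ a, off + h a % 2 ^ d < L) :
    (select addr anc L Y d none off).Acts inp inp
      (fun a => wsum (Y (off + h a % 2 ^ d)) (inp a)) := by
  induction d generalizing off with
  | zero =>
    refine (acts_condPhase none (Y off) (fun c hc => by cases hc) inp).congr (fun _ => rfl)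
      (fun _ => rfl) fun a => ?_
    rw [pow_zero, Nat.mod_one, add_zero]
    exact (one_mul (wsum _ (inp a))).symm
  | succ d ih =>
    rw [select]
    split
    next hlt =>
      have IH := fun (off : ℕ) (inp : A → ι → Bool)
        (h1 : ∀ a, ∀ i < d, inp a (addr i) = (h a).testBit i)
        (h2 : ∀ a, ∀ i < d, inp a (anc i) = false) =>
        acts_select_some (L := L) (Y := Y) (u := addr d) (off := off) (inp := inp)
          (fun i hi => ⟨(haddr d (by omega) i hi).symm, hne d (by omega) i (by omega)⟩)
          (fun i hi j hj => hne i (by omega) j (by omega))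
          (fun j hj i hi => hanc j (by omega) i hi)
          (fun k => hYaddr k d (by omega)) (fun k i hi => hYanc k i (by omega)) h1 h2
      have s1 := IH (off + 2 ^ d) inp (fun a i hi => h_addr a i (by omega))
        (fun a i hi => h_anc a i (by omega)) (fun a ha => by
          rw [h_addr a d (by omega)] at ha
          have hl := h_lt a
          rw [mod_two_pow_succ_of_testBit, if_pos ha] at hl
          omega)
      have s2 := acts_x (addr d) inp
      have s3 := IH off (fun a => update (inp a) (addr d) (!inp a (addr d)))
        (fun a i hi => by
          rw [update_of_ne (haddr d (by omega) i hi), h_addr a i (by omega)])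
        (fun a i hi => by
          rw [update_of_ne (hne d (by omega) i (by omega)).symm, h_anc a i (by omega)])
        (fun a ha => by
          rw [update_self, h_addr a d (by omega)] at ha
          have hl := h_lt a
          rw [mod_two_pow_succ_of_testBit] at hl
          omega)
      have s4 := (acts_x (addr d) (fun a => update (inp a) (addr d) (!inp a (addr d)))).congr
        (out' := inp) (fun _ => rfl) (fun a => by simp) (fun _ => rfl)
      refine (((s1.append s2).append s3).append s4).congr (fun _ => rfl) (fun _ => rfl) fun a => ?_
      have hY (k : ℕ) (y : Bool) : wsum (Y k) (update (inp a) (addr d) y) = wsum (Y k) (inp a) :=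
        wsum_update_of_false (hYaddr k d (by omega)) _ _
      simp only [hY, update_self, Pi.zero_apply, h_addr a d d.lt_succ_self]
      rw [mod_two_pow_succ_of_testBit]
      cases hb : (h a).testBit d
      · rw [if_neg (by simp), add_zero]
        generalize wsum _ (inp a) = p
        generalize wsum _ (inp a) = q
        revert p q
        decide
      · rw [if_pos rfl, show off + 2 ^ d + h a % 2 ^ d = off + (h a % 2 ^ d + 2 ^ d) by ring]
        generalize wsum _ (inp a) = p
        generalize wsum _ (inp a) = q
        revert p q
        decide
    next hlt =>
      have hb (a : A) : h a % 2 ^ (d + 1) = h a % 2 ^ d := by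
        have hl := h_lt a
        rw [mod_two_pow_succ_of_testBit] at hl ⊢
        split at hl
        · omega
        · rename_i hb
          rw [if_neg hb, add_zero]
      simp only [hb]
      exact ih (fun j hj i hi => haddr j (by omega) i hi)
        (fun i hi j hj => hne i (by omega) j (by omega))
        (fun j hj i hi => hanc j (by omega) i hi)
        (fun k i hi => hYaddr k i (by omega)) (fun k i hi => hYanc k i (by omega))
        (fun a i hi => h_addr a i (by omega)) (fun a i hi => h_anc a i (by omega))
        (fun a => hb a ▸ h_lt a)

end QCircuit

/-! ### Splitting networks -/

/-- The operation that moves the bit of qubit `src` to qubit `dst` if `ctrl` is set (for `dst`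
initially `0`). For a fixed value of `ctrl` it is linear also in a nonzero content of `dst`. -/
structure Split (ι : Type) where
  ctrl : ι
  src : ι
  dst : ι

namespace Split

/-- The effect of a split on a basis label. -/
def app (t : Split ι) (v : ι → Bool) : ι → Bool :=
  update (update v t.dst (v t.dst + v t.ctrl * v t.src)) t.src
    (v t.src + (v t.dst + v t.ctrl * v t.src))

/-- The transpose of a split, acting on coefficients of linear functionals; `v` serves to read the
control qubit. -/
def pull (t : Split ι) (v W : ι → Bool) : ι → Bool :=
  update (update W t.dst (W t.dst + W t.src)) t.src (if v t.ctrl then W t.dst else W t.src)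

theorem wsum_app {t : Split ι} (h : t.src ≠ t.dst) (W v : ι → Bool) :
    wsum W (t.app v) = wsum (t.pull v W) v := by
  rw [app, pull, wsum_update_right, wsum_update_right, wsum_update_left, wsum_update_left,
    update_of_ne h, update_of_ne h]
  generalize wsum W v = s
  generalize v t.ctrl = a
  generalize v t.src = p
  generalize v t.dst = n
  generalize W t.src = x
  generalize W t.dst = y
  revert s a p n x y
  decide

theorem app_of_notMem {t : Split ι} {M : Set ι} (hs : t.src ∈ M) (hd : t.dst ∈ M) (v : ι → Bool)
    {i : ι} (hi : i ∉ M) : t.app v i = v i := by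
  rw [app, update_of_ne (fun h => hi (by rwa [h])), update_of_ne (fun h => hi (by rwa [h]))]

/-- The transpose of a sequence of splits, performed in the order of the list. -/
def pullAll (v : ι → Bool) : List (Split ι) → (ι → Bool) → ι → Bool
  | [], W => W
  | t :: ts, W => t.pull v (pullAll v ts W)

theorem pullAll_append (v : ι → Bool) (ts us : List (Split ι)) (W : ι → Bool) :
    pullAll v (ts ++ us) W = pullAll v ts (pullAll v us W) := by
  induction ts with
  | nil => rfl
  | cons t ts ih => rw [List.cons_append, pullAll, pullAll, ih]

theorem pullAll_of_ne (v : ι → Bool) {ts : List (Split ι)} {r : ι}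
    (h : ∀ t ∈ ts, r ≠ t.src ∧ r ≠ t.dst) (W : ι → Bool) : pullAll v ts W r = W r := by
  induction ts with
  | nil => rfl
  | cons t ts ih =>
    obtain ⟨h1, h2⟩ := h t List.mem_cons_self
    rw [pullAll, pull, update_of_ne h1, update_of_ne h2,
      ih fun t ht => h t (List.mem_cons_of_mem _ ht)]

end Split

namespace QCircuit

/-- The circuit of a split. -/
def split (t : Split ι) : QCircuit ι := tof t.ctrl t.src t.dst ++ cnot t.dst t.src

theorem acts_split {t : Split ι} (h₁ : t.ctrl ≠ t.src) (h₂ : t.ctrl ≠ t.dst) (h₃ : t.src ≠ t.dst)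
    (inp : A → ι → Bool) : (split t).Acts inp (fun a => t.app (inp a)) 0 := by
  refine (acts_tof h₁ h₂ h₃ inp).append₀ ((acts_cnot h₃.symm _).congr (fun _ => rfl) ?_
    fun _ => rfl)
  intro a
  simp [Split.app, update_of_ne h₃]

/-- The inverse of a split on arbitrary labels. -/
def unsplit (t : Split ι) : QCircuit ι := cnot t.dst t.src ++ tof t.ctrl t.src t.dst

theorem acts_unsplit {t : Split ι} (h₁ : t.ctrl ≠ t.src) (h₂ : t.ctrl ≠ t.dst)
    (h₃ : t.src ≠ t.dst) (inp : A → ι → Bool) :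
    (unsplit t).Acts (fun a => t.app (inp a)) inp 0 := by
  refine ((acts_cnot h₃.symm _).append₀ (acts_tof h₁ h₂ h₃ _)).congr (fun _ => rfl) ?_
    fun _ => rfl
  intro a
  funext i
  by_cases hd : i = t.dst
  · subst hd
    simp only [Split.app, update_self, update_of_ne h₁, update_of_ne h₂, update_of_ne h₃,
      update_of_ne h₃.symm]
    generalize inp a t.ctrl = x
    generalize inp a t.src = y
    generalize inp a t.dst = z
    revert x y z
    decide
  · by_cases hs : i = t.src
    · subst hs
      simp only [Split.app, update_self, update_of_ne h₁, update_of_ne h₂, update_of_ne h₃,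
        update_of_ne h₃.symm]
      generalize inp a t.ctrl = x
      generalize inp a t.src = y
      generalize inp a t.dst = z
      revert x y z
      decide
    · simp [Split.app, update_of_ne hd, update_of_ne hs]

/-- The inverse of a split on labels with target `0`, without Toffoli gates. -/
def unsplitClean (t : Split ι) : QCircuit ι := cnot t.dst t.src ++ unAnd t.ctrl t.src t.dst

theorem acts_unsplitClean {t : Split ι} (h₁ : t.ctrl ≠ t.src) (h₂ : t.ctrl ≠ t.dst)
    (h₃ : t.src ≠ t.dst) {inp : A → ι → Bool} (h0 : ∀ a, inp a t.dst = false) :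
    (unsplitClean t).Acts (fun a => t.app (inp a)) inp 0 := by
  have s1 := (acts_cnot h₃.symm (fun a => t.app (inp a))).congr
    (out' := fun a => update (inp a) t.dst (inp a t.ctrl * inp a t.src)) (fun _ => rfl)
    (fun a => by
      funext i
      by_cases hs : i = t.src
      · subst hs
        simp only [Split.app, update_self, update_of_ne h₃, update_of_ne h₃.symm, h0]
        generalize inp a t.ctrl = x
        generalize inp a t.src = y
        revert x y
        decide
      · by_cases hd : i = t.dst
        · subst hd
          simp only [Split.app, update_self, update_of_ne h₃.symm, h0]
          exact (zero_add (inp a t.ctrl * inp a t.src)).symm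
        · simp [Split.app, update_of_ne hd, update_of_ne hs]) (fun _ => rfl)
  refine s1.append₀ ((acts_unAnd h₁ h₂ h₃ (fun a => ?_)).congr (fun _ => rfl) (fun a => ?_)
    fun _ => rfl)
  · simp [update_of_ne h₂, update_of_ne h₃]
  · simp [← h0 a]

/-- Conjugation of a circuit by a sequence of splits with arbitrary targets. -/
def conjSplits (body : QCircuit ι) : List (Split ι) → QCircuit ι
  | [] => body
  | t :: ts => split t ++ conjSplits body ts ++ unsplit t

/-- Conjugation of a circuit by a sequence of splits with targets initially `0`. -/
def conjSplitsClean (body : QCircuit ι) : List (Split ι) → QCircuit ι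
  | [] => body
  | t :: ts => split t ++ conjSplitsClean body ts ++ unsplitClean t

theorem toffoliCount_conjSplits (body : QCircuit ι) (ts : List (Split ι)) :
    (conjSplits body ts).toffoliCount ≤ body.toffoliCount + 2 * ts.length := by
  induction ts with
  | nil => exact le_refl _
  | cons t ts ih =>
    have := toffoliCount_tof t.ctrl t.src t.dst
    simp only [conjSplits, split, unsplit, toffoliCount_append, toffoliCount_cnot, List.length_cons]
    omega

theorem toffoliCount_conjSplitsClean (body : QCircuit ι) (ts : List (Split ι)) :
    (conjSplitsClean body ts).toffoliCount ≤ body.toffoliCount + ts.length := by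
  induction ts with
  | nil => exact le_refl _
  | cons t ts ih =>
    have := toffoliCount_tof t.ctrl t.src t.dst
    simp only [conjSplitsClean, split, unsplitClean, toffoliCount_append, toffoliCount_cnot,
      toffoliCount_unAnd, List.length_cons]
    omega

/-- Conjugation by splits within `M` pulls a linear phase back along their transpose. -/
theorem acts_conjSplits {M : Set ι} {inp : A → ι → Bool} {W : A → ι → Bool} {body : QCircuit ι}
    (hbody : ∀ inp' : A → ι → Bool, (∀ a, ∀ i ∉ M, inp' a i = inp a i) →
      body.Acts inp' inp' fun a => wsum (W a) (inp' a))
    {ts : List (Split ι)}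
    (hts : ∀ t ∈ ts, t.src ∈ M ∧ t.dst ∈ M ∧ t.ctrl ∉ M ∧ t.src ≠ t.dst)
    (inp' : A → ι → Bool) (h : ∀ a, ∀ i ∉ M, inp' a i = inp a i) :
    (conjSplits body ts).Acts inp' inp'
      fun a => wsum (Split.pullAll (inp a) ts (W a)) (inp' a) := by
  induction ts generalizing inp' with
  | nil => exact hbody inp' h
  | cons t ts ih =>
    obtain ⟨hs, hd, hc, hsd⟩ := hts t List.mem_cons_self
    have h₁ : t.ctrl ≠ t.src := fun e => hc (e ▸ hs)
    have h₂ : t.ctrl ≠ t.dst := fun e => hc (e ▸ hd)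
    have ih := ih (fun t ht => hts t (List.mem_cons_of_mem _ ht)) (fun a => t.app (inp' a))
      fun a i hi => by rw [Split.app_of_notMem hs hd _ hi, h a i hi]
    refine (((acts_split h₁ h₂ hsd inp').append ih).append (acts_unsplit h₁ h₂ hsd inp')).congr
      (fun _ => rfl) (fun _ => rfl) fun a => ?_
    have hp (W : ι → Bool) : t.pull (inp' a) W = t.pull (inp a) W := by
      rw [Split.pull, Split.pull, h a _ hc]
    simp only [Pi.zero_apply, zero_add, add_zero, Split.wsum_app hsd, hp, Split.pullAll]

theorem acts_conjSplitsClean {M : Set ι} {inp : A → ι → Bool} {W : A → ι → Bool}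
    {body : QCircuit ι}
    (hbody : ∀ inp' : A → ι → Bool, (∀ a, ∀ i ∉ M, inp' a i = inp a i) →
      body.Acts inp' inp' fun a => wsum (W a) (inp' a))
    {ts : List (Split ι)}
    (hts : ∀ t ∈ ts, t.src ∈ M ∧ t.dst ∈ M ∧ t.ctrl ∉ M ∧ t.src ≠ t.dst)
    (hpw : ts.Pairwise fun s t => t.dst ≠ s.src ∧ t.dst ≠ s.dst)
    (inp' : A → ι → Bool) (h : ∀ a, ∀ i ∉ M, inp' a i = inp a i)
    (h0 : ∀ t ∈ ts, ∀ a, inp' a t.dst = false) :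
    (conjSplitsClean body ts).Acts inp' inp'
      fun a => wsum (Split.pullAll (inp a) ts (W a)) (inp' a) := by
  induction ts generalizing inp' with
  | nil => exact hbody inp' h
  | cons t ts ih =>
    obtain ⟨hs, hd, hc, hsd⟩ := hts t List.mem_cons_self
    rw [List.pairwise_cons] at hpw
    have h₁ : t.ctrl ≠ t.src := fun e => hc (e ▸ hs)
    have h₂ : t.ctrl ≠ t.dst := fun e => hc (e ▸ hd)
    have ih := ih (fun t ht => hts t (List.mem_cons_of_mem _ ht)) hpw.2 (fun a => t.app (inp' a))
      (fun a i hi => by rw [Split.app_of_notMem hs hd _ hi, h a i hi])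
      (fun s hs' a => by
        rw [Split.app, update_of_ne (hpw.1 s hs').1, update_of_ne (hpw.1 s hs').2,
          h0 s (List.mem_cons_of_mem _ hs')])
    refine (((acts_split h₁ h₂ hsd inp').append ih).append
      (acts_unsplitClean h₁ h₂ hsd (h0 t List.mem_cons_self))).congr
      (fun _ => rfl) (fun _ => rfl) fun a => ?_
    have hp (W : ι → Bool) : t.pull (inp' a) W = t.pull (inp a) W := by
      rw [Split.pull, Split.pull, h a _ hc]
    simp only [Pi.zero_apply, zero_add, add_zero, Split.wsum_app hsd, hp, Split.pullAll]

end QCircuit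

/-! ### The network that routes register `0` to an addressed register -/

section Network

variable {b : ℕ} (lo : ℕ → ι) (reg : ℕ → Fin b → ι)

/-- The splits that route the content of register `0` to the register whose number is in the address
qubits `lo`, among `m` registers: register `n` receives from the register whose number is `n`
without its leading binary digit. -/
def splits : ℕ → List (Split ι)
  | 0 => []
  | 1 => []
  | n + 2 => splits (n + 1) ++ (List.finRange b).map fun i =>
      ⟨lo (n + 1).log2, reg (n + 1 - 2 ^ (n + 1).log2) i, reg (n + 1) i⟩

theorem length_splits (m : ℕ) : (splits lo reg m).length = (m - 1) * b := by
  induction m with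
  | zero => simp [splits]
  | succ m ih =>
    cases m with
    | zero => simp [splits]
    | succ n =>
      rw [splits, List.length_append, ih, List.length_map, List.length_finRange]
      simp only [Nat.add_sub_cancel]
      ring

theorem mem_splits {m : ℕ} {t : Split ι} (ht : t ∈ splits lo reg m) :
    ∃ n i, 0 < n ∧ n < m ∧ t = ⟨lo n.log2, reg (n - 2 ^ n.log2) i, reg n i⟩ := by
  induction m with
  | zero => simp [splits] at ht
  | succ m ih =>
    cases m with
    | zero => simp [splits] at ht
    | succ n =>
      rw [splits, List.mem_append] at ht
      rcases ht with ht | ht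
      · obtain ⟨k, i, h0, hk, rfl⟩ := ih ht
        exact ⟨k, i, h0, by omega, rfl⟩
      · obtain ⟨i, -, rfl⟩ := List.mem_map.1 ht
        exact ⟨n + 1, i, by omega, by omega, rfl⟩

/-- Where the network with `m` registers routes the content of register `0` for address `l`. -/
def routed (l : ℕ) : ℕ → ℕ
  | 0 => 0
  | 1 => 0
  | n + 2 => if l.testBit (n + 1).log2 = true ∧ routed l (n + 1) = n + 1 - 2 ^ (n + 1).log2
      then n + 1 else routed l (n + 1)

/-- The number `routed l m` is the largest one below `m` that consists of trailing digits of `l`. -/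
theorem routed_spec (l n : ℕ) : (∃ j, routed l (n + 1) = l % 2 ^ j) ∧ routed l (n + 1) < n + 1 ∧
    ∀ j, l % 2 ^ j < n + 1 → l % 2 ^ j ≤ routed l (n + 1) := by
  induction n with
  | zero => exact ⟨⟨0, by simp [routed, Nat.mod_one]⟩, by simp [routed], fun j hj => by omega⟩
  | succ n ih =>
    obtain ⟨⟨j₀, h₀⟩, hlt, hmax⟩ := ih
    have hmono (i j : ℕ) (hij : i ≤ j) : l % 2 ^ i ≤ l % 2 ^ j := by
      rw [← Nat.mod_mod_of_dvd l (pow_dvd_pow 2 hij)]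
      exact Nat.mod_le _ _
    set e := (n + 1).log2 with he
    have he1 : 2 ^ e ≤ n + 1 := Nat.log2_self_le (by omega)
    have he2 : n + 1 < 2 ^ (e + 1) := Nat.lt_log2_self
    have hE := mod_two_pow_succ_of_testBit (h := l) (d := e)
    have hm : l % 2 ^ e < 2 ^ e := Nat.mod_lt _ (by positivity)
    rw [pow_succ] at he2
    rw [routed]
    by_cases hc : l.testBit e = true ∧ routed l (n + 1) = n + 1 - 2 ^ e
    · rw [if_pos hc]
      rw [if_pos hc.1] at hE
      have h1 := hmax e (by omega)
      have h2 : l % 2 ^ j₀ ≤ l % 2 ^ e := by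
        rcases le_total j₀ e with h | h
        · exact hmono _ _ h
        · have := hmono _ _ h
          rw [← Nat.mod_mod_of_dvd l (pow_dvd_pow 2 h), ← h₀, Nat.mod_eq_of_lt (a := routed _ _)
            (by omega)]
      exact ⟨⟨e + 1, by omega⟩, by omega, fun j hj => by omega⟩
    · rw [if_neg hc]
      refine ⟨⟨j₀, h₀⟩, by omega, fun j hj => ?_⟩
      by_cases hjn : l % 2 ^ j < n + 1
      · exact hmax j hjn
      · exfalso
        apply hc
        have hje : ¬ j ≤ e := fun h => by have := hmono _ _ h; omega
        have h1 := hmono (e + 1) j (by omega)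
        have h2 : l % 2 ^ (e + 1) = n + 1 := by
          rw [← Nat.mod_mod_of_dvd l (pow_dvd_pow 2 (show e + 1 ≤ j by omega)),
            show l % 2 ^ j = n + 1 by omega, Nat.mod_eq_of_lt (by rw [pow_succ]; omega)]
        split at hE
        · next hb =>
          refine ⟨hb, ?_⟩
          have h3 := hmax e (by omega)
          have h4 : j₀ ≤ e := by
            by_contra h
            have := hmono (e + 1) j₀ (by omega)
            omega
          have := hmono _ _ h4
          omega
        · omega

theorem routed_eq {l m : ℕ} (h : l < m) : routed l m = l := by
  obtain ⟨n, rfl⟩ : ∃ n, m = n + 1 := ⟨m - 1, by omega⟩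
  obtain ⟨⟨j, hj⟩, -, hmax⟩ := routed_spec l n
  have h1 : l % 2 ^ l = l := Nat.mod_eq_of_lt Nat.lt_two_pow_self
  have h2 := hmax l (by omega)
  have h3 : routed l (n + 1) ≤ l := hj ▸ Nat.mod_le _ _
  omega

variable {lo reg}

/-- Along the transpose of the network, register `0` obtains the coefficients of the addressed
register. -/
theorem pullAll_splits {m l : ℕ} {v : ι → Bool}
    (hreg : ∀ k < m, ∀ k' < m, ∀ i i', reg k i = reg k' i' → k = k' ∧ i = i')
    (hlo : ∀ e, 2 ^ e < m → v (lo e) = l.testBit e) (W : ι → Bool) (i : Fin b) :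
    Split.pullAll v (splits lo reg m) W (reg 0 i) = W (reg (routed l m) i) := by
  induction m generalizing W with
  | zero => rfl
  | succ m ih =>
    cases m with
    | zero => rfl
    | succ n =>
      rw [splits, Split.pullAll_append, ih (fun k hk k' hk' => hreg k (by omega) k' (by omega))
        (fun e he => hlo e (by omega))]
      have hr : routed l (n + 1) < n + 1 := (routed_spec l n).2.1
      set k := routed l (n + 1) with hk
      set p := n + 1 - 2 ^ (n + 1).log2 with hp
      have hp_lt : p < n + 1 := by have := Nat.two_pow_pos (n + 1).log2; omega
      have h2 : 2 ^ (n + 1).log2 ≤ n + 1 := Nat.log2_self_le (by omega)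
      have hv := hlo (n + 1).log2 (by omega)
      obtain ⟨s, t, hst⟩ := List.append_of_mem (List.mem_finRange i)
      have hnd : (s ++ i :: t).Nodup := hst ▸ List.nodup_finRange b
      have his : i ∉ s := fun h => (List.disjoint_of_nodup_append hnd) h List.mem_cons_self
      have hit : i ∉ t := (List.nodup_cons.1 (List.nodup_append.1 hnd).2.1).1
      have hne (l : List (Fin b)) (hil : i ∉ l) (q : ℕ) (hq : q < n + 2) (W : ι → Bool) :
          Split.pullAll v (l.map fun i => ⟨lo (n + 1).log2, reg p i, reg (n + 1) i⟩) W
            (reg q i) = W (reg q i) := by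
        refine Split.pullAll_of_ne v (fun t ht => ?_) W
        obtain ⟨i', hi', rfl⟩ := List.mem_map.1 ht
        exact ⟨fun e => hil ((hreg _ hq _ (by omega) _ _ e).2 ▸ hi'),
          fun e => hil ((hreg _ hq _ (by omega) _ _ e).2 ▸ hi')⟩
      rw [hst, List.map_append, List.map_cons, Split.pullAll_append, hne s his k (by omega),
        Split.pullAll, Split.pull]
      dsimp only
      rw [routed, ← hk, ← hp, hv]
      by_cases hkp : k = p
      · rw [hkp, update_self, hne t hit _ (by omega), hne t hit _ (by omega)]
        cases l.testBit (n + 1).log2 <;> simp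
      · rw [update_of_ne (fun e => hkp (hreg _ (by omega) _ (by omega) _ _ e).1),
          update_of_ne (fun e => by have := (hreg _ (by omega) _ (by omega) _ _ e).1; omega),
          hne t hit _ (by omega), if_neg (fun h => hkp h.2)]

theorem pairwise_splits {m : ℕ}
    (hreg : ∀ k < m, ∀ k' < m, ∀ i i', reg k i = reg k' i' → k = k' ∧ i = i') :
    (splits lo reg m).Pairwise fun s t => t.dst ≠ s.src ∧ t.dst ≠ s.dst := by
  induction m with
  | zero => exact List.Pairwise.nil
  | succ m ih =>
    cases m with
    | zero => exact List.Pairwise.nil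
    | succ n =>
      have hp : n + 1 - 2 ^ (n + 1).log2 < n + 1 := by
        have := Nat.two_pow_pos (n + 1).log2; omega
      rw [splits, List.pairwise_append]
      refine ⟨ih fun k hk k' hk' => hreg k (by omega) k' (by omega), ?_, ?_⟩
      · rw [List.pairwise_map]
        refine (List.nodup_finRange b).imp fun {i i'} hii' => ⟨fun e => ?_, fun e => ?_⟩
        · exact hii' (hreg _ (by omega) _ (by omega) _ _ e).2.symm
        · exact hii' (hreg _ (by omega) _ (by omega) _ _ e).2.symm
      · intro s hs t ht
        obtain ⟨k, i, h0, hk, rfl⟩ := mem_splits lo reg hs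
        obtain ⟨i', -, rfl⟩ := List.mem_map.1 ht
        have hk' : k - 2 ^ k.log2 ≤ k := Nat.sub_le _ _
        refine ⟨fun e => ?_, fun e => ?_⟩
        · have := (hreg (n + 1) (by omega) _ (hk'.trans_lt (by omega)) _ _ e).1; omega
        · have := (hreg (n + 1) (by omega) k (by omega) _ _ e).1; omega

end Network

/-! ### Table lookup -/

/-- The qubits used by a lookup of `b`-bit words at a two-part address. The part `hi` of `depth` bits
is treated by unary iteration with ancillas `anc`, the part `lo` selects one of `m` registers
`reg k`; register `0` is the target. Only the values of these functions within the indicated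
ranges matter. -/
structure LookupLayout (ι : Type) (b : ℕ) where
  depth : ℕ
  m : ℕ
  hi : ℕ → ι
  anc : ℕ → ι
  lo : ℕ → ι
  reg : ℕ → Fin b → ι
  m_pos : 0 < m
  hi_inj : ∀ j < depth, ∀ i < j, hi i ≠ hi j
  hi_ne_anc : ∀ i < depth, ∀ j, j + 1 < depth → hi i ≠ anc j
  anc_inj : ∀ j, j + 1 < depth → ∀ i < j, anc i ≠ anc j
  reg_inj : ∀ k < m, ∀ k' < m, ∀ i i', reg k i = reg k' i' → k = k' ∧ i = i'
  reg_ne_hi : ∀ k < m, ∀ i, ∀ j < depth, reg k i ≠ hi j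
  reg_ne_anc : ∀ k < m, ∀ i j, j + 1 < depth → reg k i ≠ anc j
  reg_ne_lo : ∀ k < m, ∀ i e, 2 ^ e < m → reg k i ≠ lo e

namespace LookupLayout

variable {b : ℕ} (lay : LookupLayout ι b)

/-- The label `v` has the address `(h, l)` in the address qubits, and `0` in the ancillas of the
unary iteration. -/
structure Reads (h l : ℕ) (v : ι → Bool) : Prop where
  hi : ∀ i < lay.depth, v (lay.hi i) = h.testBit i
  lo : ∀ e, 2 ^ e < lay.m → v (lay.lo e) = l.testBit e
  anc : ∀ i, i + 1 < lay.depth → v (lay.anc i) = false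
  hi_lt : h < 2 ^ lay.depth
  lo_lt : l < lay.m

/-- The qubits of all registers. -/
def regs : Set ι := {r | ∃ k < lay.m, ∃ i, r = lay.reg k i}

variable {lay}

theorem reg_mem {k : ℕ} (hk : k < lay.m) (i : Fin b) : lay.reg k i ∈ lay.regs := ⟨k, hk, i, rfl⟩

theorem hi_notMem {i : ℕ} (hi : i < lay.depth) : lay.hi i ∉ lay.regs := by
  rintro ⟨k, hk, j, h⟩
  exact lay.reg_ne_hi k hk j i hi h.symm

theorem anc_notMem {i : ℕ} (hi : i + 1 < lay.depth) : lay.anc i ∉ lay.regs := by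
  rintro ⟨k, hk, j, h⟩
  exact lay.reg_ne_anc k hk j i hi h.symm

theorem lo_notMem {e : ℕ} (he : 2 ^ e < lay.m) : lay.lo e ∉ lay.regs := by
  rintro ⟨k, hk, j, h⟩
  exact lay.reg_ne_lo k hk j e he h.symm

theorem reg_zero_injective : Injective (lay.reg 0) := fun i i' h =>
  (lay.reg_inj 0 lay.m_pos 0 lay.m_pos i i' h).2

theorem Reads.congr {h l : ℕ} {v v' : ι → Bool} (hv : lay.Reads h l v)
    (heq : ∀ r ∉ lay.regs, v' r = v r) : lay.Reads h l v' where
  hi i hi := by rw [heq _ (hi_notMem hi), hv.hi i hi]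
  lo e he := by rw [heq _ (lo_notMem he), hv.lo e he]
  anc i hi := by rw [heq _ (anc_notMem hi), hv.anc i hi]
  hi_lt := hv.hi_lt
  lo_lt := hv.lo_lt

variable (lay)

open Classical in
/-- The coefficients of the linear phase for row `h` of the table: the words `X h k` in the
registers `reg k`. -/
noncomputable def coeff (X : ℕ → ℕ → Fin b → Bool) (h : ℕ) (r : ι) : Bool :=
  decide (∃ k < lay.m, ∃ i, r = lay.reg k i ∧ X h k i = true)

/-- The phases of all rows of the table, for rows numbered by less than `L`. -/
noncomputable def rows (L : ℕ) (X : ℕ → ℕ → Fin b → Bool) : QCircuit ι :=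
  QCircuit.select lay.hi lay.anc L (lay.coeff X) lay.depth none 0

/-- Phase lookup with registers initially `0`, except for the target. -/
noncomputable def phaseClean (L : ℕ) (X : ℕ → ℕ → Fin b → Bool) : QCircuit ι :=
  QCircuit.conjSplitsClean (lay.rows L X) (splits lay.lo lay.reg lay.m)

/-- Phase lookup up to a phase that depends on the content of the registers other than the
target. -/
noncomputable def phaseDirty (L : ℕ) (X : ℕ → ℕ → Fin b → Bool) : QCircuit ι :=
  QCircuit.conjSplits (lay.rows L X) (splits lay.lo lay.reg lay.m)

/-- The coefficients of the phase that `phaseDirty` produces. -/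
noncomputable def pulled (X : ℕ → ℕ → Fin b → Bool) (h : ℕ) (v : ι → Bool) : ι → Bool :=
  Split.pullAll v (splits lay.lo lay.reg lay.m) (lay.coeff X h)

variable {lay} {L : ℕ} {X : ℕ → ℕ → Fin b → Bool}

theorem coeff_reg {h k : ℕ} (hk : k < lay.m) (i : Fin b) :
    lay.coeff X h (lay.reg k i) = X h k i := by
  rw [coeff, Bool.eq_iff_iff, decide_eq_true_iff]
  constructor
  · rintro ⟨k', hk', i', he, hX⟩
    obtain ⟨rfl, rfl⟩ := lay.reg_inj _ hk _ hk' _ _ he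
    exact hX
  · exact fun hX => ⟨k, hk, i, rfl, hX⟩

theorem coeff_of_notMem {h : ℕ} {r : ι} (hr : r ∉ lay.regs) : lay.coeff X h r = false := by
  rw [coeff, decide_eq_false_iff_not]
  rintro ⟨k, hk, i, rfl, -⟩
  exact hr (reg_mem hk i)

theorem mem_regs_of_mem_splits {t : Split ι} (ht : t ∈ splits lay.lo lay.reg lay.m) :
    t.src ∈ lay.regs ∧ t.dst ∈ lay.regs ∧ t.ctrl ∉ lay.regs ∧ t.src ≠ t.dst := by
  obtain ⟨n, i, h0, hn, rfl⟩ := mem_splits _ _ ht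
  have h2 : 2 ^ n.log2 ≤ n := Nat.log2_self_le (by omega)
  have h3 := Nat.two_pow_pos n.log2
  have h4 : n - 2 ^ n.log2 < n := Nat.sub_lt h0 h3
  exact ⟨reg_mem (h4.trans hn) i, reg_mem hn i, lo_notMem (h2.trans_lt hn), fun e =>
    h4.ne (lay.reg_inj _ (h4.trans hn) _ hn _ _ e).1⟩

theorem pulled_reg {h l : ℕ} {v : ι → Bool} (hv : lay.Reads h l v) (i : Fin b) :
    lay.pulled X h v (lay.reg 0 i) = X h l i := by
  rw [pulled, pullAll_splits lay.reg_inj hv.lo, routed_eq hv.lo_lt, coeff_reg hv.lo_lt]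

theorem pulled_of_notMem {h : ℕ} {v : ι → Bool} {r : ι} (hr : r ∉ lay.regs) :
    lay.pulled X h v r = false := by
  rw [pulled, Split.pullAll_of_ne, coeff_of_notMem hr]
  intro t ht
  obtain ⟨h1, h2, -, -⟩ := mem_regs_of_mem_splits ht
  exact ⟨fun e => hr (e ▸ h1), fun e => hr (e ▸ h2)⟩

theorem toffoliCount_rows (hL : 0 < L) : (lay.rows L X).toffoliCount + 1 ≤ L :=
  (QCircuit.toffoliCount_select _ _ hL).trans (min_le_right _ _)

theorem toffoliCount_phaseClean (hL : 0 < L) :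
    (lay.phaseClean L X).toffoliCount + 1 ≤ L + (lay.m - 1) * b := by
  have h1 := toffoliCount_rows (lay := lay) (X := X) hL
  have h2 := QCircuit.toffoliCount_conjSplitsClean (lay.rows L X) (splits lay.lo lay.reg lay.m)
  rw [length_splits] at h2
  rw [phaseClean]
  omega

theorem toffoliCount_phaseDirty (hL : 0 < L) :
    (lay.phaseDirty L X).toffoliCount + 1 ≤ L + 2 * ((lay.m - 1) * b) := by
  have h1 := toffoliCount_rows (lay := lay) (X := X) hL
  have h2 := QCircuit.toffoliCount_conjSplits (lay.rows L X) (splits lay.lo lay.reg lay.m)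
  rw [length_splits] at h2
  rw [phaseDirty]
  omega

theorem acts_rows {inp : A → ι → Bool} {h l : A → ℕ} (hr : ∀ a, lay.Reads (h a) (l a) (inp a))
    (hL : ∀ a, h a < L) :
    (lay.rows L X).Acts inp inp fun a => wsum (lay.coeff X (h a)) (inp a) := by
  have hmod (a : A) : 0 + h a % 2 ^ lay.depth = h a := by
    rw [Nat.mod_eq_of_lt (hr a).hi_lt, zero_add]
  refine (QCircuit.acts_select_none (off := 0) (h := h) lay.hi_inj lay.hi_ne_anc lay.anc_inj
    (fun k i hi => coeff_of_notMem (hi_notMem hi)) (fun k i hi => coeff_of_notMem (anc_notMem hi))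
    (fun a => (hr a).hi) (fun a => (hr a).anc) (fun a => ?_)).congr (fun _ => rfl) (fun _ => rfl)
    fun a => ?_
  · rw [hmod]; exact hL a
  · rw [hmod]

theorem acts_phaseDirty {inp : A → ι → Bool} {h l : A → ℕ}
    (hr : ∀ a, lay.Reads (h a) (l a) (inp a)) (hL : ∀ a, h a < L) (inp' : A → ι → Bool)
    (heq : ∀ a, ∀ r ∉ lay.regs, inp' a r = inp a r) :
    (lay.phaseDirty L X).Acts inp' inp'
      fun a => wsum (lay.pulled X (h a) (inp a)) (inp' a) :=
  QCircuit.acts_conjSplits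
    (fun _ heq => acts_rows (fun a => (hr a).congr (heq a)) hL)
    (fun _ ht => mem_regs_of_mem_splits ht) inp' heq

theorem acts_phaseClean {inp : A → ι → Bool} {h l : A → ℕ}
    (hr : ∀ a, lay.Reads (h a) (l a) (inp a)) (hL : ∀ a, h a < L)
    (h0 : ∀ a k i, 0 < k → k < lay.m → inp a (lay.reg k i) = false) :
    (lay.phaseClean L X).Acts inp inp
      fun a => ∑ i, X (h a) (l a) i * inp a (lay.reg 0 i) := by
  refine (QCircuit.acts_conjSplitsClean
    (fun _ heq => acts_rows (fun a => (hr a).congr (heq a)) hL)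
    (fun _ ht => mem_regs_of_mem_splits ht) (pairwise_splits lay.reg_inj) inp (fun _ _ _ => rfl)
    (fun t ht a => ?_)).congr (fun _ => rfl) (fun _ => rfl) fun a => ?_
  · obtain ⟨n, i, hn0, hn, rfl⟩ := mem_splits _ _ ht
    exact h0 a n i hn0 hn
  · change _ = wsum (lay.pulled X (h a) (inp a)) (inp a)
    rw [wsum_eq_sum (reg_zero_injective (lay := lay))]
    · simp only [pulled_reg (hr a)]
    · intro r hr0 hW
      have hmem : r ∈ lay.regs := by
        by_contra hmem
        simp [pulled_of_notMem hmem] at hW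
      obtain ⟨k, hk, i, rfl⟩ := hmem
      refine h0 a k i (Nat.pos_of_ne_zero fun hk0 => hr0 ⟨i, by rw [hk0]⟩) hk

end LookupLayout

namespace QCircuit

/-- Conjugation of a circuit by Hadamard gates on the listed qubits. -/
def conjHs (c : QCircuit ι) : List ι → QCircuit ι
  | [] => c
  | d :: ds => conjH d (conjHs c ds)

theorem toffoliCount_conjHs (c : QCircuit ι) (ds : List ι) :
    (conjHs c ds).toffoliCount = c.toffoliCount := by
  induction ds with
  | nil => rfl
  | cons d ds ih => rw [conjHs, toffoliCount_conjH, ih]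

/-- The label `v` with the listed qubits replaced by those of `s`. -/
def overlay (ds : List ι) (s v : ι → Bool) : ι → Bool := fun r => if r ∈ ds then s r else v r

theorem Acts.conjHs {c : QCircuit ι} {ds : List ι} (hds : ds.Nodup) {inp : A → ι → Bool}
    {φ : A → Bool} {y : A → ι → Bool}
    (h : c.Acts (fun p : A × (ι → Bool) => overlay ds p.2 (inp p.1))
      (fun p => overlay ds p.2 (inp p.1))
      (fun p => φ p.1 + (ds.map fun r => p.2 r * y p.1 r).sum)) :
    (QCircuit.conjHs c ds).Acts inp (fun a => overlay ds (inp a + y a) (inp a)) φ := by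
  induction ds generalizing A with
  | nil =>
    refine (h.reindex fun a => (a, inp a)).congr (fun _ => ?_) (fun _ => ?_) fun _ => ?_
    · funext r; simp [overlay]
    · funext r; simp [overlay]
    · simp
  | cons d ds ih =>
    rw [List.nodup_cons] at hds
    have ih := ih (A := A × Bool) hds.2 (inp := fun p => update (inp p.1) d p.2)
      (φ := fun p => φ p.1 + p.2 * y p.1 d) (y := fun p => y p.1) (by
        have hlab (p : (A × Bool) × (ι → Bool)) :
            overlay ds p.2 (update (inp p.1.1) d p.1.2) =
              overlay (d :: ds) (update p.2 d p.1.2) (inp p.1.1) := by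
          funext r
          by_cases hr : r = d
          · subst hr; simp [overlay, hds.1]
          · simp [overlay, hr]
        refine (h.reindex fun p : (A × Bool) × (ι → Bool) => (p.1.1, update p.2 d p.1.2)).congr
          hlab hlab fun p => ?_
        dsimp only
        rw [List.map_cons, List.sum_cons, update_self, add_assoc]
        congr 3
        refine List.map_congr_left fun r hr => ?_
        rw [update_of_ne (show r ≠ d from fun e => hds.1 (e ▸ hr))])
    refine (Acts.conjH (out := fun a => overlay ds (inp a + y a) (inp a)) (φ := φ)
      (y := fun a => y a d) (ih.congr (fun _ => rfl) (fun p => ?_) fun _ => rfl)).congr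
      (fun _ => rfl) (fun a => ?_) fun _ => rfl
    · funext r
      by_cases hr : r = d
      · subst hr; simp [overlay, hds.1]
      · simp [overlay, hr]
    · funext r
      by_cases hr : r = d
      · subst hr; simp [overlay]
      · simp [overlay, hr]

end QCircuit

namespace LookupLayout

variable {b : ℕ} {lay : LookupLayout ι b} {L : ℕ} {X : ℕ → ℕ → Fin b → Bool}

variable (lay)

/-- The qubits of the target register. -/
def target : List ι := List.ofFn (lay.reg 0)

variable {lay}

theorem nodup_target : lay.target.Nodup := List.nodup_ofFn.2 reg_zero_injective

theorem mem_target {r : ι} : r ∈ lay.target ↔ r ∈ Set.range (lay.reg 0) := List.mem_ofFn' _ _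

theorem mem_regs_of_mem_target {r : ι} (h : r ∈ lay.target) : r ∈ lay.regs := by
  obtain ⟨i, rfl⟩ := mem_target.1 h
  exact reg_mem lay.m_pos i

/-- Hadamard gates on the target turn a phase lookup into the addition of the word to the target. -/
theorem acts_conjHs_target {c : QCircuit ι} {inp out : A → ι → Bool} {φ : A → Bool}
    {y : A → Fin b → Bool}
    (h : c.Acts (fun p : A × (ι → Bool) => QCircuit.overlay lay.target p.2 (inp p.1))
      (fun p => QCircuit.overlay lay.target p.2 (inp p.1))
      (fun p => φ p.1 + ∑ i, y p.1 i * p.2 (lay.reg 0 i)))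
    (hout : ∀ a i, out a (lay.reg 0 i) = inp a (lay.reg 0 i) + y a i)
    (hout' : ∀ a, ∀ r ∉ Set.range (lay.reg 0), out a r = inp a r) :
    (QCircuit.conjHs c lay.target).Acts inp out φ := by
  have hext (a : A) (i : Fin b) : extend (lay.reg 0) (y a) 0 (lay.reg 0 i) = y a i :=
    reg_zero_injective.extend_apply _ _ _
  refine (QCircuit.Acts.conjHs nodup_target (φ := φ) (y := fun a => extend (lay.reg 0) (y a) 0)
    (h.congr (fun _ => rfl) (fun _ => rfl) fun p => ?_)).congr (fun _ => rfl) (fun a => ?_)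
    fun _ => rfl
  · rw [target, List.map_ofFn, List.sum_ofFn]
    simp only [comp_apply, hext, mul_comm]
  · funext r
    by_cases hr : r ∈ lay.target
    · obtain ⟨i, rfl⟩ := mem_target.1 hr
      rw [QCircuit.overlay, if_pos hr, hout, Pi.add_apply, hext]
    · rw [QCircuit.overlay, if_neg hr, hout' a r (fun h => hr (mem_target.2 h))]

theorem overlay_of_notMem_regs {s v : ι → Bool} {r : ι} (hr : r ∉ lay.regs) :
    QCircuit.overlay lay.target s v r = v r :=
  if_neg fun h => hr (mem_regs_of_mem_target h)

theorem overlay_target (s v : ι → Bool) (i : Fin b) :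
    QCircuit.overlay lay.target s v (lay.reg 0 i) = s (lay.reg 0 i) :=
  if_pos (mem_target.2 ⟨i, rfl⟩)

/-- Lookup of a word, added to the target, with the other registers initially `0`. -/
theorem acts_xorClean {inp out : A → ι → Bool} {h l : A → ℕ}
    (hr : ∀ a, lay.Reads (h a) (l a) (inp a)) (hL : ∀ a, h a < L)
    (h0 : ∀ a k i, 0 < k → k < lay.m → inp a (lay.reg k i) = false)
    (hout : ∀ a i, out a (lay.reg 0 i) = inp a (lay.reg 0 i) + X (h a) (l a) i)
    (hout' : ∀ a, ∀ r ∉ Set.range (lay.reg 0), out a r = inp a r) :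
    (QCircuit.conjHs (lay.phaseClean L X) lay.target).Acts inp out 0 := by
  refine acts_conjHs_target (y := fun a => X (h a) (l a)) ?_ hout hout'
  refine (acts_phaseClean (A := A × (ι → Bool)) (h := fun p => h p.1) (l := fun p => l p.1)
    (fun p => (hr p.1).congr fun r hr => overlay_of_notMem_regs hr) (fun p => hL p.1)
    fun p k i hk hkm => ?_).congr (fun _ => rfl) (fun _ => rfl) fun p => ?_
  · rw [QCircuit.overlay, if_neg, h0 p.1 k i hk hkm]
    rw [mem_target]
    rintro ⟨i', he⟩
    exact hk.ne (lay.reg_inj _ lay.m_pos _ hkm _ _ he).1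
  · simp only [overlay_target, Pi.zero_apply, zero_add]

/-- Lookup of a word into a target initially `0`, with arbitrary content of the other registers: the
phases due to that content are the same with and without a content of the target, so that they
cancel between two rounds. -/
theorem acts_xorDirty {inp out : A → ι → Bool} {h l : A → ℕ}
    (hr : ∀ a, lay.Reads (h a) (l a) (inp a)) (hL : ∀ a, h a < L)
    (h0 : ∀ a i, inp a (lay.reg 0 i) = false)
    (hout : ∀ a i, out a (lay.reg 0 i) = X (h a) (l a) i)
    (hout' : ∀ a, ∀ r ∉ Set.range (lay.reg 0), out a r = inp a r) :
    (lay.phaseDirty L X ++ QCircuit.conjHs (lay.phaseDirty L X) lay.target).Acts inp out 0 := by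
  have s1 := acts_phaseDirty (X := X) hr hL inp (fun _ _ _ => rfl)
  refine (s1.append (acts_conjHs_target (out := out) (y := fun a => X (h a) (l a))
    (φ := fun a => wsum (lay.pulled X (h a) (inp a)) (inp a))
    ((acts_phaseDirty (A := A × (ι → Bool)) (h := fun p => h p.1) (l := fun p => l p.1)
      (inp := fun p => inp p.1) (fun p => hr p.1) (fun p => hL p.1) _
      (fun p r hr => overlay_of_notMem_regs hr)).congr (fun _ => rfl) (fun _ => rfl) fun p => ?_)
    (fun a i => ?_) hout')).congr (fun _ => rfl) (fun _ => rfl) fun a => ?_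
  · have hsplit : QCircuit.overlay lay.target p.2 (inp p.1) =
        inp p.1 + QCircuit.overlay lay.target p.2 0 := by
      funext r
      by_cases hr : r ∈ lay.target
      · obtain ⟨i, rfl⟩ := mem_target.1 hr
        rw [Pi.add_apply, overlay_target, overlay_target, h0]
        exact (zero_add (p.2 (lay.reg 0 i))).symm
      · rw [Pi.add_apply, QCircuit.overlay, QCircuit.overlay, if_neg hr, if_neg hr, Pi.zero_apply,
          add_zero]
    rw [hsplit, wsum_add_right]
    congr 1
    rw [wsum_eq_sum (reg_zero_injective (lay := lay))]
    · simp only [pulled_reg (hr p.1), overlay_target]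
    · intro r hr _
      rw [QCircuit.overlay, if_neg (fun h => hr (mem_target.1 h))]
      rfl
  · rw [hout, h0]
    exact (zero_add (X (h a) (l a) i)).symm
  · exact (Bool.xor_self (wsum _ (inp a))).symm

end LookupLayout

namespace LookupLayout

variable {lay : LookupLayout ι 1} {L : ℕ} {X : ℕ → ℕ → Fin 1 → Bool}

/-- The phase given by a table of bits, with all registers initially `0`. -/
theorem acts_signClean {inp : A → ι → Bool} {h l : A → ℕ}
    (hr : ∀ a, lay.Reads (h a) (l a) (inp a)) (hL : ∀ a, h a < L)
    (h0 : ∀ a, ∀ k < lay.m, ∀ i, inp a (lay.reg k i) = false) :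
    (QCircuit.x (lay.reg 0 0) ++ lay.phaseClean L X ++ QCircuit.x (lay.reg 0 0)).Acts inp inp
      fun a => X (h a) (l a) 0 := by
  have hz (a : A) : inp a (lay.reg 0 0) = false := h0 a 0 lay.m_pos 0
  have hmem : lay.reg 0 0 ∈ lay.regs := reg_mem lay.m_pos 0
  have s2 := acts_phaseClean (X := X) (inp := fun a => update (inp a) (lay.reg 0 0)
      (!inp a (lay.reg 0 0))) (h := h) (l := l)
    (fun a => (hr a).congr fun r hr => update_of_ne (fun e => hr (by rwa [e])) _ _) hL
    (fun a k i hk hkm => by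
      rw [update_of_ne (fun e => hk.ne (lay.reg_inj _ hkm _ lay.m_pos _ _ e).1.symm), h0 a k hkm])
  refine (((QCircuit.acts_x _ inp).append s2).append (QCircuit.acts_x _ _)).congr (fun _ => rfl)
    (fun a => ?_) fun a => ?_
  · simp
  · simp [hz]
    exact (mul_one (X (h a) (l a) 0)).symm

/-- The phase given by a table of bits, with arbitrary content of the registers other than the
target. -/
theorem acts_signDirty {inp : A → ι → Bool} {h l : A → ℕ}
    (hr : ∀ a, lay.Reads (h a) (l a) (inp a)) (hL : ∀ a, h a < L)
    (h0 : ∀ a, inp a (lay.reg 0 0) = false) :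
    (lay.phaseDirty L X ++ QCircuit.x (lay.reg 0 0) ++ lay.phaseDirty L X ++
      QCircuit.x (lay.reg 0 0)).Acts inp inp fun a => X (h a) (l a) 0 := by
  have hmem : lay.reg 0 0 ∈ lay.regs := reg_mem lay.m_pos 0
  have s1 := acts_phaseDirty (X := X) hr hL inp (fun _ _ _ => rfl)
  have s2 := acts_phaseDirty (X := X) hr hL
    (fun a => update (inp a) (lay.reg 0 0) (!inp a (lay.reg 0 0)))
    (fun a r hr => update_of_ne (fun e => hr (by rwa [e])) _ _)
  refine (((s1.append (QCircuit.acts_x _ inp)).append s2).append (QCircuit.acts_x _ _)).congr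
    (fun _ => rfl) (fun a => ?_) fun a => ?_
  · simp
  · rw [wsum_update_right, pulled_reg (hr a), h0]
    generalize wsum _ (inp a) = s
    generalize X (h a) (l a) 0 = t
    revert s t
    simp only [Pi.zero_apply]
    decide

end LookupLayout

/-! ### Addition and subtraction -/

namespace QCircuit

theorem acts_cnot_of {c t : ι} (h : c ≠ t) {inp out : A → ι → Bool}
    (ht : ∀ a, out a t = inp a t + inp a c) (ho : ∀ a, ∀ r ≠ t, out a r = inp a r) :
    (cnot c t).Acts inp out 0 :=
  (acts_cnot h inp).congr (fun _ => rfl)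
    (fun a => (eq_update_iff).2 ⟨ht a, fun r hr => ho a r hr⟩) fun _ => rfl

theorem acts_tof_of {c₁ c₂ t : ι} (h : c₁ ≠ c₂) (h₁ : c₁ ≠ t) (h₂ : c₂ ≠ t)
    {inp out : A → ι → Bool} (ht : ∀ a, out a t = inp a t + inp a c₁ * inp a c₂)
    (ho : ∀ a, ∀ r ≠ t, out a r = inp a r) : (tof c₁ c₂ t).Acts inp out 0 :=
  (acts_tof h h₁ h₂ inp).congr (fun _ => rfl)
    (fun a => (eq_update_iff).2 ⟨ht a, fun r hr => ho a r hr⟩) fun _ => rfl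

theorem acts_unAnd_of {c₁ c₂ t : ι} (h : c₁ ≠ c₂) (h₁ : c₁ ≠ t) (h₂ : c₂ ≠ t)
    {inp out : A → ι → Bool} (hi : ∀ a, inp a t = inp a c₁ * inp a c₂)
    (ht : ∀ a, out a t = false) (ho : ∀ a, ∀ r ≠ t, out a r = inp a r) :
    (unAnd c₁ c₂ t).Acts inp out 0 :=
  (acts_unAnd h h₁ h₂ hi).congr (fun _ => rfl)
    (fun a => (eq_update_iff).2 ⟨ht a, fun r hr => ho a r hr⟩) fun _ => rfl

/-- Ripple-carry addition of the number in `k` to the one in the `w` qubits `q`, modulo `2 ^ w`, with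
carry bits in `c`; the bits of the summand for which there is no qubit are `0`. Carry `i + 1` is
computed as `(q ⊕ c) (k ⊕ c) ⊕ c` and later erased without Toffoli gates. -/
def adder : ℕ → (ℕ → ι) → (ℕ → Option ι) → (ℕ → ι) → QCircuit ι
  | 0, _, _, _ => .done
  | 1, q, k, c => cnot (c 0) (q 0) ++ (k 0).elim .done fun k => cnot k (q 0)
  | w + 2, q, k, c =>
    let rest := adder (w + 1) (fun i => q (i + 1)) (fun i => k (i + 1)) (fun i => c (i + 1))
    (k 0).elim
      (tof (q 0) (c 0) (c 1) ++ (rest ++ (unAnd (q 0) (c 0) (c 1) ++ cnot (c 0) (q 0))))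
      fun k =>
        cnot (c 0) (q 0) ++ (cnot (c 0) k ++ (tof (q 0) k (c 1) ++ (cnot (c 0) (c 1) ++
          (rest ++ (cnot (c 0) (c 1) ++ (unAnd (q 0) k (c 1) ++ (cnot (c 0) k ++
            cnot k (q 0))))))))

theorem toffoliCount_adder (w : ℕ) (q : ℕ → ι) (k : ℕ → Option ι) (c : ℕ → ι) :
    (adder w q k c).toffoliCount ≤ w := by
  induction w generalizing q k c with
  | zero => exact le_refl _
  | succ w ih =>
    cases w with
    | zero =>
      cases hk : k 0 <;>
        simp [adder, hk, toffoliCount_append, toffoliCount_cnot, toffoliCount]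
    | succ w =>
      have := ih (fun i => q (i + 1)) (fun i => k (i + 1)) (fun i => c (i + 1))
      rw [adder]
      cases hk : k 0 with
      | none =>
        have := toffoliCount_tof (q 0) (c 0) (c 1)
        simp only [Option.elim, toffoliCount_append, toffoliCount_cnot, toffoliCount_unAnd]
        omega
      | some k =>
        have := toffoliCount_tof (q 0) k (c 1)
        simp only [Option.elim, toffoliCount_append, toffoliCount_cnot, toffoliCount_unAnd]
        omega

/-- The qubits of an adder are distinct. -/
structure AdderLayout (w : ℕ) (q : ℕ → ι) (k : ℕ → Option ι) (c : ℕ → ι) : Prop where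
  q_inj : ∀ j < w, ∀ i < j, q i ≠ q j
  c_inj : ∀ j < w, ∀ i < j, c i ≠ c j
  k_inj : ∀ j < w, ∀ i < j, ∀ r, k i = some r → k j ≠ some r
  q_ne_c : ∀ i < w, ∀ j < w, q i ≠ c j
  q_ne_k : ∀ i < w, ∀ j < w, k j ≠ some (q i)
  c_ne_k : ∀ i < w, ∀ j < w, k j ≠ some (c i)

theorem AdderLayout.tail {w : ℕ} {q : ℕ → ι} {k : ℕ → Option ι} {c : ℕ → ι}
    (h : AdderLayout (w + 1) q k c) :
    AdderLayout w (fun i => q (i + 1)) (fun i => k (i + 1)) (fun i => c (i + 1)) where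
  q_inj j hj i hi := h.q_inj _ (by omega) _ (by omega)
  c_inj j hj i hi := h.c_inj _ (by omega) _ (by omega)
  k_inj j hj i hi := h.k_inj _ (by omega) _ (by omega)
  q_ne_c i hi j hj := h.q_ne_c _ (by omega) _ (by omega)
  q_ne_k i hi j hj := h.q_ne_k _ (by omega) _ (by omega)
  c_ne_k i hi j hj := h.c_ne_k _ (by omega) _ (by omega)

theorem testBit_zero_add_carry (m n : ℕ) (c : Bool) :
    (m + n + c.toNat).testBit 0 = m.testBit 0 + n.testBit 0 + c := by
  simp only [Nat.testBit_zero]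
  rcases Nat.mod_two_eq_zero_or_one m with h | h <;>
    rcases Nat.mod_two_eq_zero_or_one n with h' | h' <;> cases c <;>
    simp [h, h', Nat.add_mod] <;> rfl

theorem half_add_carry (m n : ℕ) (c : Bool) :
    (m + n + c.toNat) / 2 = m / 2 + n / 2 +
      ((m.testBit 0 + c) * (n.testBit 0 + c) + c : Bool).toNat := by
  simp only [Nat.testBit_zero]
  have e1 : ((false + false) * (false + false) + false : Bool) = false := rfl
  have e2 : ((false + false) * (true + false) + false : Bool) = false := rfl
  have e3 : ((true + false) * (false + false) + false : Bool) = false := rfl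
  have e4 : ((true + false) * (true + false) + false : Bool) = true := rfl
  have e5 : ((false + true) * (false + true) + true : Bool) = false := rfl
  have e6 : ((false + true) * (true + true) + true : Bool) = true := rfl
  have e7 : ((true + true) * (false + true) + true : Bool) = true := rfl
  have e8 : ((true + true) * (true + true) + true : Bool) = true := rfl
  rcases Nat.mod_two_eq_zero_or_one m with h | h <;>
    rcases Nat.mod_two_eq_zero_or_one n with h' | h' <;> cases c <;>
    simp only [h, h', zero_ne_one, decide_false, decide_true, e1, e2, e3, e4, e5, e6, e7, e8,
      Bool.toNat_false, Bool.toNat_true] <;> omega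

theorem acts_adder {w : ℕ} {q : ℕ → ι} {k : ℕ → Option ι} {c : ℕ → ι}
    (lay : AdderLayout w q k c) {inp out : A → ι → Bool} {m n : A → ℕ} {cin : A → Bool}
    (hq : ∀ a, ∀ i < w, inp a (q i) = (m a).testBit i)
    (hk : ∀ a, ∀ i < w, (k i).elim false (inp a) = (n a).testBit i)
    (hc₀ : ∀ a, 0 < w → inp a (c 0) = cin a)
    (hc : ∀ a i, 0 < i → i < w → inp a (c i) = false)
    (hout : ∀ a, ∀ i < w, out a (q i) = (m a + n a + (cin a).toNat).testBit i)
    (hout' : ∀ a r, (∀ i < w, r ≠ q i) → out a r = inp a r) :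
    (adder w q k c).Acts inp out 0 := by
  induction w generalizing q k c inp out m n cin with
  | zero =>
    exact acts_done.congr (fun _ => rfl)
      (fun a => funext fun r => hout' a r fun i hi => absurd hi (by omega)) fun _ => rfl
  | succ w ih =>
    have hcq := lay.q_ne_c 0 (by omega) 0 (by omega)
    cases w with
    | zero =>
      rw [adder]
      have hk0 (a : A) := hk a 0 (by omega)
      have ho (a : A) := hout a 0 (by omega)
      simp only [testBit_zero_add_carry] at ho
      cases hk' : k 0 with
      | none =>
        simp only [hk', Option.elim] at hk0
        refine (acts_cnot_of hcq.symm (fun a => ?_) fun a r hr => ?_).append₀ acts_done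
        · rw [ho, ← hk0, hq a 0 (by omega), hc₀ a (by omega)]
          congr 1
          exact add_zero ((m a).testBit 0)
        · exact hout' a r fun i hi => by obtain rfl : i = 0 := by omega
                                         exact hr
      | some k₀ =>
        have hqk : k₀ ≠ q 0 := fun e => lay.q_ne_k 0 (by omega) 0 (by omega) (e ▸ hk')
        simp only [hk', Option.elim] at hk0
        refine (acts_cnot hcq.symm inp).append₀ (acts_cnot_of hqk (fun a => ?_) fun a r hr => ?_)
        · rw [ho, update_self, update_of_ne hqk, hk0, hq a 0 (by omega), hc₀ a (by omega)]
          exact add_right_comm ((m a).testBit 0) ((n a).testBit 0) (cin a)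
        · rw [update_of_ne hr]
          exact hout' a r fun i hi => by obtain rfl : i = 0 := by omega
                                         exact hr
    | succ w =>
      have ho (a : A) := hout a 0 (by omega)
      have hk0 (a : A) := hk a 0 (by omega)
      have hq0 (a : A) := hq a 0 (by omega)
      have hc0 (a : A) := hc₀ a (by omega)
      have hc1 (a : A) := hc a 1 (by omega) (by omega)
      simp only [testBit_zero_add_carry] at ho
      have hqc1 := lay.q_ne_c 0 (by omega) 1 (by omega)
      have hc01 := lay.c_inj 1 (by omega) 0 (by omega)
      have hqq (i : ℕ) (hi : i < w + 1) := lay.q_inj (i + 1) (by omega) 0 (by omega)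
      have hqc (i : ℕ) (hi : i < w + 2) := lay.q_ne_c i hi 1 (by omega)
      have hq0c (i : ℕ) (hi : i < w + 2) := lay.q_ne_c 0 (by omega) i (by omega)
      have hcc (i : ℕ) (h0 : 0 < i) (hi : i < w + 1) := lay.c_inj (i + 1) (by omega) 1 (by omega)
      have hoc0 (a : A) : out a (c 0) = inp a (c 0) :=
        hout' a _ fun i hi => (lay.q_ne_c i hi 0 (by omega)).symm
      have hoc1 (a : A) : out a (c 1) = inp a (c 1) :=
        hout' a _ fun i hi => (lay.q_ne_c i hi 1 (by omega)).symm
      have ho' (a : A) (i : ℕ) (hi : i < w + 1) : out a (q (i + 1)) = (m a / 2 + n a / 2 +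
          (((m a).testBit 0 + cin a) * ((n a).testBit 0 + cin a) + cin a : Bool).toNat).testBit i := by
        rw [hout a _ (by omega), Nat.testBit_succ, half_add_carry]
      rw [adder]
      cases hk' : k 0 with
      | none =>
        simp only [hk', Option.elim] at hk0
        dsimp only [Option.elim]
        set v₁ : A → ι → Bool := fun a => update (inp a) (c 1) (inp a (q 0) * inp a (c 0)) with hv₁
        set v₂ : A → ι → Bool := fun a => update (update (out a) (q 0) (inp a (q 0))) (c 1)
          (inp a (q 0) * inp a (c 0)) with hv₂
        set v₃ : A → ι → Bool := fun a => update (out a) (q 0) (inp a (q 0)) with hv₃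
        have s1 : (tof (q 0) (c 0) (c 1)).Acts inp v₁ 0 :=
          acts_tof_of hcq hqc1 hc01 (fun a => by
              rw [hv₁]; dsimp only; rw [update_self, hc1]
              exact (zero_add (inp a (q 0) * inp a (c 0))).symm)
            fun a r hr => by rw [hv₁]; exact update_of_ne hr _ _
        have s2 : (adder (w + 1) (fun i => q (i + 1)) (fun i => k (i + 1))
            (fun i => c (i + 1))).Acts v₁ v₂ 0 := by
          refine ih lay.tail (m := fun a => m a / 2) (n := fun a => n a / 2)
            (cin := fun a => ((m a).testBit 0 + cin a) * ((n a).testBit 0 + cin a) + cin a)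
            (fun a i hi => ?_) (fun a i hi => ?_) (fun a _ => ?_) (fun a i h0 hi => ?_)
            (fun a i hi => ?_) fun a r hr => ?_
          · simp only [hv₁, update_of_ne (hqc (i + 1) (by omega)), hq a _ (show i + 1 < w + 2 by omega),
              Nat.testBit_succ]
          · rw [← Nat.testBit_succ, ← hk a (i + 1) (by omega)]
            cases hki : k (i + 1) with
            | none => rfl
            | some r =>
              have : r ≠ c 1 := fun e =>
                lay.c_ne_k 1 (by omega) (i + 1) (by omega) (e ▸ hki)
              simp only [Option.elim, hv₁, update_of_ne this]
          · simp only [hv₁, zero_add, update_self, ← hk0, hq0, hc0]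
            generalize (m a).testBit 0 = x
            generalize cin a = y
            revert x y
            decide
          · simp only [hv₁, update_of_ne (hcc i h0 hi).symm, hc a _ (Nat.succ_pos i) (show i + 1 < w + 2 by omega)]
          · simp only [hv₂, update_of_ne (hqc (i + 1) (by omega)), update_of_ne (hqq i hi).symm,
              ho' a i hi]
          · by_cases h1 : r = c 1
            · subst h1; simp only [hv₁, hv₂, update_self]
            · by_cases h2 : r = q 0
              · subst h2; simp only [hv₁, hv₂, update_self, update_of_ne h1]
              · simp only [hv₁, hv₂, update_of_ne h1, update_of_ne h2]
                refine hout' a r fun i hi => ?_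
                cases i with
                | zero => exact h2
                | succ i => exact hr i (by omega)
        have s3 : (unAnd (q 0) (c 0) (c 1)).Acts v₂ v₃ 0 :=
          acts_unAnd_of hcq hqc1 hc01
            (fun a => by simp only [hv₂, update_self, update_of_ne hqc1, update_of_ne hc01,
              update_of_ne hcq.symm, hoc0])
            (fun a => by simp only [hv₃, update_of_ne hqc1.symm, hoc1, hc1])
            fun a r hr => by simp only [hv₂, hv₃, update_of_ne hr]
        have s4 : (cnot (c 0) (q 0)).Acts v₃ out 0 :=
          acts_cnot_of hcq.symm (fun a => by
              simp only [hv₃, update_self, update_of_ne hcq.symm, hoc0, ho, hq0, hc0, ← hk0]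
              congr 1
              exact add_zero ((m a).testBit 0))
            fun a r hr => by simp only [hv₃, update_of_ne hr]
        exact s1.append₀ (s2.append₀ (s3.append₀ s4))
      | some k₀ =>
        simp only [hk', Option.elim] at hk0
        dsimp only [Option.elim]
        have hkq (i : ℕ) (hi : i < w + 2) : k₀ ≠ q i := fun e =>
          lay.q_ne_k i hi 0 (by omega) (e ▸ hk')
        have hkc (i : ℕ) (hi : i < w + 2) : k₀ ≠ c i := fun e =>
          lay.c_ne_k i hi 0 (by omega) (e ▸ hk')
        have hkq0 := hkq 0 (by omega)
        have hkc0 := hkc 0 (by omega)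
        have hkc1 := hkc 1 (by omega)
        have hok (a : A) : out a k₀ = inp a k₀ := hout' a _ hkq
        -- The labels before and after the recursive call, as functions of the carry to be passed.
        set u : A → Bool → ι → Bool := fun a s => update (update (update (inp a)
          (q 0) (inp a (q 0) + inp a (c 0))) k₀ (inp a k₀ + inp a (c 0))) (c 1) s with hu
        set v : A → Bool → ι → Bool := fun a s => update (update (update (out a)
          (q 0) (inp a (q 0) + inp a (c 0))) k₀ (inp a k₀ + inp a (c 0))) (c 1) s with hv
        set p : A → Bool := fun a => (inp a (q 0) + inp a (c 0)) * (inp a k₀ + inp a (c 0)) with hp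
        have s1 : (cnot (c 0) (q 0)).Acts inp
            (fun a => update (inp a) (q 0) (inp a (q 0) + inp a (c 0))) 0 := acts_cnot hcq.symm inp
        have s2 : (cnot (c 0) k₀).Acts
            (fun a => update (inp a) (q 0) (inp a (q 0) + inp a (c 0))) (fun a => u a false) 0 :=
          acts_cnot_of hkc0.symm (fun a => by
              simp only [hu, update_self, update_of_ne hkc1, update_of_ne hkq0,
                update_of_ne hcq.symm])
            fun a r hr => by
              by_cases h1 : r = c 1
              · subst h1; simp only [hu, update_self, update_of_ne hqc1.symm, hc1]
              · simp only [hu, update_of_ne hr, update_of_ne h1]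
        have s3 : (tof (q 0) k₀ (c 1)).Acts (fun a => u a false) (fun a => u a (p a)) 0 :=
          acts_tof_of hkq0.symm hqc1 hkc1 (fun a => by
              simp only [hu, hp, update_self, update_of_ne hqc1, update_of_ne hkq0.symm,
                update_of_ne hkc1]
              exact (zero_add (_ : Bool)).symm)
            fun a r hr => by simp only [hu, update_of_ne hr]
        have s4 : (cnot (c 0) (c 1)).Acts (fun a => u a (p a))
            (fun a => u a (p a + inp a (c 0))) 0 :=
          acts_cnot_of hc01 (fun a => by
              simp only [hu, update_self, update_of_ne hc01, update_of_ne hkc0.symm,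
                update_of_ne hcq.symm])
            fun a r hr => by simp only [hu, update_of_ne hr]
        have s5 : (adder (w + 1) (fun i => q (i + 1)) (fun i => k (i + 1))
            (fun i => c (i + 1))).Acts (fun a => u a (p a + inp a (c 0)))
              (fun a => v a (p a + inp a (c 0))) 0 := by
          refine ih lay.tail (m := fun a => m a / 2) (n := fun a => n a / 2)
            (cin := fun a => ((m a).testBit 0 + cin a) * ((n a).testBit 0 + cin a) + cin a)
            (fun a i hi => ?_) (fun a i hi => ?_) (fun a _ => ?_) (fun a i h0 hi => ?_)
            (fun a i hi => ?_) fun a r hr => ?_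
          · simp only [hu, update_of_ne (hqc (i + 1) (by omega)), update_of_ne (hqq i hi).symm,
              update_of_ne (hkq (i + 1) (by omega)).symm,
              hq a _ (show i + 1 < w + 2 by omega), Nat.testBit_succ]
          · rw [← Nat.testBit_succ, ← hk a (i + 1) (by omega)]
            cases hki : k (i + 1) with
            | none => rfl
            | some r =>
              have h1 : r ≠ c 1 := fun e =>
                lay.c_ne_k 1 (by omega) (i + 1) (by omega) (e ▸ hki)
              have h2 : r ≠ q 0 := fun e =>
                lay.q_ne_k 0 (by omega) (i + 1) (by omega) (e ▸ hki)
              have h3 : r ≠ k₀ := fun e =>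
                lay.k_inj (i + 1) (by omega) 0 (by omega) k₀ hk' (e ▸ hki)
              simp only [Option.elim, hu, update_of_ne h1, update_of_ne h2, update_of_ne h3]
          · simp only [hu, hp, zero_add, update_self, hk0, hq0, hc0]
          · simp only [hu, update_of_ne (hcc i h0 hi).symm, update_of_ne (hkc (i + 1) (by omega)).symm,
              update_of_ne (hq0c (i + 1) (by omega)).symm,
              hc a _ (Nat.succ_pos i) (show i + 1 < w + 2 by omega)]
          · simp only [hv, update_of_ne (hqc (i + 1) (by omega)), update_of_ne (hqq i hi).symm,
              update_of_ne (hkq (i + 1) (by omega)).symm, ho' a i hi]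
          · by_cases h1 : r = c 1
            · subst h1; simp only [hu, hv, update_self]
            · by_cases h3 : r = k₀
              · subst h3; simp only [hu, hv, update_self, update_of_ne h1]
              · by_cases h2 : r = q 0
                · subst h2; simp only [hu, hv, update_self, update_of_ne h1, update_of_ne h3]
                · simp only [hu, hv, update_of_ne h1, update_of_ne h2, update_of_ne h3]
                  refine hout' a r fun i hi => ?_
                  cases i with
                  | zero => exact h2
                  | succ i => exact hr i (by omega)
        have s6 : (cnot (c 0) (c 1)).Acts (fun a => v a (p a + inp a (c 0)))
            (fun a => v a (p a)) 0 :=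
          acts_cnot_of hc01 (fun a => by
              simp only [hv, update_self, update_of_ne hc01, update_of_ne hkc0.symm,
                update_of_ne hcq.symm, hoc0]
              generalize p a = x
              generalize inp a (c 0) = y
              revert x y
              decide)
            fun a r hr => by simp only [hv, update_of_ne hr]
        have s7 : (unAnd (q 0) k₀ (c 1)).Acts (fun a => v a (p a)) (fun a => v a false) 0 :=
          acts_unAnd_of hkq0.symm hqc1 hkc1 (fun a => by
              simp only [hv, hp, update_self, update_of_ne hqc1, update_of_ne hkq0.symm,
                update_of_ne hkc1])
            (fun a => by simp only [hv, update_self])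
            fun a r hr => by simp only [hv, update_of_ne hr]
        have s8 : (cnot (c 0) k₀).Acts (fun a => v a false)
            (fun a => update (out a) (q 0) (inp a (q 0) + inp a (c 0))) 0 :=
          acts_cnot_of hkc0.symm (fun a => by
              simp only [hv, update_self, update_of_ne hkc1, update_of_ne hkq0,
                update_of_ne hcq.symm, update_of_ne hc01, update_of_ne hkc0.symm, hoc0, hok]
              generalize inp a k₀ = x
              generalize inp a (c 0) = y
              revert x y
              decide)
            fun a r hr => by
              by_cases h1 : r = c 1
              · subst h1; simp only [hv, update_self, update_of_ne hqc1.symm, hoc1, hc1]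
              · simp only [hv, update_of_ne hr, update_of_ne h1]
        have s9 : (cnot k₀ (q 0)).Acts
            (fun a => update (out a) (q 0) (inp a (q 0) + inp a (c 0))) out 0 :=
          acts_cnot_of hkq0 (fun a => by
              simp only [update_self, update_of_ne hkq0, hok, ho, hq0, hc0, hk0]
              exact add_right_comm ((m a).testBit 0) ((n a).testBit 0) (cin a))
            fun a r hr => by simp only [update_of_ne hr]
        exact s1.append₀ (s2.append₀ (s3.append₀ (s4.append₀ (s5.append₀ (s6.append₀
          (s7.append₀ (s8.append₀ s9)))))))

/-- `X` gates on the qubits `q i`, `i < w`. -/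
def xAll (q : ℕ → ι) : ℕ → QCircuit ι
  | 0 => .done
  | w + 1 => xAll q w ++ x (q w)

theorem toffoliCount_xAll (q : ℕ → ι) (w : ℕ) : (xAll q w).toffoliCount = 0 := by
  induction w with
  | zero => rfl
  | succ w ih => rw [xAll, toffoliCount_append, ih, toffoliCount_x]

theorem acts_xAll {w : ℕ} {q : ℕ → ι} (hq : ∀ j < w, ∀ i < j, q i ≠ q j) {inp out : A → ι → Bool}
    (hout : ∀ a, ∀ i < w, out a (q i) = !inp a (q i))
    (hout' : ∀ a r, (∀ i < w, r ≠ q i) → out a r = inp a r) : (xAll q w).Acts inp out 0 := by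
  induction w generalizing out with
  | zero =>
    exact acts_done.congr (fun _ => rfl)
      (fun a => funext fun r => hout' a r fun i hi => absurd hi (by omega)) fun _ => rfl
  | succ w ih =>
    refine (ih (out := fun a => update (out a) (q w) (inp a (q w)))
      (fun j hj => hq j (by omega)) (fun a i hi => ?_) fun a r hr => ?_).append₀
      ((acts_x (q w) _).congr (fun _ => rfl) (fun a => ?_) fun _ => rfl)
    · rw [update_of_ne (hq w (by omega) i hi), hout a i (by omega)]
    · by_cases h : r = q w
      · subst h; rw [update_self]
      · rw [update_of_ne h]
        refine hout' a r fun i hi => ?_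
        rcases Nat.lt_succ_iff_lt_or_eq.1 hi with hi | rfl
        · exact hr i hi
        · exact h
    · rw [update_self, update_idem, ← hout a w (by omega), update_eq_self]

/-- Subtraction, by addition to the complement. -/
def subtractor (w : ℕ) (q : ℕ → ι) (k : ℕ → Option ι) (c : ℕ → ι) : QCircuit ι :=
  xAll q w ++ (adder w q k c ++ xAll q w)

theorem toffoliCount_subtractor (w : ℕ) (q : ℕ → ι) (k : ℕ → Option ι) (c : ℕ → ι) :
    (subtractor w q k c).toffoliCount ≤ w := by
  have := toffoliCount_adder w q k c
  simp only [subtractor, toffoliCount_append, toffoliCount_xAll]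
  omega

theorem acts_subtractor {w : ℕ} {q : ℕ → ι} {k : ℕ → Option ι} {c : ℕ → ι}
    (lay : AdderLayout w q k c) {inp out : A → ι → Bool} {m n : A → ℕ}
    (hq : ∀ a, ∀ i < w, inp a (q i) = (m a).testBit i)
    (hk : ∀ a, ∀ i < w, (k i).elim false (inp a) = (n a).testBit i)
    (hc : ∀ a, ∀ i < w, inp a (c i) = false)
    (hm : ∀ a, m a < 2 ^ w) (hn : ∀ a, n a ≤ m a)
    (hout : ∀ a, ∀ i < w, out a (q i) = (m a - n a).testBit i)
    (hout' : ∀ a r, (∀ i < w, r ≠ q i) → out a r = inp a r) :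
    (subtractor w q k c).Acts inp out 0 := by
  classical
  set v : A → ι → Bool := fun a r => if ∃ i < w, r = q i then !inp a r else inp a r with hv
  set v' : A → ι → Bool := fun a r => if ∃ i < w, r = q i then !out a r else out a r with hv'
  have hvq (a : A) (i : ℕ) (hi : i < w) : v a (q i) = !inp a (q i) := if_pos ⟨i, hi, rfl⟩
  have hv'q (a : A) (i : ℕ) (hi : i < w) : v' a (q i) = !out a (q i) := if_pos ⟨i, hi, rfl⟩
  have hvr (a : A) (r : ι) (hr : ∀ i < w, r ≠ q i) : v a r = inp a r :=
    if_neg fun ⟨i, hi, e⟩ => hr i hi e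
  have hv'r (a : A) (r : ι) (hr : ∀ i < w, r ≠ q i) : v' a r = out a r :=
    if_neg fun ⟨i, hi, e⟩ => hr i hi e
  refine (acts_xAll lay.q_inj hvq hvr).append₀ (Acts.append₀ (mid := v') (acts_adder lay
    (m := fun a => 2 ^ w - (m a + 1)) (n := n) (cin := fun _ => false) (fun a i hi => ?_)
    (fun a i hi => ?_) (fun a hw => ?_) (fun a i _ hi => ?_) (fun a i hi => ?_) fun a r hr => ?_)
    (acts_xAll lay.q_inj (fun a i hi => ?_) fun a r hr => (hv'r a r hr).symm))
  · rw [hvq a i hi, hq a i hi, Nat.testBit_two_pow_sub_succ (hm a)]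
    simp [hi]
  · rw [← hk a i hi]
    cases hki : k i with
    | none => rfl
    | some r => exact hvr a r fun j hj e => lay.q_ne_k j hj i hi (e ▸ hki)
  · rw [hvr a _ fun j hj => (lay.q_ne_c j hj 0 hw).symm, hc a 0 hw]
  · rw [hvr a _ fun j hj => (lay.q_ne_c j hj i hi).symm, hc a i hi]
  · have h1 := hm a
    have h2 := hn a
    rw [hv'q a i hi, hout a i hi, Bool.toNat_false, add_zero,
      show 2 ^ w - (m a + 1) + n a = 2 ^ w - (m a - n a + 1) by omega,
      Nat.testBit_two_pow_sub_succ (by omega)]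
    simp [hi]
  · rw [hv'r a r hr, hout' a r hr, hvr a r hr]
  · rw [hv'q a i hi, Bool.not_not]

end QCircuit

/-! ### In-place permutations and division by a constant -/

namespace QCircuit

/-- Moves the qubits `tmp i` to the qubits `r i`, initially `0`, for `i < d`. -/
def moveAll (r tmp : ℕ → ι) : ℕ → QCircuit ι
  | 0 => .done
  | d + 1 => moveAll r tmp d ++ (cnot (tmp d) (r d) ++ cnot (r d) (tmp d))

theorem toffoliCount_moveAll (r tmp : ℕ → ι) (d : ℕ) : (moveAll r tmp d).toffoliCount = 0 := by
  induction d with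
  | zero => rfl
  | succ d ih => simp only [moveAll, toffoliCount_append, ih, toffoliCount_cnot]

theorem acts_moveAll {d : ℕ} {r tmp : ℕ → ι} (hr : ∀ j < d, ∀ i < j, r i ≠ r j)
    (ht : ∀ j < d, ∀ i < j, tmp i ≠ tmp j) (hrt : ∀ i < d, ∀ j < d, r i ≠ tmp j)
    {inp out : A → ι → Bool} (hi : ∀ a, ∀ i < d, inp a (r i) = false)
    (hor : ∀ a, ∀ i < d, out a (r i) = inp a (tmp i))
    (hot : ∀ a, ∀ i < d, out a (tmp i) = false)
    (ho : ∀ a s, (∀ i < d, s ≠ r i ∧ s ≠ tmp i) → out a s = inp a s) :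
    (moveAll r tmp d).Acts inp out 0 := by
  induction d generalizing out with
  | zero =>
    exact acts_done.congr (fun _ => rfl)
      (fun a => funext fun r => ho a r fun i hi => absurd hi (by omega)) fun _ => rfl
  | succ d ih =>
    have hd := hrt d (by omega) d (by omega)
    set v : A → ι → Bool := fun a =>
      update (update (out a) (r d) false) (tmp d) (inp a (tmp d)) with hv
    set v' : A → ι → Bool := fun a => update (out a) (tmp d) (inp a (tmp d)) with hv'
    have s1 : (moveAll r tmp d).Acts inp v 0 := by
      refine ih (fun j hj => hr j (by omega)) (fun j hj => ht j (by omega))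
        (fun i hi j hj => hrt i (by omega) j (by omega)) (fun a i h => hi a i (by omega))
        (fun a i h => ?_) (fun a i h => ?_) fun a s hs => ?_
      · simp only [hv, update_of_ne (hrt i (by omega) d (by omega)),
          update_of_ne (hr d (by omega) i h), hor a i (by omega)]
      · simp only [hv, update_of_ne (ht d (by omega) i h),
          update_of_ne (hrt d (by omega) i (by omega)).symm, hot a i (by omega)]
      · by_cases h1 : s = tmp d
        · subst h1; simp only [hv, update_self]
        · by_cases h2 : s = r d
          · subst h2; simp only [hv, update_of_ne h1, update_self, hi a d (by omega)]
          · simp only [hv, update_of_ne h1, update_of_ne h2]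
            refine ho a s fun i h => ?_
            rcases Nat.lt_succ_iff_lt_or_eq.1 h with h | rfl
            · exact hs i h
            · exact ⟨h2, h1⟩
    have s2 : (cnot (tmp d) (r d)).Acts v v' 0 :=
      acts_cnot_of hd.symm (fun a => by
          simp only [hv, hv', update_self, update_of_ne hd, hor a d (by omega)]
          exact (zero_add (inp a (tmp d))).symm)
        fun a s hs => by
          by_cases h : s = tmp d
          · subst h; simp only [hv, hv', update_self]
          · simp only [hv, hv', update_of_ne h, update_of_ne hs]
    have s3 : (cnot (r d) (tmp d)).Acts v' out 0 :=
      acts_cnot_of hd (fun a => by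
          simp only [hv', update_self, update_of_ne hd, hot a d (by omega), hor a d (by omega)]
          exact (Bool.xor_self (inp a (tmp d))).symm)
        fun a s hs => by simp only [hv', update_of_ne hs]
    exact s1.append₀ (s2.append₀ s3)

/-- The qubits of an in-place permutation are distinct. -/
structure InPlaceLayout (d : ℕ) (r tmp anc : ℕ → ι) : Prop where
  r_inj : ∀ j < d, ∀ i < j, r i ≠ r j
  tmp_inj : ∀ j < d, ∀ i < j, tmp i ≠ tmp j
  anc_inj : ∀ j, j + 1 < d → ∀ i < j, anc i ≠ anc j
  r_ne_tmp : ∀ i < d, ∀ j < d, r i ≠ tmp j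
  r_ne_anc : ∀ i < d, ∀ j, j + 1 < d → r i ≠ anc j
  tmp_ne_anc : ∀ i < d, ∀ j, j + 1 < d → tmp i ≠ anc j

theorem InPlaceLayout.symm {d : ℕ} {r tmp anc : ℕ → ι} (h : InPlaceLayout d r tmp anc) :
    InPlaceLayout d tmp r anc where
  r_inj := h.tmp_inj
  tmp_inj := h.r_inj
  anc_inj := h.anc_inj
  r_ne_tmp i hi j hj := (h.r_ne_tmp j hj i hi).symm
  r_ne_anc := h.tmp_ne_anc
  tmp_ne_anc := h.r_ne_anc

theorem ne_of_inj {d : ℕ} {f : ℕ → ι} (h : ∀ j < d, ∀ i < j, f i ≠ f j) {i j : ℕ} (hi : i < d)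
    (hj : j < d) (hij : i ≠ j) : f i ≠ f j := by
  rcases lt_or_gt_of_ne hij with h' | h'
  · exact h j hj i h'
  · exact (h i hi j h').symm

/-- Every register of a label can be overwritten by the digits of a number. -/
theorem exists_write {d : ℕ} {f : ℕ → ι} (h : ∀ j < d, ∀ i < j, f i ≠ f j) (x : A → ℕ)
    (u : A → ι → Bool) : ∃ v : A → ι → Bool, (∀ a, ∀ i < d, v a (f i) = (x a).testBit i) ∧
      ∀ a t, (∀ i < d, t ≠ f i) → v a t = u a t := by
  classical
  refine ⟨fun a t => if h : ∃ i < d, t = f i then (x a).testBit h.choose else u a t,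
    fun a i hi => ?_, fun a t ht => dif_neg fun ⟨i, hi, e⟩ => ht i hi e⟩
  have hex : ∃ j < d, f i = f j := ⟨i, hi, rfl⟩
  have hch : i = hex.choose := by
    by_contra hne
    exact ne_of_inj h hi hex.choose_spec.1 hne hex.choose_spec.2
  dsimp only
  rw [dif_pos hex, ← hch]

/-- The lookup layout with address `r` and the single register `tmp`. -/
def InPlaceLayout.lookup {d : ℕ} {r tmp anc : ℕ → ι} (h : InPlaceLayout d r tmp anc) :
    LookupLayout ι d where
  depth := d
  m := 1
  hi := r
  anc := anc
  lo := r
  reg _ i := tmp i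
  m_pos := one_pos
  hi_inj := h.r_inj
  hi_ne_anc := h.r_ne_anc
  anc_inj := h.anc_inj
  reg_inj k hk k' hk' i i' e := by
    refine ⟨by omega, ?_⟩
    by_contra hii
    exact ne_of_inj h.tmp_inj i.2 i'.2 (fun e => hii (Fin.ext e)) e
  reg_ne_hi k _ i j hj := (h.r_ne_tmp j hj i i.2).symm
  reg_ne_anc k _ i j hj := h.tmp_ne_anc i i.2 j hj
  reg_ne_lo k _ i e he := absurd he (by have := Nat.two_pow_pos e; omega)

/-- Addition of the word `f h` to `tmp`, for the number `h < N` in `r`. -/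
noncomputable def tableXor {d : ℕ} {r tmp anc : ℕ → ι} (lay : InPlaceLayout d r tmp anc) (N : ℕ)
    (f : ℕ → ℕ) : QCircuit ι :=
  conjHs (lay.lookup.phaseClean N fun h _ i => (f h).testBit i) lay.lookup.target

theorem toffoliCount_tableXor {d : ℕ} {r tmp anc : ℕ → ι} (lay : InPlaceLayout d r tmp anc)
    {N : ℕ} (hN : 0 < N) (f : ℕ → ℕ) : (tableXor lay N f).toffoliCount ≤ N := by
  have h := LookupLayout.toffoliCount_phaseClean (lay := lay.lookup)
    (X := fun h _ i => (f h).testBit i) hN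
  have hm : (lay.lookup.m - 1) * d = 0 := by simp [InPlaceLayout.lookup]
  rw [tableXor, toffoliCount_conjHs]
  omega

theorem acts_tableXor {d : ℕ} {r tmp anc : ℕ → ι} (lay : InPlaceLayout d r tmp anc) {N : ℕ}
    {f : ℕ → ℕ} {inp out : A → ι → Bool} {n : A → ℕ} (hN : N ≤ 2 ^ d) (hn : ∀ a, n a < N)
    (hr : ∀ a, ∀ i < d, inp a (r i) = (n a).testBit i)
    (hanc : ∀ a i, i + 1 < d → inp a (anc i) = false)
    (hout : ∀ a, ∀ i < d, out a (tmp i) = inp a (tmp i) + (f (n a)).testBit i)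
    (hout' : ∀ a s, (∀ i < d, s ≠ tmp i) → out a s = inp a s) :
    (tableXor lay N f).Acts inp out 0 := by
  refine LookupLayout.acts_xorClean (h := n) (l := fun _ => 0) (fun a => ?_) hn
    (fun a k i hk hkm => absurd hkm ?_) (fun a i => hout a i i.2) fun a s hs => ?_
  · exact ⟨hr a, fun e he => absurd he (by
      have := Nat.two_pow_pos e; simp only [InPlaceLayout.lookup]; omega), hanc a,
      (hn a).trans_le hN, one_pos⟩
  · simp only [InPlaceLayout.lookup]; omega
  · exact hout' a s fun i hi e => hs ⟨⟨i, hi⟩, e.symm⟩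

/-- Replacement of the number `n < N` in `r` by `f n`, where `g` inverts `f`. -/
noncomputable def inPlace {d : ℕ} {r tmp anc : ℕ → ι} (lay : InPlaceLayout d r tmp anc) (N : ℕ)
    (f g : ℕ → ℕ) : QCircuit ι :=
  tableXor lay N f ++ (tableXor lay.symm N g ++ moveAll r tmp d)

theorem toffoliCount_inPlace {d : ℕ} {r tmp anc : ℕ → ι} (lay : InPlaceLayout d r tmp anc)
    {N : ℕ} (hN : 0 < N) (f g : ℕ → ℕ) : (inPlace lay N f g).toffoliCount ≤ 2 * N := by
  have h1 := toffoliCount_tableXor lay hN f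
  have h2 := toffoliCount_tableXor lay.symm hN g
  simp only [inPlace, toffoliCount_append, toffoliCount_moveAll]
  omega

/-- With `f n` computed in `tmp`, the number `n = g (f n)` in `r` is cleared by a second lookup. -/
theorem acts_inPlace {d : ℕ} {r tmp anc : ℕ → ι} (lay : InPlaceLayout d r tmp anc) {N : ℕ}
    {f g : ℕ → ℕ} {inp out : A → ι → Bool} {n : A → ℕ} (hN : N ≤ 2 ^ d) (hn : ∀ a, n a < N)
    (hf : ∀ a, f (n a) < N) (hgf : ∀ a, g (f (n a)) = n a)
    (hr : ∀ a, ∀ i < d, inp a (r i) = (n a).testBit i)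
    (htmp : ∀ a, ∀ i < d, inp a (tmp i) = false)
    (hanc : ∀ a i, i + 1 < d → inp a (anc i) = false)
    (hout : ∀ a, ∀ i < d, out a (r i) = (f (n a)).testBit i)
    (hout' : ∀ a s, (∀ i < d, s ≠ r i) → out a s = inp a s) :
    (inPlace lay N f g).Acts inp out 0 := by
  classical
  have hrt := lay.r_ne_tmp
  -- The labels with `f n` in `tmp`, and `n` or `0` in `r`.
  obtain ⟨v₁, h₁, h₁'⟩ := exists_write lay.tmp_inj (fun a => f (n a)) inp
  set v₂ : A → ι → Bool := fun a s => if ∃ i < d, s = r i then false else v₁ a s with hv₂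
  have h₂ (a : A) (i : ℕ) (hi : i < d) : v₂ a (r i) = false := if_pos ⟨i, hi, rfl⟩
  have h₂' (a : A) (s : ι) (hs : ∀ i < d, s ≠ r i) : v₂ a s = v₁ a s :=
    if_neg fun ⟨i, hi, e⟩ => hs i hi e
  have s1 : (tableXor lay N f).Acts inp v₁ 0 :=
    acts_tableXor lay hN hn hr hanc (fun a i hi => by
      rw [h₁ a i hi, htmp a i hi]; exact (zero_add ((f (n a)).testBit i)).symm) h₁'
  have s2 : (tableXor lay.symm N g).Acts v₁ v₂ 0 :=
    acts_tableXor lay.symm hN (n := fun a => f (n a)) hf h₁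
      (fun a i hi => by rw [h₁' a _ fun j hj => (lay.tmp_ne_anc j hj i hi).symm, hanc a i hi])
      (fun a i hi => by
        rw [h₂ a i hi, hgf, h₁' a _ fun j hj => hrt i hi j hj, hr a i hi]
        exact (Bool.xor_self ((n a).testBit i)).symm) h₂'
  have s3 : (moveAll r tmp d).Acts v₂ out 0 :=
    acts_moveAll lay.r_inj lay.tmp_inj hrt h₂
      (fun a i hi => by
        rw [hout a i hi, h₂' a _ fun j hj => (hrt j hj i hi).symm, h₁ a i hi])
      (fun a i hi => by rw [hout' a _ fun j hj => (hrt j hj i hi).symm, htmp a i hi])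
      fun a s hs => by
        rw [hout' a s fun i hi => (hs i hi).1, h₂' a s fun i hi => (hs i hi).1,
          h₁' a s fun i hi => (hs i hi).2]
  exact s1.append₀ (s2.append₀ s3)

/-- The register of a division step: the next digit of the dividend, below the remainder. -/
def stepReg (q₀ : ι) (ρ : ℕ → ι) : ℕ → ι
  | 0 => q₀
  | e + 1 => ρ e

/-- One step of long division by `m` in base two: `x = 2 * remainder + digit` is replaced by the new
remainder, followed by a digit of the quotient. -/
def divStep (m x : ℕ) : ℕ := 2 * (x % m) + x / m

/-- The inverse of `divStep`. -/
def undivStep (m y : ℕ) : ℕ := y % 2 * m + y / 2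

theorem div_lt_two {m x : ℕ} (hx : x < 2 * m) : x / m < 2 :=
  Nat.div_lt_of_lt_mul (by rwa [mul_comm])

theorem divStep_lt {m x : ℕ} (hx : x < 2 * m) : divStep m x < 2 * m := by
  have h1 := div_lt_two hx
  have h2 := Nat.mod_lt x (show 0 < m by omega)
  rw [divStep]
  omega

theorem undivStep_divStep {m x : ℕ} (hx : x < 2 * m) : undivStep m (divStep m x) = x := by
  have h1 := div_lt_two hx
  have h2 : divStep m x % 2 = x / m := by
    rw [divStep]
    generalize x / m = c at h1 ⊢
    omega
  have h3 : divStep m x / 2 = x % m := by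
    rw [divStep]
    generalize x / m = c at h1 ⊢
    omega
  rw [undivStep, h2, h3, mul_comm]
  exact Nat.div_add_mod x m

/-- The qubits of a divider: the digits `q` of the dividend, the `s` digits `ρ` of the remainder, and
the ancillas of the in-place permutations. -/
structure DivLayout (d s : ℕ) (q ρ tmp anc : ℕ → ι) : Prop where
  q_inj : ∀ j < d, ∀ i < j, q i ≠ q j
  q_ne_rem : ∀ i < d, ∀ j < s, q i ≠ ρ j
  q_ne_tmp : ∀ i < d, ∀ j < s + 1, q i ≠ tmp j
  q_ne_anc : ∀ i < d, ∀ j < s, q i ≠ anc j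
  rem_inj : ∀ j < s, ∀ i < j, ρ i ≠ ρ j
  tmp_inj : ∀ j < s + 1, ∀ i < j, tmp i ≠ tmp j
  anc_inj : ∀ j < s, ∀ i < j, anc i ≠ anc j
  rem_ne_tmp : ∀ i < s, ∀ j < s + 1, ρ i ≠ tmp j
  rem_ne_anc : ∀ i < s, ∀ j < s, ρ i ≠ anc j
  tmp_ne_anc : ∀ i < s + 1, ∀ j < s, tmp i ≠ anc j

variable {d s : ℕ} {q ρ tmp anc : ℕ → ι}

theorem DivLayout.init (h : DivLayout (d + 1) s q ρ tmp anc) : DivLayout d s q ρ tmp anc where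
  q_inj j hj := h.q_inj j (by omega)
  q_ne_rem j hj := h.q_ne_rem j (by omega)
  q_ne_tmp j hj := h.q_ne_tmp j (by omega)
  q_ne_anc j hj := h.q_ne_anc j (by omega)
  rem_inj := h.rem_inj
  tmp_inj := h.tmp_inj
  anc_inj := h.anc_inj
  rem_ne_tmp := h.rem_ne_tmp
  rem_ne_anc := h.rem_ne_anc
  tmp_ne_anc := h.tmp_ne_anc

theorem DivLayout.step (h : DivLayout (d + 1) s q ρ tmp anc) :
    InPlaceLayout (s + 1) (stepReg (q d) ρ) tmp anc where
  r_inj j hj i hi := by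
    obtain ⟨j, rfl⟩ : ∃ k, j = k + 1 := ⟨j - 1, by omega⟩
    cases i with
    | zero => exact h.q_ne_rem d (by omega) j (by omega)
    | succ i => exact h.rem_inj j (by omega) i (by omega)
  tmp_inj := h.tmp_inj
  anc_inj j hj := h.anc_inj j (by omega)
  r_ne_tmp i hi j hj := by
    cases i with
    | zero => exact h.q_ne_tmp d (by omega) j hj
    | succ i => exact h.rem_ne_tmp i (by omega) j hj
  r_ne_anc i hi j hj := by
    cases i with
    | zero => exact h.q_ne_anc d (by omega) j (by omega)
    | succ i => exact h.rem_ne_anc i (by omega) j (by omega)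
  tmp_ne_anc i hi j hj := h.tmp_ne_anc i hi j (by omega)

/-- Long division by `m`: the dividend in `q` is replaced by the quotient, and the remainder in `ρ`
is updated. -/
noncomputable def divider (m s : ℕ) (q ρ tmp anc : ℕ → ι) :
    (d : ℕ) → DivLayout d s q ρ tmp anc → QCircuit ι
  | 0, _ => .done
  | d + 1, h => inPlace h.step (2 * m) (divStep m) (undivStep m) ++
      divider m s q ρ tmp anc d h.init

/-- The inverse of `divider`. -/
noncomputable def undivider (m s : ℕ) (q ρ tmp anc : ℕ → ι) :
    (d : ℕ) → DivLayout d s q ρ tmp anc → QCircuit ι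
  | 0, _ => .done
  | d + 1, h => undivider m s q ρ tmp anc d h.init ++
      inPlace h.step (2 * m) (undivStep m) (divStep m)

theorem toffoliCount_divider {m : ℕ} (hm : 0 < m) (lay : DivLayout d s q ρ tmp anc) :
    (divider m s q ρ tmp anc d lay).toffoliCount ≤ 4 * m * d := by
  induction d with
  | zero => exact Nat.zero_le _
  | succ d ih =>
    have h1 := ih lay.init
    have h2 := toffoliCount_inPlace lay.step (show 0 < 2 * m by omega) (divStep m) (undivStep m)
    rw [divider, toffoliCount_append, mul_add]
    omega

theorem toffoliCount_undivider {m : ℕ} (hm : 0 < m) (lay : DivLayout d s q ρ tmp anc) :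
    (undivider m s q ρ tmp anc d lay).toffoliCount ≤ 4 * m * d := by
  induction d with
  | zero => exact Nat.zero_le _
  | succ d ih =>
    have h1 := ih lay.init
    have h2 := toffoliCount_inPlace lay.step (show 0 < 2 * m by omega) (undivStep m) (divStep m)
    rw [undivider, toffoliCount_append, mul_add]
    omega

/-- The leading digit of the quotient of a long division, and what remains to be divided. -/
theorem long_division {m r n d : ℕ} (hr : r < m) :
    (r * 2 ^ (d + 1) + n % 2 ^ (d + 1)) / m =
        2 ^ d * ((2 * r + (n.testBit d).toNat) / m) +
          ((2 * r + (n.testBit d).toNat) % m * 2 ^ d + n % 2 ^ d) / m ∧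
      (r * 2 ^ (d + 1) + n % 2 ^ (d + 1)) % m =
        ((2 * r + (n.testBit d).toNat) % m * 2 ^ d + n % 2 ^ d) % m ∧
      ((2 * r + (n.testBit d).toNat) % m * 2 ^ d + n % 2 ^ d) / m < 2 ^ d := by
  have hm : 0 < m := by omega
  set x := 2 * r + (n.testBit d).toNat with hx
  have h1 : r * 2 ^ (d + 1) + n % 2 ^ (d + 1) = x * 2 ^ d + n % 2 ^ d := by
    rw [mod_two_pow_succ_of_testBit, hx, pow_succ]
    cases n.testBit d
    · simp; ring
    · simp; ring
  have h2 : x * 2 ^ d + n % 2 ^ d = x % m * 2 ^ d + n % 2 ^ d + m * (2 ^ d * (x / m)) := by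
    conv_lhs => rw [← Nat.div_add_mod x m]
    ring
  refine ⟨?_, ?_, ?_⟩
  · rw [h1, h2, Nat.add_mul_div_left _ _ hm, add_comm]
  · rw [h1, h2, Nat.add_mul_mod_self_left]
  · refine Nat.div_lt_of_lt_mul ?_
    have h3 := Nat.mod_lt x hm
    have h4 := Nat.mod_lt n (Nat.two_pow_pos d)
    calc x % m * 2 ^ d + n % 2 ^ d < x % m * 2 ^ d + 2 ^ d := by omega
      _ = (x % m + 1) * 2 ^ d := by ring
      _ ≤ m * 2 ^ d := Nat.mul_le_mul_right _ h3

/-- The remainder `r` so far is part of the dividend `r * 2 ^ d + n % 2 ^ d` of the remaining steps. -/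
theorem acts_divider {m : ℕ} (hms : m ≤ 2 ^ s) (lay : DivLayout d s q ρ tmp anc)
    {inp out : A → ι → Bool} {n r : A → ℕ} (hr : ∀ a, r a < m)
    (hq : ∀ a, ∀ i < d, inp a (q i) = (n a).testBit i)
    (hρ : ∀ a, ∀ i < s, inp a (ρ i) = (r a).testBit i)
    (htmp : ∀ a, ∀ i < s + 1, inp a (tmp i) = false)
    (hanc : ∀ a, ∀ i < s, inp a (anc i) = false)
    (hoq : ∀ a, ∀ i < d, out a (q i) = ((r a * 2 ^ d + n a % 2 ^ d) / m).testBit i)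
    (hoρ : ∀ a, ∀ i < s, out a (ρ i) = ((r a * 2 ^ d + n a % 2 ^ d) % m).testBit i)
    (ho : ∀ a t, (∀ i < d, t ≠ q i) → (∀ i < s, t ≠ ρ i) → out a t = inp a t) :
    (divider m s q ρ tmp anc d lay).Acts inp out 0 ∧
      (undivider m s q ρ tmp anc d lay).Acts out inp 0 := by
  classical
  induction d generalizing inp n r with
  | zero =>
    have h (a : A) : out a = inp a := by
      funext t
      by_cases ht : ∃ i < s, t = ρ i
      · obtain ⟨i, hi, rfl⟩ := ht
        rw [hoρ a i hi, hρ a i hi]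
        simp [Nat.mod_one, Nat.mod_eq_of_lt (hr a)]
      · exact ho a t (fun i hi => absurd hi (by omega)) fun i hi e => ht ⟨i, hi, e⟩
    exact ⟨acts_done.congr (fun _ => rfl) h fun _ => rfl,
      acts_done.congr (fun _ => rfl) (fun a => (h a).symm) fun _ => rfl⟩
  | succ d ih =>
    have hld (a : A) := long_division (n := n a) (d := d) (hr a)
    set y : A → ℕ := fun a => 2 * r a + ((n a).testBit d).toNat with hy
    have hym (a : A) : y a < 2 * m := by
      have h1 := hr a
      have h2 := Bool.toNat_lt ((n a).testBit d)
      simp only [hy]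
      omega
    -- The label after the first step of the division.
    obtain ⟨v, hvρ, hv⟩ := exists_write lay.rem_inj (fun a => y a % m)
      fun a => update (inp a) (q d) ((y a / m).testBit 0)
    have hvq (a : A) : v a (q d) = (y a / m).testBit 0 := by
      rw [hv a _ fun i hi => lay.q_ne_rem d (by omega) i hi, update_self]
    have hvq' (a : A) (i : ℕ) (hi : i < d) : v a (q i) = inp a (q i) := by
      rw [hv a _ fun j hj => lay.q_ne_rem i (by omega) j hj,
        update_of_ne (lay.q_inj d (by omega) i hi)]
    have hvt (a : A) (i : ℕ) (hi : i < s + 1) : v a (tmp i) = false := by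
      rw [hv a _ fun j hj => (lay.rem_ne_tmp j hj i hi).symm,
        update_of_ne (lay.q_ne_tmp d (by omega) i hi).symm, htmp a i hi]
    have hva (a : A) (i : ℕ) (hi : i < s) : v a (anc i) = false := by
      rw [hv a _ fun j hj => (lay.rem_ne_anc j hj i hi).symm,
        update_of_ne (lay.q_ne_anc d (by omega) i hi).symm, hanc a i hi]
    have hb (a : A) : inp a (q d) = (y a).testBit 0 := by
      rw [hq a d (by omega)]
      simp only [hy, Nat.testBit_zero]
      cases (n a).testBit d <;> simp
    have hinpr (a : A) (i : ℕ) (hi : i < s + 1) :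
        inp a (stepReg (q d) ρ i) = (y a).testBit i := by
      cases i with
      | zero => exact hb a
      | succ i =>
        have h2 := Bool.toNat_lt ((n a).testBit d)
        rw [stepReg, hρ a i (by omega), Nat.testBit_succ]
        congr 1
        simp only [hy]
        omega
    have hvr (a : A) (i : ℕ) (hi : i < s + 1) :
        v a (stepReg (q d) ρ i) = (divStep m (y a)).testBit i := by
      have h1 := div_lt_two (hym a)
      cases i with
      | zero =>
        rw [stepReg, hvq a, divStep, Nat.testBit_zero, Nat.testBit_zero, Nat.mul_add_mod]
      | succ i =>
        rw [stepReg, hvρ a i (by omega), Nat.testBit_succ, divStep]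
        congr 1
        generalize y a / m = c at h1 ⊢
        omega
    have hvo (a : A) (t : ι) (ht : ∀ i < s + 1, t ≠ stepReg (q d) ρ i) : v a t = inp a t := by
      rw [hv a t fun i hi => ht (i + 1) (by omega), update_of_ne (show t ≠ q d from ht 0 (by omega))]
    have hN : 2 * m ≤ 2 ^ (s + 1) := by rw [pow_succ]; omega
    have s1 : (inPlace lay.step (2 * m) (divStep m) (undivStep m)).Acts inp v 0 :=
      acts_inPlace lay.step hN hym (fun a => divStep_lt (hym a))
        (fun a => undivStep_divStep (hym a)) hinpr htmp (fun a i hi => hanc a i (by omega)) hvr hvo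
    have s1' : (inPlace lay.step (2 * m) (undivStep m) (divStep m)).Acts v inp 0 :=
      acts_inPlace lay.step hN (n := fun a => divStep m (y a)) (fun a => divStep_lt (hym a))
        (fun a => by rw [undivStep_divStep (hym a)]; exact hym a)
        (fun a => by rw [undivStep_divStep (hym a)]) hvr hvt (fun a i hi => hva a i (by omega))
        (fun a i hi => by rw [undivStep_divStep (hym a), hinpr a i hi])
        fun a t ht => (hvo a t ht).symm
    have s2 := ih lay.init (inp := v) (n := n) (r := fun a => y a % m)
      (fun a => Nat.mod_lt _ (by have := hr a; omega))
      (fun a i hi => by rw [hvq' a i hi, hq a i (by omega)]) hvρ hvt hva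
      (fun a i hi => by
        rw [hoq a i (by omega), (hld a).1, Nat.testBit_two_pow_mul_add _ (hld a).2.2, if_pos hi])
      (fun a i hi => by rw [hoρ a i hi, (hld a).2.1])
      fun a t ht ht' => by
        by_cases h : t = q d
        · subst h
          rw [hvq, hoq a d (by omega), (hld a).1, Nat.testBit_two_pow_mul_add _ (hld a).2.2,
            if_neg (lt_irrefl d), Nat.sub_self]
        · rw [hv a t ht', update_of_ne h]
          refine ho a t (fun i hi => ?_) ht'
          rcases Nat.lt_succ_iff_lt_or_eq.1 hi with hi | rfl
          · exact ht i hi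
          · exact h
    exact ⟨s1.append₀ s2.1, s2.2.append₀ s1'⟩

end QCircuit

/-! ### Layouts for addresses in binary -/

/-- Registers of `b` qubits: register `0` is `out`, the others are consecutive pieces of `pool`. -/
def regOf {b : ℕ} (out : Fin b → ι) (pool : ℕ → ι) : ℕ → Fin b → ι
  | 0, i => out i
  | k + 1, i => pool (k * b + i)

theorem pool_index_lt {b m k : ℕ} (hk : k + 1 < m) (i : Fin b) : k * b + i < (m - 1) * b :=
  calc k * b + i < k * b + b := by have := i.2; omega
    _ = (k + 1) * b := by ring
    _ ≤ (m - 1) * b := Nat.mul_le_mul_right _ (by omega)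

theorem pool_index_inj {b k k' : ℕ} {i i' : Fin b} (h : k * b + i = k' * b + i') :
    k = k' ∧ i = i' := by
  have hi := i.2
  have hi' := i'.2
  have hb : 0 < b := by omega
  have h1 : (k * b + i) / b = k := by
    rw [mul_comm, Nat.mul_add_div hb, Nat.div_eq_of_lt hi, add_zero]
  have h2 : (k' * b + i') / b = k' := by
    rw [mul_comm, Nat.mul_add_div hb, Nat.div_eq_of_lt hi', add_zero]
  have hk : k = k' := by rw [← h1, h, h2]
  subst hk
  exact ⟨rfl, Fin.ext (by omega)⟩

theorem regOf_ne {b m : ℕ} {out : Fin b → ι} {pool : ℕ → ι} {r : ι} (h : ∀ i, out i ≠ r)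
    (h' : ∀ n < (m - 1) * b, pool n ≠ r) {k : ℕ} (hk : k < m) (i : Fin b) :
    regOf out pool k i ≠ r := by
  cases k with
  | zero => exact h i
  | succ k => exact h' _ (pool_index_lt hk i)

theorem regOf_inj {b m : ℕ} {out : Fin b → ι} {pool : ℕ → ι} (hout : Injective out)
    (hpool : ∀ n < (m - 1) * b, ∀ n' < (m - 1) * b, pool n = pool n' → n = n')
    (hne : ∀ i, ∀ n < (m - 1) * b, out i ≠ pool n) :
    ∀ k < m, ∀ k' < m, ∀ i i', regOf out pool k i = regOf out pool k' i' → k = k' ∧ i = i' := by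
  intro k hk k' hk' i i' e
  cases k with
  | zero =>
    cases k' with
    | zero => exact ⟨rfl, hout e⟩
    | succ k' => exact absurd e (hne i _ (pool_index_lt hk' i'))
  | succ k =>
    cases k' with
    | zero => exact absurd e.symm (hne i' _ (pool_index_lt hk i))
    | succ k' =>
      obtain ⟨rfl, rfl⟩ := pool_index_inj
        (hpool _ (pool_index_lt hk i) _ (pool_index_lt hk' i') e)
      exact ⟨rfl, rfl⟩

/-- The lookup layout for an address of `t` bits, the lowest `p` of which select one of `2 ^ p`
registers. -/
def binaryLayout {b : ℕ} (t p : ℕ) (addr anc : ℕ → ι) (reg : ℕ → Fin b → ι) (hp : p ≤ t)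
    (h_addr : ∀ j < t, ∀ i < j, addr i ≠ addr j)
    (h_anc : ∀ j, j + 1 < t → ∀ i < j, anc i ≠ anc j)
    (h_addr_anc : ∀ i < t, ∀ j, j + 1 < t → addr i ≠ anc j)
    (h_reg : ∀ k < 2 ^ p, ∀ k' < 2 ^ p, ∀ i i', reg k i = reg k' i' → k = k' ∧ i = i')
    (h_reg_addr : ∀ k < 2 ^ p, ∀ i, ∀ j < t, reg k i ≠ addr j)
    (h_reg_anc : ∀ k < 2 ^ p, ∀ i j, j + 1 < t → reg k i ≠ anc j) : LookupLayout ι b where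
  depth := t - p
  m := 2 ^ p
  hi i := addr (p + i)
  anc := anc
  lo := addr
  reg := reg
  m_pos := Nat.two_pow_pos p
  hi_inj j hj i hi := h_addr _ (by omega) _ (by omega)
  hi_ne_anc i hi j hj := h_addr_anc _ (by omega) _ (by omega)
  anc_inj j hj i hi := h_anc _ (by omega) _ hi
  reg_inj := h_reg
  reg_ne_hi k hk i j hj := h_reg_addr k hk i _ (by omega)
  reg_ne_anc k hk i j hj := h_reg_anc k hk i j (by omega)
  reg_ne_lo k hk i e he := h_reg_addr k hk i e
    (((Nat.pow_lt_pow_iff_right (by norm_num)).1 he).trans_le hp)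

theorem binaryLayout_reads {b t p : ℕ} {addr anc : ℕ → ι} {reg : ℕ → Fin b → ι} (hp : p ≤ t)
    (h₁ : ∀ j < t, ∀ i < j, addr i ≠ addr j)
    (h₂ : ∀ j, j + 1 < t → ∀ i < j, anc i ≠ anc j)
    (h₃ : ∀ i < t, ∀ j, j + 1 < t → addr i ≠ anc j)
    (h₄ : ∀ k < 2 ^ p, ∀ k' < 2 ^ p, ∀ i i', reg k i = reg k' i' → k = k' ∧ i = i')
    (h₅ : ∀ k < 2 ^ p, ∀ i, ∀ j < t, reg k i ≠ addr j)
    (h₆ : ∀ k < 2 ^ p, ∀ i j, j + 1 < t → reg k i ≠ anc j) {x : ℕ} {v : ι → Bool}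
    (hx : x < 2 ^ t) (h_addr : ∀ i < t, v (addr i) = x.testBit i)
    (h_anc : ∀ i, i + 1 < t → v (anc i) = false) :
    (binaryLayout t p addr anc reg hp h₁ h₂ h₃ h₄ h₅ h₆).Reads (x / 2 ^ p) (x % 2 ^ p) v where
  hi i hi := by
    have hi' : i < t - p := hi
    simp only [binaryLayout]
    rw [h_addr _ (by omega), Nat.testBit_div_two_pow, add_comm]
  lo e he := by
    have he' : e < p := (Nat.pow_lt_pow_iff_right (by norm_num)).1 he
    simp only [binaryLayout]
    rw [h_addr _ (by omega), Nat.testBit_mod_two_pow]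
    simp [he']
  anc i hi := by
    have hi' : i + 1 < t - p := hi
    exact h_anc i (by omega)
  hi_lt := by
    refine Nat.div_lt_of_lt_mul ?_
    simp only [binaryLayout]
    rw [← pow_add, Nat.add_sub_cancel' hp]
    exact hx
  lo_lt := Nat.mod_lt _ (Nat.two_pow_pos p)

namespace QCircuit

/-- Measurement of the qubits `f i`, `i < w`, in the `X` basis and reset to `|0⟩`, followed by a
circuit that depends on the outcomes. -/
def eraseAll (f : ℕ → ι) : ℕ → ((ℕ → Bool) → QCircuit ι) → QCircuit ι
  | 0, cont => cont fun _ => false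
  | w + 1, cont => eraseAll f w fun o => eraseX (f w) fun s => cont (update o w s)

theorem toffoliCount_eraseAll {f : ℕ → ι} {w : ℕ} {cont : (ℕ → Bool) → QCircuit ι} {n : ℕ}
    (h : ∀ o, (cont o).toffoliCount ≤ n) : (eraseAll f w cont).toffoliCount ≤ n := by
  induction w generalizing cont with
  | zero => exact h _
  | succ w ih => exact ih fun o => toffoliCount_eraseX fun s => h _

/-- The phase that remains after erasure of a register is linear in the erased bits. -/
theorem acts_eraseAll {f : ℕ → ι} {w : ℕ} (hf : ∀ j < w, ∀ i < j, f i ≠ f j)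
    {cont : (ℕ → Bool) → QCircuit ι} {inp mid out : A → ι → Bool} {φ : A → Bool}
    (hmid : ∀ a, ∀ i < w, mid a (f i) = false)
    (hmid' : ∀ a r, (∀ i < w, r ≠ f i) → mid a r = inp a r)
    (h : ∀ o, (cont o).Acts mid out
      fun a => φ a + ∑ i ∈ Finset.range w, o i * inp a (f i)) :
    (eraseAll f w cont).Acts inp out φ := by
  induction w generalizing cont mid with
  | zero =>
    exact (h _).congr (fun a => funext fun r => (hmid' a r fun i hi => absurd hi (by omega)).symm)
      (fun _ => rfl) fun a => by simp
  | succ w ih =>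
    refine ih (mid := fun a => update (mid a) (f w) (inp a (f w))) (fun j hj => hf j (by omega))
      (fun a i hi => ?_) (fun a r hr => ?_) fun o => ?_
    · rw [update_of_ne (hf w (by omega) i hi), hmid a i (by omega)]
    · by_cases hw : r = f w
      · subst hw; rw [update_self]
      · rw [update_of_ne hw]
        refine hmid' a r fun i hi => ?_
        rcases Nat.lt_succ_iff_lt_or_eq.1 hi with hi | rfl
        · exact hr i hi
        · exact hw
    · refine Acts.eraseX fun s => (h (update o w s)).congr (fun a => ?_) (fun _ => rfl) fun a => ?_
      · rw [update_idem, ← hmid a w (by omega), update_eq_self]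
      · rw [Finset.sum_range_succ, update_self, update_self, add_assoc]
        congr 2
        refine Finset.sum_congr rfl fun i hi => ?_
        rw [update_of_ne (Finset.mem_range.1 hi).ne]

end QCircuit

/-! ### The registers of the oracle -/

namespace Lookup

/-- The names of the registers: row index `j`, column index `k`, data, flat index, ancillas. -/
inductive Reg
  | row
  | col
  | data
  | flat
  | anc

variable {J K b Q N : ℕ}

/-- The number of qubits of a register. -/
def size (J K b Q N : ℕ) : Reg → ℕ
  | .row => Nat.clog 2 J
  | .col => Nat.clog 2 K
  | .data => b
  | .flat => Nat.clog 2 Q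
  | .anc => N

/-- The qubits of a register. -/
def emb : (r : Reg) → Fin (size J K b Q N r) → LookupQubits J K b Q N
  | .row, i => .inl i
  | .col, i => .inr (.inl i)
  | .data, i => .inr (.inr (.inl i))
  | .flat, i => .inr (.inr (.inr (.inl i)))
  | .anc, i => .inr (.inr (.inr (.inr i)))

/-- The register of a qubit and its number there. -/
def decode : LookupQubits J K b Q N → Reg × ℕ :=
  Sum.elim (fun i => (.row, i)) <| Sum.elim (fun i => (.col, i)) <| Sum.elim (fun i => (.data, i)) <|
    Sum.elim (fun i => (.flat, i)) fun i => (.anc, i)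

theorem emb_inj {r r' : Reg} {i : Fin (size J K b Q N r)} {i' : Fin (size J K b Q N r')}
    (h : emb r i = emb r' i') : r = r' ∧ i.1 = i'.1 := by
  have hd (r : Reg) (i : Fin (size J K b Q N r)) : decode (emb r i) = (r, i.1) := by
    cases r <;> rfl
  have h' : (r, i.1) = (r', i'.1) := by rw [← hd, ← hd, h]
  exact ⟨congrArg Prod.fst h', congrArg Prod.snd h'⟩

/-- Qubit number `i` of a register; beyond the size of the register, the arbitrary qubit `e`. -/
def pos (e : LookupQubits J K b Q N) (r : Reg) (i : ℕ) : LookupQubits J K b Q N :=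
  if h : i < size J K b Q N r then emb r ⟨i, h⟩ else e

variable {e : LookupQubits J K b Q N}

theorem pos_inj {r r' : Reg} {i i' : ℕ} (hi : i < size J K b Q N r) (hi' : i' < size J K b Q N r')
    (h : pos e r i = pos e r' i') : r = r' ∧ i = i' := by
  rw [pos, pos, dif_pos hi, dif_pos hi'] at h
  exact emb_inj h

theorem pos_ne {r r' : Reg} {i i' : ℕ} (hi : i < size J K b Q N r) (hi' : i' < size J K b Q N r')
    (h : r ≠ r') : pos e r i ≠ pos e r' i' := fun he => h (pos_inj hi hi' he).1

theorem pos_ne' {r : Reg} {i i' : ℕ} (hi : i < size J K b Q N r) (hi' : i' < size J K b Q N r)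
    (h : i ≠ i') : pos e r i ≠ pos e r i' := fun he => h (pos_inj hi hi' he).2

theorem exists_pos (e u : LookupQubits J K b Q N) : ∃ r, ∃ i < size J K b Q N r, u = pos e r i := by
  have h (r : Reg) (i : Fin (size J K b Q N r)) : emb r i = pos e r i := by
    rw [pos, dif_pos i.2]
  rcases u with i | i | i | i | i
  · exact ⟨.row, i, i.2, h .row i⟩
  · exact ⟨.col, i, i.2, h .col i⟩
  · exact ⟨.data, i, i.2, h .data i⟩
  · exact ⟨.flat, i, i.2, h .flat i⟩
  · exact ⟨.anc, i, i.2, h .anc i⟩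

/-- The basis label with the given contents of the registers. -/
def lab (j k : ℕ) (z : Fin b → Bool) (q : ℕ) (y : ℕ → Bool) : LookupQubits J K b Q N → Bool :=
  Sum.elim (fun i => j.testBit i) <| Sum.elim (fun i => k.testBit i) <| Sum.elim z <|
    Sum.elim (fun i => q.testBit i) fun i => y i

theorem lookupLabel_eq (j k : ℕ) (z : Fin b → Bool) :
    (lookupLabel j k z : LookupQubits J K b Q N → Bool) = lab j k z 0 0 := by
  funext r
  rcases r with i | i | i | i | i
  · rfl
  · rfl
  · rfl
  · exact (Nat.zero_testBit i).symm
  · rfl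

variable {j k q : ℕ} {z : Fin b → Bool} {y : ℕ → Bool} {i : ℕ}

theorem lab_row (hi : i < Nat.clog 2 J) : lab j k z q y (pos e .row i) = j.testBit i := by
  rw [pos, dif_pos (show i < size J K b Q N .row from hi)]; rfl

theorem lab_col (hi : i < Nat.clog 2 K) : lab j k z q y (pos e .col i) = k.testBit i := by
  rw [pos, dif_pos (show i < size J K b Q N .col from hi)]; rfl

theorem lab_data (hi : i < b) : lab j k z q y (pos e .data i) = z ⟨i, hi⟩ := by
  rw [pos, dif_pos (show i < size J K b Q N .data from hi)]; rfl

theorem lab_flat (hi : i < Nat.clog 2 Q) : lab j k z q y (pos e .flat i) = q.testBit i := by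
  rw [pos, dif_pos (show i < size J K b Q N .flat from hi)]; rfl

theorem lab_anc (hi : i < N) : lab j k z q y (pos e .anc i) = y i := by
  rw [pos, dif_pos (show i < size J K b Q N .anc from hi)]; rfl

/-- Two labels agree on a qubit if they agree on the register that contains it. -/
theorem lab_eq_lab {q' : ℕ} {z' : Fin b → Bool} {y' : ℕ → Bool} {u : LookupQubits J K b Q N}
    (e : LookupQubits J K b Q N)
    (hz : z' = z ∨ ∀ i < b, u ≠ pos e .data i)
    (hq : q' = q ∨ ∀ i < Nat.clog 2 Q, u ≠ pos e .flat i)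
    (hy : ∀ i < N, u = pos e .anc i → y' i = y i) :
    lab j k z' q' y' u = lab j k z q y u := by
  obtain ⟨r, i, hi, rfl⟩ := exists_pos e u
  cases r with
  | row => exact (lab_row hi).trans (lab_row hi).symm
  | col => exact (lab_col hi).trans (lab_col hi).symm
  | data =>
    rcases hz with rfl | hz
    · exact (lab_data hi).trans (lab_data hi).symm
    · exact absurd rfl (hz i hi)
  | flat =>
    rcases hq with rfl | hq
    · exact (lab_flat hi).trans (lab_flat hi).symm
    · exact absurd rfl (hq i hi)
  | anc => exact ((lab_anc hi).trans (hy i hi rfl)).trans (lab_anc hi).symm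

end Lookup

namespace Lookup

variable {J K b Q N : ℕ} {e : LookupQubits J K b Q N}

/-! ### Lookup addressed by the row index, with dirty qubits -/

/-- The borrowed qubits of a lookup addressed by the row index: ancilla `0`, the data register, and
the ancillas from number `W` on. -/
def rowPool (e : LookupQubits J K b Q N) (W n : ℕ) : LookupQubits J K b Q N :=
  if n = 0 then pos e .anc 0 else if n ≤ b then pos e .data (n - 1) else pos e .anc (W + (n - 1 - b))

theorem rowPool_cases (e : LookupQubits J K b Q N) {W M n : ℕ} (hN : W + M ≤ N)
    (hn : n < 1 + b + M) :
    (n = 0 ∧ rowPool e W n = pos e .anc 0) ∨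
      (0 < n ∧ n ≤ b ∧ rowPool e W n = pos e .data (n - 1)) ∨
      (b < n ∧ W + (n - 1 - b) < N ∧ rowPool e W n = pos e .anc (W + (n - 1 - b))) := by
  rcases Nat.eq_zero_or_pos n with rfl | h0
  · exact .inl ⟨rfl, if_pos rfl⟩
  · by_cases hb : n ≤ b
    · exact .inr (.inl ⟨h0, hb, by rw [rowPool, if_neg h0.ne', if_pos hb]⟩)
    · exact .inr (.inr ⟨by omega, by omega, by rw [rowPool, if_neg h0.ne', if_neg hb]⟩)

theorem rowPool_inj {W M : ℕ} (hW : 0 < W) (hN : W + M ≤ N) {n n' : ℕ} (hn : n < 1 + b + M)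
    (hn' : n' < 1 + b + M) (h : rowPool e W n = rowPool e W n') : n = n' := by
  have hN0 : 0 < N := by omega
  rcases rowPool_cases e hN hn with ⟨h1, e1⟩ | ⟨h1, h2, e1⟩ | ⟨h1, h2, e1⟩ <;>
    rcases rowPool_cases e hN hn' with ⟨h1', e1'⟩ | ⟨h1', h2', e1'⟩ | ⟨h1', h2', e1'⟩ <;>
    rw [e1, e1'] at h
  · omega
  · exact nomatch (pos_inj (r := .anc) (r' := .data) hN0 (show n' - 1 < b by omega) h).1
  · have := (pos_inj (r := .anc) (r' := .anc) hN0 h2' h).2; omega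
  · exact nomatch (pos_inj (r := .data) (r' := .anc) (show n - 1 < b by omega) hN0 h).1
  · have := (pos_inj (r := .data) (r' := .data) (show n - 1 < b by omega)
      (show n' - 1 < b by omega) h).2
    omega
  · exact nomatch (pos_inj (r := .data) (r' := .anc) (show n - 1 < b by omega) h2' h).1
  · have := (pos_inj (r := .anc) (r' := .anc) h2 hN0 h).2; omega
  · exact nomatch (pos_inj (r := .anc) (r' := .data) h2 (show n' - 1 < b by omega) h).1
  · have := (pos_inj (r := .anc) (r' := .anc) h2 h2' h).2; omega

theorem rowPool_ne {W M : ℕ} (hW : 0 < W) (hN : W + M ≤ N) {n : ℕ} (hn : n < 1 + b + M) {r : Reg}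
    {i : ℕ} (hi : i < size J K b Q N r) (hr : r ≠ .data) (hr' : r = .anc → 0 < i ∧ i < W) :
    rowPool e W n ≠ pos e r i := by
  have hN0 : 0 < N := by omega
  rcases rowPool_cases e hN hn with ⟨h1, e1⟩ | ⟨h1, h2, e1⟩ | ⟨h1, h2, e1⟩ <;> rw [e1] <;> intro h
  · obtain ⟨h3, h4⟩ := pos_inj (r := .anc) hN0 hi h
    have := hr' h3.symm
    omega
  · exact hr (pos_inj (r := .data) (show n - 1 < b by omega) hi h).1.symm
  · obtain ⟨h3, h4⟩ := pos_inj (r := .anc) h2 hi h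
    have := hr' h3.symm
    omega

/-- Layouts addressed by the row index, with target within the flat-index register. -/
theorem exists_rowLayout (e : LookupQubits J K b Q N) {W M : ℕ} (hW : 0 < W)
    (hWJ : Nat.clog 2 J ≤ W) (hN : W + M ≤ N) {b' p : ℕ} {out : Fin b' → ℕ} (hout : Injective out)
    (hout' : ∀ i, out i < Nat.clog 2 Q) (hp : p ≤ Nat.clog 2 J)
    (hpool : (2 ^ p - 1) * b' ≤ 1 + b + M) :
    ∃ lay : LookupLayout (LookupQubits J K b Q N) b', lay.m = 2 ^ p ∧
      (∀ i, lay.reg 0 i = pos e .flat (out i)) ∧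
      ∀ j k z q, j < 2 ^ Nat.clog 2 J → lay.Reads (j / 2 ^ p) (j % 2 ^ p) (lab j k z q 0) := by
  have hflat (i : Fin b') {r : Reg} {i' : ℕ} (hi' : i' < size J K b Q N r) (hr : r ≠ .flat) :
      pos e .flat (out i) ≠ pos e r i' := pos_ne (hout' i) hi' hr.symm
  have hanc (i : ℕ) (hi : i + 1 < Nat.clog 2 J) : 1 + i < size J K b Q N .anc := by
    simp only [size]; omega
  have hreg := regOf_inj (m := 2 ^ p) (out := fun i => pos e .flat (out i)) (pool := rowPool e W)
    (fun i i' h => hout (pos_inj (hout' i) (hout' i') h).2)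
    (fun n hn n' hn' => rowPool_inj hW hN (hn.trans_le hpool) (hn'.trans_le hpool))
    (fun i n hn h => rowPool_ne hW hN (hn.trans_le hpool) (hout' i) (by simp) (by simp) h.symm)
  refine ⟨binaryLayout (Nat.clog 2 J) p (pos e .row) (fun i => pos e .anc (1 + i))
    (regOf (fun i => pos e .flat (out i)) (rowPool e W)) hp ?_ ?_ ?_ hreg ?_ ?_, rfl,
    fun _ => rfl, fun j k z q hj => binaryLayout_reads _ _ _ _ _ _ _ hj
      (fun i hi => lab_row hi) (fun i hi => lab_anc (hanc i hi))⟩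
  · exact fun j hj i hi => pos_ne' (show i < Nat.clog 2 J by omega) hj hi.ne
  · exact fun j hj i hi => pos_ne' (hanc i (by omega)) (hanc j hj) (by omega)
  · exact fun i hi j hj => pos_ne hi (hanc j hj) (by simp)
  · exact fun k hk i j hj => regOf_ne (fun i => hflat i hj (by simp))
      (fun n hn => rowPool_ne hW hN (hn.trans_le hpool) hj (by simp) (by simp)) hk i
  · exact fun k hk i j hj => regOf_ne (fun i => hflat i (hanc j hj) (by simp))
      (fun n hn => rowPool_ne hW hN (hn.trans_le hpool) (hanc j hj) (by simp)
        (fun _ => ⟨by omega, by omega⟩)) hk i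

/-- The number of inner nodes of the unary iteration over blocks of `2 ^ min p t` words. -/
theorem blocks_le {d t p μ : ℕ} (hd : d ≤ 2 ^ t) (hμ : 1 + μ = 2 ^ p) :
    (((d - 1) / 2 ^ min p t : ℕ) : ℝ) ≤ d / (1 + μ) := by
  rcases le_total p t with h | h
  · rw [min_eq_left h, ← hμ]
    refine Nat.cast_div_le.trans ?_
    push_cast
    gcongr
    exact Nat.sub_le _ _
  · rw [min_eq_right h, Nat.div_eq_of_lt (by have := Nat.two_pow_pos t; omega), Nat.cast_zero]
    positivity

theorem div_two_pow_lt {j d p : ℕ} (h : j < d) : j / 2 ^ p < (d - 1) / 2 ^ p + 1 :=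
  Nat.lt_succ_of_le (Nat.div_le_div_right (by omega))

theorem mem_dirtyChoices {w n μ : ℕ} (h : μ ∈ dirtyChoices w n) : μ * w ≤ n ∧ IsPowTwo (1 + μ) := by
  classical
  obtain ⟨h1, h2⟩ := Finset.mem_filter.1 h
  exact ⟨(Nat.mul_le_mul_right w (Finset.mem_Icc.1 h1).2).trans (Nat.div_mul_le_self n w), h2⟩

theorem target_eq {b' : ℕ} {lay : LookupLayout ι b'} {out : Fin b' → ι}
    (h : ∀ i, lay.reg 0 i = out i) : lay.reg 0 = out := funext h

/-- Lookup of the numbers `s j` into the flat-index register. Every choice of `μ` in the cost function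
is realised by the borrowed qubits. -/
theorem exists_row_xor (e : LookupQubits J K b Q N) {lam n : ℕ} (hQ : 0 < Nat.clog 2 Q)
    (hJ : 0 < J) (hN : max (Nat.clog 2 Q) (Nat.clog 2 J) + lam * b ≤ N) (hn : n = 1 + b * (1 + lam))
    (s : ℕ → ℕ) :
    ∃ c : QCircuit (LookupQubits J K b Q N),
      (c.toffoliCount : ℝ) ≤ dirtyCost J (Nat.clog 2 Q) n ∧
      ∀ {A : Type} (j k : A → ℕ) (z : A → Fin b → Bool), (∀ a, j a < J) →
        c.Acts (fun a => lab (j a) (k a) (z a) 0 0) (fun a => lab (j a) (k a) (z a) (s (j a)) 0)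
          0 := by
  have hJt : J ≤ 2 ^ Nat.clog 2 J := Nat.le_pow_clog one_lt_two J
  have hn' : n = 1 + b + lam * b := by rw [hn]; ring
  set w := Nat.clog 2 Q with hw
  have layout (p : ℕ) (hp : p ≤ Nat.clog 2 J) (hpool : (2 ^ p - 1) * w ≤ n) :=
    exists_rowLayout (K := K) (Q := Q) e (W := max w (Nat.clog 2 J)) (M := lam * b) (p := p)
      (b' := w) (out := fun i => i.1)
      (by omega) (le_max_right _ _) hN Fin.val_injective (fun i => i.2) hp (by omega)
  -- The word for row `j`, at address `(h, l)`.
  let X (p : ℕ) : ℕ → ℕ → Fin w → Bool := fun h l i => (s (h * 2 ^ p + l)).testBit i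
  have hX (p j : ℕ) (i : Fin w) : X p (j / 2 ^ p) (j % 2 ^ p) i = (s j).testBit i := by
    simp only [X, mul_comm, Nat.div_add_mod]
  have hlab {A : Type} (j k : A → ℕ) (z : A → Fin b → Bool) (a : A)
      (r : LookupQubits J K b Q N) (hr : r ∉ Set.range fun i : Fin w => pos e .flat i) :
      (lab (j a) (k a) (z a) (s (j a)) 0 : LookupQubits J K b Q N → Bool) r =
        lab (j a) (k a) (z a) 0 0 r :=
    lab_eq_lab e (.inl rfl) (.inr fun i hi h => hr ⟨⟨i, hi⟩, h.symm⟩) fun _ _ _ => rfl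
  rcases (Finset.fold_min_le _).1 (le_refl (dirtyCost J w n)) with h | ⟨μ, hμ, h⟩
  · obtain ⟨lay, hm, hreg, hreads⟩ := layout 0 (Nat.zero_le _) (by simp)
    have hreg' := target_eq hreg
    refine ⟨QCircuit.conjHs (lay.phaseClean J (X 0)) lay.target, le_trans ?_ h,
      fun j k z hj => ?_⟩
    · have := LookupLayout.toffoliCount_phaseClean (lay := lay) (X := X 0) hJ
      simp only [hm, pow_zero, Nat.sub_self, zero_mul] at this
      rw [QCircuit.toffoliCount_conjHs]
      exact_mod_cast (by omega : _ ≤ J)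
    · refine LookupLayout.acts_xorClean (h := fun a => j a / 2 ^ 0) (l := fun a => j a % 2 ^ 0)
        (fun a => hreads _ _ _ _ ((hj a).trans_le hJt)) (fun a => by simpa using hj a)
        (fun a k i hk hkm => ?_) (fun a i => ?_) ?_
      · rw [hm, pow_zero] at hkm; omega
      · rw [hX, hreg, lab_flat i.2, lab_flat i.2, Nat.zero_testBit]
        exact (zero_add ((s (j a)).testBit i)).symm
      · rw [hreg']; exact hlab j k z
  · obtain ⟨hμw, p, hp⟩ := mem_dirtyChoices hμ
    have hm_le : 2 ^ min p (Nat.clog 2 J) - 1 ≤ μ := by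
      have := Nat.pow_le_pow_right (n := 2) (by norm_num) (min_le_left p (Nat.clog 2 J))
      omega
    obtain ⟨lay, hm, hreg, hreads⟩ := layout (min p (Nat.clog 2 J)) (min_le_right _ _)
      ((Nat.mul_le_mul_right w hm_le).trans hμw)
    have hreg' := target_eq hreg
    set p' := min p (Nat.clog 2 J) with hp'
    set L := (J - 1) / 2 ^ p' + 1 with hL
    refine ⟨lay.phaseDirty L (X p') ++ QCircuit.conjHs (lay.phaseDirty L (X p')) lay.target,
      le_trans ?_ h, fun j k z hj => ?_⟩
    · have h1 := LookupLayout.toffoliCount_phaseDirty (lay := lay) (L := L) (X := X p')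
        (Nat.succ_pos _)
      have h2 := blocks_le hJt hp
      rw [hm] at h1
      rw [QCircuit.toffoliCount_append, QCircuit.toffoliCount_conjHs]
      have h3 : (2 ^ p' - 1) * w ≤ μ * w := Nat.mul_le_mul_right w hm_le
      have h4 : (lay.phaseDirty L (X p')).toffoliCount ≤ (J - 1) / 2 ^ p' + 2 * (μ * w) := by omega
      have h5 : ((lay.phaseDirty L (X p')).toffoliCount : ℝ) ≤
          (((J - 1) / 2 ^ p' : ℕ) : ℝ) + 2 * (μ * w) := by exact_mod_cast h4
      push_cast
      rw [mul_div_assoc]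
      linarith
    · refine LookupLayout.acts_xorDirty (h := fun a => j a / 2 ^ p') (l := fun a => j a % 2 ^ p')
        (fun a => hreads _ _ _ _ ((hj a).trans_le hJt)) (fun a => div_two_pow_lt (hj a))
        (fun a i => ?_) (fun a i => ?_) ?_
      · rw [hreg, lab_flat i.2, Nat.zero_testBit]
      · rw [hX, hreg, lab_flat i.2]
      · rw [hreg']; exact hlab j k z

/-- The phase given by a bit that depends on the row index. A single qubit of the flat-index register
serves as target. -/
theorem exists_row_sign (e : LookupQubits J K b Q N) {lam n : ℕ} (hQ : 0 < Nat.clog 2 Q)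
    (hJ : 0 < J) (hN : max (Nat.clog 2 Q) (Nat.clog 2 J) + lam * b ≤ N) (hn : n = 1 + b * (1 + lam))
    (F : ℕ → Bool) :
    ∃ c : QCircuit (LookupQubits J K b Q N),
      (c.toffoliCount : ℝ) ≤ dirtyUncost J (Nat.clog 2 Q) n ∧
      ∀ {A : Type} (j k : A → ℕ) (z : A → Fin b → Bool), (∀ a, j a < J) →
        c.Acts (fun a => lab (j a) (k a) (z a) 0 0) (fun a => lab (j a) (k a) (z a) 0 0)
          fun a => F (j a) := by
  have hJt : J ≤ 2 ^ Nat.clog 2 J := Nat.le_pow_clog one_lt_two J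
  have hn' : n = 1 + b + lam * b := by rw [hn]; ring
  set w := Nat.clog 2 Q with hw
  have layout (p : ℕ) (hp : p ≤ Nat.clog 2 J) (hpool : 2 ^ p - 1 ≤ n) :=
    exists_rowLayout (K := K) (Q := Q) e (W := max w (Nat.clog 2 J)) (M := lam * b) (p := p)
      (b' := 1) (out := fun _ => 0)
      (by omega) (le_max_right _ _) hN (injective_of_subsingleton _) (fun i => hQ) hp (by omega)
  let X (p : ℕ) : ℕ → ℕ → Fin 1 → Bool := fun h l _ => F (h * 2 ^ p + l)
  have hX (p j : ℕ) : X p (j / 2 ^ p) (j % 2 ^ p) 0 = F j := by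
    simp only [X, mul_comm, Nat.div_add_mod]
  rcases (Finset.fold_min_le _).1 (le_refl (dirtyUncost J w n)) with h | ⟨μ, hμ, h⟩
  · obtain ⟨lay, hm, hreg, hreads⟩ := layout 0 (Nat.zero_le _) (by simp)
    refine ⟨QCircuit.x (lay.reg 0 0) ++ lay.phaseClean J (X 0) ++ QCircuit.x (lay.reg 0 0),
      le_trans ?_ h, fun j k z hj => ?_⟩
    · have := LookupLayout.toffoliCount_phaseClean (lay := lay) (X := X 0) hJ
      simp only [hm, pow_zero, Nat.sub_self, zero_mul] at this
      simp only [QCircuit.toffoliCount_append, QCircuit.toffoliCount_x]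
      exact_mod_cast (by omega : _ ≤ J)
    · refine (LookupLayout.acts_signClean (h := fun a => j a / 2 ^ 0) (l := fun a => j a % 2 ^ 0)
        (fun a => hreads _ _ _ _ ((hj a).trans_le hJt)) (fun a => by simpa using hj a)
        (fun a k hkm i => ?_)).congr (fun _ => rfl) (fun _ => rfl) fun a => (hX 0 (j a)).symm
      obtain rfl : k = 0 := by rw [hm, pow_zero] at hkm; omega
      rw [hreg, lab_flat hQ, Nat.zero_testBit]
  · obtain ⟨hμw, p, hp⟩ := mem_dirtyChoices hμ
    have hm_le : 2 ^ min p (Nat.clog 2 J) - 1 ≤ μ := by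
      have := Nat.pow_le_pow_right (n := 2) (by norm_num) (min_le_left p (Nat.clog 2 J))
      omega
    have hμn : μ ≤ n := (Nat.le_mul_of_pos_right μ hQ).trans hμw
    obtain ⟨lay, hm, hreg, hreads⟩ := layout (min p (Nat.clog 2 J)) (min_le_right _ _)
      (hm_le.trans hμn)
    set p' := min p (Nat.clog 2 J) with hp'
    set L := (J - 1) / 2 ^ p' + 1 with hL
    refine ⟨lay.phaseDirty L (X p') ++ QCircuit.x (lay.reg 0 0) ++ lay.phaseDirty L (X p') ++
      QCircuit.x (lay.reg 0 0), le_trans ?_ h, fun j k z hj => ?_⟩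
    · have h1 := LookupLayout.toffoliCount_phaseDirty (lay := lay) (L := L) (X := X p')
        (Nat.succ_pos _)
      have h2 := blocks_le hJt hp
      rw [hm] at h1
      simp only [QCircuit.toffoliCount_append, QCircuit.toffoliCount_x]
      have h4 : (lay.phaseDirty L (X p')).toffoliCount ≤ (J - 1) / 2 ^ p' + 2 * μ := by omega
      have h5 : ((lay.phaseDirty L (X p')).toffoliCount : ℝ) ≤
          (((J - 1) / 2 ^ p' : ℕ) : ℝ) + 2 * μ := by exact_mod_cast h4
      push_cast
      rw [mul_div_assoc]
      linarith
    · refine (LookupLayout.acts_signDirty (h := fun a => j a / 2 ^ p')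
        (l := fun a => j a % 2 ^ p') (fun a => hreads _ _ _ _ ((hj a).trans_le hJt))
        (fun a => div_two_pow_lt (hj a)) (fun a => ?_)).congr (fun _ => rfl) (fun _ => rfl)
        fun a => (hX p' (j a)).symm
      rw [hreg, lab_flat hQ, Nat.zero_testBit]

end Lookup

namespace Lookup

variable {J K b Q N : ℕ} {e : LookupQubits J K b Q N}

/-! ### Lookup addressed by the flat index, with clean qubits -/

/-- A way to look up words by the flat index, with target `out` in the data register: the circuit
`pre` brings the flat index into the form of an address `(fh q, fl q)`, and `post` undoes this. -/
structure FlatAddress (e : LookupQubits J K b Q N) {b' : ℕ} (out : Fin b' → ℕ) where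
  lay : LookupLayout (LookupQubits J K b Q N) b'
  pre : QCircuit (LookupQubits J K b Q N)
  post : QCircuit (LookupQubits J K b Q N)
  L : ℕ
  fh : ℕ → ℕ
  fl : ℕ → ℕ
  /-- The contents of the flat-index register and of the ancillas when the address is in place. -/
  fq : ℕ → ℕ
  fy : ℕ → ℕ → Bool
  /-- The flat index with a given address. -/
  index : ℕ → ℕ → ℕ
  target : ∀ i, lay.reg 0 i = pos e .data (out i)
  L_pos : 0 < L
  index_eq : ∀ q < Q, index (fh q) (fl q) = q
  fh_lt : ∀ q < Q, fh q < L
  reads : ∀ q < Q, ∀ j k z, lay.Reads (fh q) (fl q) (lab j k z (fq q) (fy q))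
  clean : ∀ q < Q, ∀ j k z n i, 0 < n → n < lay.m → lab j k z (fq q) (fy q) (lay.reg n i) = false
  acts_pre : ∀ {A : Type} (j k q : A → ℕ) (z : A → Fin b → Bool), (∀ a, q a < Q) →
    pre.Acts (fun a => lab (j a) (k a) (z a) (q a) 0)
      (fun a => lab (j a) (k a) (z a) (fq (q a)) (fy (q a))) 0
  acts_post : ∀ {A : Type} (j k q : A → ℕ) (z : A → Fin b → Bool), (∀ a, q a < Q) →
    post.Acts (fun a => lab (j a) (k a) (z a) (fq (q a)) (fy (q a)))
      (fun a => lab (j a) (k a) (z a) (q a) 0) 0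

/-- Upper bound for the Toffoli count of the lookups with the given address. -/
def FlatAddress.cost {b' : ℕ} {out : Fin b' → ℕ} (f : FlatAddress e out) : ℕ :=
  f.pre.toffoliCount + f.post.toffoliCount + (f.L - 1 + (f.lay.m - 1) * b')

/-- The registers other than the target lie in the ancillas from number `W` on. -/
theorem flatReg_inj {b' m W : ℕ} {out : Fin b' → ℕ} (hout : Injective out) (hout' : ∀ i, out i < b)
    (hpool : W + (m - 1) * b' ≤ N) : ∀ k < m, ∀ k' < m, ∀ i i',
      regOf (fun i => pos e .data (out i)) (fun n => pos e .anc (W + n)) k i =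
        regOf (fun i => pos e .data (out i)) (fun n => pos e .anc (W + n)) k' i' →
      k = k' ∧ i = i' :=
  regOf_inj (fun i i' h => hout (pos_inj (hout' i) (hout' i') h).2)
    (fun n hn n' hn' h => by
      have := (pos_inj (r := .anc) (r' := .anc) (show W + n < N by omega)
        (show W + n' < N by omega) h).2
      omega)
    fun i n hn => pos_ne (hout' i) (show W + n < size J K b Q N .anc by simp only [size]; omega)
      (by simp)

theorem flatReg_ne {b' m W : ℕ} {out : Fin b' → ℕ} (hout' : ∀ i, out i < b)
    (hpool : W + (m - 1) * b' ≤ N) {r : Reg} {i' : ℕ} (hi' : i' < size J K b Q N r) (hr : r ≠ .data)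
    (hr' : r = .anc → i' < W ∨ W + (m - 1) * b' ≤ i') {k : ℕ} (hk : k < m) (i : Fin b') :
    regOf (fun i => pos e .data (out i)) (fun n => pos e .anc (W + n)) k i ≠ pos e r i' :=
  regOf_ne (fun i => pos_ne (hout' i) hi' hr.symm)
    (fun n hn h => by
      obtain ⟨h1, h2⟩ := pos_inj (r := .anc) (show W + n < N by omega) hi' h
      have := hr' h1.symm
      omega) hk i

theorem flatReg_anc {b' W k : ℕ} {out : Fin b' → ℕ} (hk : 0 < k) (i : Fin b') :
    regOf (fun i => pos e .data (out i)) (fun n => pos e .anc (W + n)) k i =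
      pos e .anc (W + ((k - 1) * b' + i)) := by
  obtain ⟨k, rfl⟩ : ∃ n, k = n + 1 := ⟨k - 1, by omega⟩
  rfl

/-- If the number of registers is a power of two, the binary digits of the flat index serve as
address. -/
theorem exists_flatAddress_two_pow (e : LookupQubits J K b Q N) {W M μ p b' : ℕ}
    {out : Fin b' → ℕ} (hout : Injective out) (hout' : ∀ i, out i < b) (hW : Nat.clog 2 Q ≤ W)
    (hN : W + M ≤ N) (hM : μ * b' ≤ M) (hμ : 1 + μ = 2 ^ p) :
    ∃ f : FlatAddress e out, (f.cost : ℝ) ≤ Q / (1 + μ) + μ * b' := by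
  have hQ : Q ≤ 2 ^ Nat.clog 2 Q := Nat.le_pow_clog one_lt_two Q
  set w := Nat.clog 2 Q with hw
  have hm_le : 2 ^ min p w - 1 ≤ μ := by
    have := Nat.pow_le_pow_right (n := 2) (by norm_num) (min_le_left p w)
    omega
  have hle : (2 ^ min p w - 1) * b' ≤ μ * b' := Nat.mul_le_mul_right b' hm_le
  have hblocks := blocks_le hQ hμ
  set p' := min p w with hp'
  have hp'w : p' ≤ w := min_le_right _ _
  have hpool : W + (2 ^ p' - 1) * b' ≤ N := by omega
  have hanc (i : ℕ) (hi : i + 1 < w) : i < size J K b Q N .anc := by simp only [size]; omega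
  let lay : LookupLayout (LookupQubits J K b Q N) b' := binaryLayout w p' (pos e .flat) (pos e .anc)
    (regOf (fun i => pos e .data (out i)) (fun n => pos e .anc (W + n))) hp'w
    (fun j hj i hi => pos_ne' (show i < Nat.clog 2 Q by omega) hj hi.ne)
    (fun j hj i hi => pos_ne' (hanc i (by omega)) (hanc j hj) hi.ne)
    (fun i hi j hj => pos_ne hi (hanc j hj) (by simp))
    (flatReg_inj hout hout' hpool)
    (fun k hk i j hj => flatReg_ne hout' hpool hj (by simp) (by simp) hk i)
    (fun k hk i j hj => flatReg_ne hout' hpool (hanc j hj) (by simp) (fun _ => .inl (by omega)) hk i)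
  refine ⟨{
    lay := lay
    pre := .done
    post := .done
    L := (Q - 1) / 2 ^ p' + 1
    fh := fun q => q / 2 ^ p'
    fl := fun q => q % 2 ^ p'
    fq := id
    fy := fun _ => 0
    index := fun h l => h * 2 ^ p' + l
    target := fun _ => rfl
    L_pos := Nat.succ_pos _
    index_eq := fun q _ => by rw [mul_comm]; exact Nat.div_add_mod q _
    fh_lt := fun q hq => div_two_pow_lt hq
    reads := fun q hq j k z => binaryLayout_reads _ _ _ _ _ _ _ (hq.trans_le hQ)
      (fun i hi => lab_flat hi) (fun i hi => lab_anc (hanc i hi))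
    clean := fun q hq j k z n i hn hnm => ?_
    acts_pre := fun j k q z _ => QCircuit.acts_done
    acts_post := fun j k q z _ => QCircuit.acts_done }, ?_⟩
  · have h := pool_index_lt (m := 2 ^ p') (b := b') (k := n - 1)
      (by have : n < 2 ^ p' := hnm; omega) i
    exact (congrArg _ (flatReg_anc hn i)).trans (lab_anc (by omega))
  · have h1 : (2 ^ p' - 1) * b' ≤ μ * b' := hle
    have h2 : (((Q - 1) / 2 ^ p' + (2 ^ p' - 1) * b' : ℕ) : ℝ) ≤
        (((Q - 1) / 2 ^ p' : ℕ) : ℝ) + μ * b' := by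
      exact_mod_cast Nat.add_le_add_left h1 _
    simp only [FlatAddress.cost, QCircuit.toffoliCount, zero_add, Nat.add_sub_cancel]
    exact h2.trans (by linarith)

/-- In general, quotient and remainder of the flat index modulo the number of registers serve as
address. -/
theorem exists_flatAddress_div (e : LookupQubits J K b Q N) {W M μ b' : ℕ}
    {out : Fin b' → ℕ} (hout : Injective out) (hout' : ∀ i, out i < b) (hW : Nat.clog 2 Q ≤ W)
    (hN : W + M + 8 * (1 + μ) ≤ N) (hM : μ * b' ≤ M) :
    ∃ f : FlatAddress e out,
      (f.cost : ℝ) ≤ Q / (1 + μ) + μ * b' + (8 * (1 + μ) : ℕ) * (Nat.clog 2 Q : ℕ) := by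
  have hQ : Q ≤ 2 ^ Nat.clog 2 Q := Nat.le_pow_clog one_lt_two Q
  set w := Nat.clog 2 Q with hw
  set m := 1 + μ with hm
  set s := Nat.clog 2 m with hs
  set E := W + M with hE
  have hms : m ≤ 2 ^ s := Nat.le_pow_clog one_lt_two m
  have hsm : s ≤ m := Nat.clog_le_of_le_pow Nat.lt_two_pow_self.le
  have hm0 : 0 < m := by omega
  have hμm : m - 1 = μ := by omega
  have hpool : W + (m - 1) * b' ≤ N := by rw [hμm]; omega
  have hanc (i : ℕ) (hi : i < 8 * m) : E + i < size J K b Q N .anc := by simp only [size]; omega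
  have hanc' (i : ℕ) (hi : i + 1 < w) : i < size J K b Q N .anc := by simp only [size]; omega
  have hflat (i : ℕ) (hi : i < w) : i < size J K b Q N .flat := hi
  have hlt (t : ℕ) (ht : 2 ^ t < m) : t < s :=
    (Nat.pow_lt_pow_iff_right (by norm_num)).1 (ht.trans_le hms)
  have dl : QCircuit.DivLayout w s (pos e .flat) (fun i => pos e .anc (E + i))
      (fun i => pos e .anc (E + (s + i))) (fun i => pos e .anc (E + (2 * s + 1 + i))) :=
    { q_inj := fun j hj i hi => pos_ne' (hflat i (by omega)) (hflat j hj) hi.ne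
      q_ne_rem := fun i hi j hj => pos_ne (hflat i hi) (hanc _ (by omega)) (by simp)
      q_ne_tmp := fun i hi j hj => pos_ne (hflat i hi) (hanc _ (by omega)) (by simp)
      q_ne_anc := fun i hi j hj => pos_ne (hflat i hi) (hanc _ (by omega)) (by simp)
      rem_inj := fun j hj i hi => pos_ne' (hanc _ (by omega)) (hanc _ (by omega)) (by omega)
      tmp_inj := fun j hj i hi => pos_ne' (hanc _ (by omega)) (hanc _ (by omega)) (by omega)
      anc_inj := fun j hj i hi => pos_ne' (hanc _ (by omega)) (hanc _ (by omega)) (by omega)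
      rem_ne_tmp := fun i hi j hj => pos_ne' (hanc _ (by omega)) (hanc _ (by omega)) (by omega)
      rem_ne_anc := fun i hi j hj => pos_ne' (hanc _ (by omega)) (hanc _ (by omega)) (by omega)
      tmp_ne_anc := fun i hi j hj => pos_ne' (hanc _ (by omega)) (hanc _ (by omega)) (by omega) }
  let lay : LookupLayout (LookupQubits J K b Q N) b' :=
    { depth := w
      m := m
      hi := pos e .flat
      anc := pos e .anc
      lo := fun i => pos e .anc (E + i)
      reg := regOf (fun i => pos e .data (out i)) (fun n => pos e .anc (W + n))
      m_pos := hm0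
      hi_inj := fun j hj i hi => pos_ne' (hflat i (by omega)) (hflat j hj) hi.ne
      hi_ne_anc := fun i hi j hj => pos_ne (hflat i hi) (hanc' j hj) (by simp)
      anc_inj := fun j hj i hi => pos_ne' (hanc' i (by omega)) (hanc' j hj) hi.ne
      reg_inj := flatReg_inj hout hout' hpool
      reg_ne_hi := fun k hk i j hj => flatReg_ne hout' hpool (hflat j hj) (by simp) (by simp) hk i
      reg_ne_anc := fun k hk i j hj => flatReg_ne hout' hpool (hanc' j hj) (by simp)
        (fun _ => .inl (by omega)) hk i
      reg_ne_lo := fun k hk i t ht => flatReg_ne hout' hpool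
        (hanc t (by have := hlt t ht; omega)) (by simp)
        (fun _ => .inr (by rw [hμm]; omega)) hk i }
  -- The ancillas hold the remainder from number `E` on.
  let fy : ℕ → ℕ → Bool := fun q i => decide (E ≤ i ∧ i < E + s) && (q % m).testBit (i - E)
  have fy_rem (q i : ℕ) (hi : i < s) : fy q (E + i) = (q % m).testBit i := by simp [fy, hi]
  have fy_else (q i : ℕ) (hi : i < E ∨ E + s ≤ i) : fy q i = false := by
    simp only [fy]
    rw [decide_eq_false (by omega), Bool.false_and]
  have hdiv {A : Type} (j k q : A → ℕ) (z : A → Fin b → Bool) (hq : ∀ a, q a < Q) :=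
    QCircuit.acts_divider hms dl (inp := fun a => lab (j a) (k a) (z a) (q a) 0)
      (out := fun a => lab (j a) (k a) (z a) (q a / m) (fy (q a))) (n := q) (r := fun _ => 0)
      (fun _ => hm0) (fun a i hi => lab_flat hi)
      (fun a i hi => (lab_anc (hanc i (by omega))).trans (Nat.zero_testBit i).symm)
      (fun a i hi => lab_anc (hanc _ (by omega))) (fun a i hi => lab_anc (hanc _ (by omega)))
      (fun a i hi => by
        rw [lab_flat hi, zero_mul, zero_add, Nat.mod_eq_of_lt ((hq a).trans_le hQ)])
      (fun a i hi => (lab_anc (hanc i (by omega))).trans (by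
        rw [fy_rem _ _ hi, zero_mul, zero_add, Nat.mod_eq_of_lt ((hq a).trans_le hQ)]))
      fun a t ht ht' => lab_eq_lab e (.inl rfl) (.inr ht) fun i hi h =>
        fy_else _ _ (by
          by_contra hc
          exact ht' (i - E) (by omega) (by rw [h]; congr 1; omega))
  refine ⟨{
    lay := lay
    pre := QCircuit.divider m s _ _ _ _ w dl
    post := QCircuit.undivider m s _ _ _ _ w dl
    L := (Q - 1) / m + 1
    fh := fun q => q / m
    fl := fun q => q % m
    fq := fun q => q / m
    fy := fy
    index := fun h l => h * m + l
    target := fun _ => rfl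
    L_pos := Nat.succ_pos _
    index_eq := fun q _ => by rw [mul_comm]; exact Nat.div_add_mod q _
    fh_lt := fun q hq => Nat.lt_succ_of_le (Nat.div_le_div_right (by omega))
    reads := fun q hq j k z => ?_
    clean := fun q hq j k z n i hn hnm => ?_
    acts_pre := fun j k q z hq => (hdiv j k q z hq).1
    acts_post := fun j k q z hq => (hdiv j k q z hq).2 }, ?_⟩
  · exact ⟨fun i hi => lab_flat hi,
      fun t ht => (lab_anc (hanc t (by have := hlt t ht; omega))).trans (fy_rem _ _ (hlt t ht)),
      fun i hi => (lab_anc (hanc' i hi)).trans (fy_else _ _ (.inl (by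
        have : i + 1 < w := hi
        omega))),
      (Nat.div_le_self q m).trans_lt (hq.trans_le hQ), Nat.mod_lt _ hm0⟩
  · have h := pool_index_lt (m := m) (b := b') (k := n - 1)
      (by have : n < m := hnm; omega) i
    rw [hμm] at h
    exact (congrArg _ (flatReg_anc hn i)).trans ((lab_anc (by omega)).trans
      (fy_else _ _ (.inl (by omega))))
  · have h1 := QCircuit.toffoliCount_divider hm0 dl
    have h2 := QCircuit.toffoliCount_undivider hm0 dl
    have h3 : (((Q - 1) / m : ℕ) : ℝ) ≤ Q / (1 + μ) := by
      refine Nat.cast_div_le.trans ?_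
      rw [hm]
      push_cast
      gcongr
      exact Nat.sub_le _ _
    simp only [FlatAddress.cost, Nat.add_sub_cancel]
    have h4 : (lay.m - 1) * b' = μ * b' := congrArg (· * b') hμm
    have h5 : 4 * m * w + 4 * m * w = 8 * m * w := by ring
    calc (_ : ℝ) ≤ ((8 * m * w + ((Q - 1) / m + μ * b') : ℕ) : ℝ) := by
          rw [h4]; exact_mod_cast by omega
      _ = (((Q - 1) / m : ℕ) : ℝ) + μ * b' + (8 * m : ℕ) * (w : ℕ) := by push_cast; ring
      _ ≤ _ := by linarith

/-- Computation of a word from the flat index. -/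
theorem FlatAddress.exists_xor {out : Fin b → ℕ} (f : FlatAddress e out) (hout : ∀ i, out i = i)
    (F : ℕ → Fin b → Bool) :
    ∃ c : QCircuit (LookupQubits J K b Q N), c.toffoliCount ≤ f.cost ∧
      ∀ {A : Type} (j k q : A → ℕ) (z : A → Fin b → Bool), (∀ a, q a < Q) →
        c.Acts (fun a => lab (j a) (k a) (z a) (q a) 0)
          (fun a => lab (j a) (k a) (z a + F (q a)) (q a) 0) 0 := by
  have hreg := target_eq f.target
  set X : ℕ → ℕ → Fin b → Bool := fun h l => F (f.index h l) with hX
  refine ⟨f.pre ++ (QCircuit.conjHs (f.lay.phaseClean f.L X) f.lay.target ++ f.post), ?_,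
    fun j k q z hq => (f.acts_pre j k q z hq).append₀ (QCircuit.Acts.append₀ ?_
      (f.acts_post j k q _ hq))⟩
  · have := LookupLayout.toffoliCount_phaseClean (lay := f.lay) (X := X) f.L_pos
    simp only [QCircuit.toffoliCount_append, QCircuit.toffoliCount_conjHs, FlatAddress.cost]
    have := f.L_pos
    omega
  · refine LookupLayout.acts_xorClean (h := fun a => f.fh (q a)) (l := fun a => f.fl (q a))
      (fun a => f.reads _ (hq a) _ _ _) (fun a => f.fh_lt _ (hq a))
      (fun a n i hn hnm => f.clean _ (hq a) _ _ _ n i hn hnm) (fun a i => ?_) fun a r hr => ?_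
    · have hi : out i < b := by rw [hout]; exact i.2
      have hfin : (⟨out i, hi⟩ : Fin b) = i := Fin.ext (hout i)
      rw [f.target, lab_data hi, lab_data hi, hfin, hX]
      dsimp only
      rw [f.index_eq _ (hq a)]
      rfl
    · refine lab_eq_lab e (.inr fun i hi h => hr ⟨⟨i, hi⟩, ?_⟩) (.inl rfl) fun _ _ _ => rfl
      rw [h, f.target, hout]

/-- The phase given by a bit that depends on the flat index. -/
theorem FlatAddress.exists_sign {out : Fin 1 → ℕ} (f : FlatAddress e out) (hout : out 0 < b)
    (F : ℕ → Bool) :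
    ∃ c : QCircuit (LookupQubits J K b Q N), c.toffoliCount ≤ f.cost ∧
      ∀ {A : Type} (j k q : A → ℕ), (∀ a, q a < Q) →
        c.Acts (fun a => lab (j a) (k a) 0 (q a) 0) (fun a => lab (j a) (k a) 0 (q a) 0)
          fun a => F (q a) := by
  set X : ℕ → ℕ → Fin 1 → Bool := fun h l _ => F (f.index h l) with hX
  refine ⟨f.pre ++ (QCircuit.x (f.lay.reg 0 0) ++ f.lay.phaseClean f.L X ++
    QCircuit.x (f.lay.reg 0 0) ++ f.post), ?_, fun j k q hq =>
      ((f.acts_pre j k q (fun _ => 0) hq).append ((LookupLayout.acts_signClean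
        (h := fun a => f.fh (q a)) (l := fun a => f.fl (q a))
        (fun a => f.reads _ (hq a) _ _ _) (fun a => f.fh_lt _ (hq a)) (fun a n hnm i => ?_)).append
        (f.acts_post j k q (fun _ => 0) hq))).congr (fun _ => rfl) (fun _ => rfl) fun a => ?_⟩
  · have := LookupLayout.toffoliCount_phaseClean (lay := f.lay) (X := X) f.L_pos
    simp only [QCircuit.toffoliCount_append, QCircuit.toffoliCount_x, FlatAddress.cost]
    have := f.L_pos
    omega
  · rcases Nat.eq_zero_or_pos n with rfl | hn
    · obtain rfl : i = 0 := Subsingleton.elim _ _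
      rw [f.target, lab_data hout]
      rfl
    · exact f.clean _ (hq a) _ _ _ n i hn hnm
  · simp only [Pi.zero_apply, zero_add, add_zero, hX, f.index_eq _ (hq a)]

end Lookup

namespace Lookup

variable {J K b Q N : ℕ} {e : LookupQubits J K b Q N}

/-! ### The flat index -/

/-- The qubits that hold the bits of the column index. -/
def colBit (e : LookupQubits J K b Q N) (i : ℕ) : Option (LookupQubits J K b Q N) :=
  if i < Nat.clog 2 K then some (pos e .col i) else none

theorem colBit_eq_some {i : ℕ} {r : LookupQubits J K b Q N} (h : colBit e i = some r) :
    i < Nat.clog 2 K ∧ r = pos e .col i := by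
  by_cases hi : i < Nat.clog 2 K
  · rw [colBit, if_pos hi, Option.some_inj] at h
    exact ⟨hi, h.symm⟩
  · rw [colBit, if_neg hi] at h
    exact nomatch h

theorem adderLayout (e : LookupQubits J K b Q N) (hN : Nat.clog 2 Q ≤ N) :
    QCircuit.AdderLayout (Nat.clog 2 Q) (pos e .flat) (colBit e) (pos e .anc) where
  q_inj j hj i hi := pos_ne' (show i < Nat.clog 2 Q by omega) hj hi.ne
  c_inj j hj i hi := pos_ne' (show i < N by omega) (show j < N by omega) hi.ne
  k_inj j hj i hi r hr hr' := by
    obtain ⟨h1, rfl⟩ := colBit_eq_some hr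
    obtain ⟨h2, h3⟩ := colBit_eq_some hr'
    exact pos_ne' h1 h2 hi.ne h3
  q_ne_c i hi j hj := pos_ne hi (show j < N by omega) (by simp)
  q_ne_k i hi j hj h := by
    obtain ⟨h1, h2⟩ := colBit_eq_some h
    exact pos_ne hi h1 (by simp) h2
  c_ne_k i hi j hj h := by
    obtain ⟨h1, h2⟩ := colBit_eq_some h
    exact pos_ne (r := .anc) (show i < N by omega) h1 (by simp) h2

theorem lab_colBit {j k q : ℕ} {z : Fin b → Bool} {y : ℕ → Bool} (hk : k < K) (i : ℕ) :
    (colBit e i).elim false (lab j k z q y) = k.testBit i := by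
  by_cases hi : i < Nat.clog 2 K
  · rw [colBit, if_pos hi]
    exact lab_col hi
  · rw [colBit, if_neg hi]
    exact (Nat.testBit_lt_two_pow (hk.trans_le ((Nat.le_pow_clog one_lt_two K).trans
      (Nat.pow_le_pow_right (by norm_num) (not_lt.1 hi))))).symm

/-- A sign that depends linearly on the erased number `s j` is a function of the row index `j`, so its
erasure amounts to a lookup of single bits. -/
theorem exists_erase_row (e : LookupQubits J K b Q N) {lam n : ℕ} (hQ : 0 < Nat.clog 2 Q)
    (hJ : 0 < J) (hN : max (Nat.clog 2 Q) (Nat.clog 2 J) + lam * b ≤ N) (hn : n = 1 + b * (1 + lam))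
    (s : ℕ → ℕ) :
    ∃ c : QCircuit (LookupQubits J K b Q N),
      (c.toffoliCount : ℝ) ≤ dirtyUncost J (Nat.clog 2 Q) n ∧
      ∀ {A : Type} (j k : A → ℕ) (z : A → Fin b → Bool), (∀ a, j a < J) →
        c.Acts (fun a => lab (j a) (k a) (z a) (s (j a)) 0) (fun a => lab (j a) (k a) (z a) 0 0)
          0 := by
  set w := Nat.clog 2 Q with hw
  choose sign hcost hsign using fun o : ℕ → Bool => exists_row_sign (K := K) e hQ hJ hN hn
    fun j => ∑ i ∈ Finset.range w, o i * (s j).testBit i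
  refine ⟨QCircuit.eraseAll (pos e .flat) w sign, ?_, fun j k z hj => ?_⟩
  · have h0 : 0 ≤ dirtyUncost J w n := (Nat.cast_nonneg _).trans (hcost fun _ => false)
    exact (Nat.le_floor_iff h0).1 (QCircuit.toffoliCount_eraseAll fun o => Nat.le_floor (hcost o))
  · refine QCircuit.acts_eraseAll (fun i hi i' hi' => pos_ne' (show i' < w from hi'.trans hi) hi hi'.ne)
      (mid := fun a => lab (j a) (k a) (z a) 0 0)
      (fun a i hi => (lab_flat hi).trans (Nat.zero_testBit i))
      (fun a r hr => lab_eq_lab e (.inl rfl) (.inr hr) fun _ _ _ => rfl) fun o =>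
        (hsign o j k z hj).congr (fun _ => rfl) (fun _ => rfl) fun a => ?_
    rw [Pi.zero_apply]
    refine (zero_add _).trans (Finset.sum_congr rfl fun i hi => ?_)
    rw [lab_flat (Finset.mem_range.1 hi)]

theorem le_fold_min_of_nonneg {S : Finset ℕ} {d : ℝ} {f : ℕ → ℝ} (hd : 0 ≤ d) (hf : ∀ i, 0 ≤ f i) :
    0 ≤ S.fold min d f :=
  (Finset.le_fold_min _).2 ⟨hd, fun i _ => hf i⟩

theorem dirtyCost_nonneg (d w n : ℕ) : 0 ≤ dirtyCost d w n :=
  le_fold_min_of_nonneg (Nat.cast_nonneg _) fun _ => by positivity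

theorem dirtyUncost_nonneg (d w n : ℕ) : 0 ≤ dirtyUncost d w n :=
  le_fold_min_of_nonneg (Nat.cast_nonneg _) fun _ => by positivity

/-- A circuit that uses the flat index `s j + k` can be run between its computation and its
uncomputation. -/
theorem exists_conj_flatIndex (e : LookupQubits J K b Q N) {lam n : ℕ}
    (hJ : 0 < Nat.clog 2 Q → 0 < J)
    (hN : max (Nat.clog 2 Q) (Nat.clog 2 J) + lam * b ≤ N) (hn : n = 1 + b * (1 + lam))
    (s : ℕ → ℕ) (d : QCircuit (LookupQubits J K b Q N)) :
    ∃ c : QCircuit (LookupQubits J K b Q N),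
      (c.toffoliCount : ℝ) ≤ dirtyCost J (Nat.clog 2 Q) n + dirtyUncost J (Nat.clog 2 Q) n +
        d.toffoliCount + 2 * (Nat.clog 2 Q : ℕ) ∧
      ∀ {A : Type} (j k : A → ℕ) (z z' : A → Fin b → Bool) (φ : A → Bool), (∀ a, j a < J) →
        (∀ a, k a < K) → (∀ a, s (j a) + k a < Q) →
        d.Acts (fun a => lab (j a) (k a) (z a) (s (j a) + k a) 0)
          (fun a => lab (j a) (k a) (z' a) (s (j a) + k a) 0) φ →
        c.Acts (fun a => lab (j a) (k a) (z a) 0 0) (fun a => lab (j a) (k a) (z' a) 0 0) φ := by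
  have hQ : Q ≤ 2 ^ Nat.clog 2 Q := Nat.le_pow_clog one_lt_two Q
  have h1 := dirtyCost_nonneg J (Nat.clog 2 Q) n
  have h2 := dirtyUncost_nonneg J (Nat.clog 2 Q) n
  rcases Nat.eq_zero_or_pos (Nat.clog 2 Q) with hw | hw
  -- Without qubits for the flat index, its only value is `0`.
  · refine ⟨d, by linarith [(Nat.clog 2 Q).cast_nonneg (α := ℝ)], fun j k z z' φ _ _ hs hd => ?_⟩
    have h0 (a : _) : s (j a) + k a = 0 := by
      have := (hs a).trans_le hQ
      rw [hw, pow_zero] at this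
      omega
    simpa only [h0] using hd
  obtain ⟨c₁, hc₁, h₁⟩ := exists_row_xor (K := K) e hw (hJ hw) hN hn s
  obtain ⟨c₂, hc₂, h₂⟩ := exists_erase_row (K := K) e hw (hJ hw) hN hn s
  have lay := adderLayout e (show Nat.clog 2 Q ≤ N by omega)
  have hanc {i : ℕ} (hi : i < Nat.clog 2 Q) : i < N := by omega
  refine ⟨c₁ ++ (QCircuit.adder (Nat.clog 2 Q) (pos e .flat) (colBit e) (pos e .anc) ++ (d ++
    (QCircuit.subtractor (Nat.clog 2 Q) (pos e .flat) (colBit e) (pos e .anc) ++ c₂))), ?_,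
    fun j k z z' φ hj hk hs hd => ?_⟩
  · have h3 : ((QCircuit.adder (Nat.clog 2 Q) (pos e .flat) (colBit e)
        (pos e .anc)).toffoliCount : ℝ) ≤ (Nat.clog 2 Q : ℕ) :=
      Nat.cast_le.2 (QCircuit.toffoliCount_adder _ _ _ _)
    have h4 : ((QCircuit.subtractor (Nat.clog 2 Q) (pos e .flat) (colBit e)
        (pos e .anc)).toffoliCount : ℝ) ≤ (Nat.clog 2 Q : ℕ) :=
      Nat.cast_le.2 (QCircuit.toffoliCount_subtractor _ _ _ _)
    simp only [QCircuit.toffoliCount_append, Nat.cast_add]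
    linarith
  · have add : (QCircuit.adder (Nat.clog 2 Q) (pos e .flat) (colBit e) (pos e .anc)).Acts
        (fun a => lab (j a) (k a) (z a) (s (j a)) 0)
        (fun a => lab (j a) (k a) (z a) (s (j a) + k a) 0) 0 :=
      QCircuit.acts_adder lay (m := fun a => s (j a)) (n := k) (cin := fun _ => false)
        (fun a i hi => lab_flat hi) (fun a i _ => lab_colBit (hk a) i)
        (fun a hi => lab_anc (hanc hi)) (fun a i _ hi => lab_anc (hanc hi))
        (fun a i hi => lab_flat hi)
        fun a r hr => lab_eq_lab e (.inl rfl) (.inr hr) fun _ _ _ => rfl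
    have sub : (QCircuit.subtractor (Nat.clog 2 Q) (pos e .flat) (colBit e) (pos e .anc)).Acts
        (fun a => lab (j a) (k a) (z' a) (s (j a) + k a) 0)
        (fun a => lab (j a) (k a) (z' a) (s (j a)) 0) 0 :=
      QCircuit.acts_subtractor lay (m := fun a => s (j a) + k a) (n := k)
        (fun a i hi => lab_flat hi) (fun a i _ => lab_colBit (hk a) i)
        (fun a i hi => lab_anc (hanc hi)) (fun a => (hs a).trans_le hQ)
        (fun a => Nat.le_add_left _ _)
        (fun a i hi => (lab_flat hi).trans (by rw [Nat.add_sub_cancel]))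
        fun a r hr => lab_eq_lab e (.inl rfl) (.inr hr) fun _ _ _ => rfl
    exact ((h₁ j k z hj).append (add.append (hd.append (sub.append (h₂ j k z' hj))))).congr
      (fun _ => rfl) (fun _ => rfl) fun a => by simp

/-- The number of the first entry of row `j` if all entries are numbered row by row. -/
def rowStart (Ks : Fin J → ℕ) (j : ℕ) : ℕ :=
  if h : j < J then ∑ i : Fin j, Ks (Fin.castLE h.le i) else 0

theorem rowStart_add (Ks : Fin J → ℕ) (a : Σ j : Fin J, Fin (Ks j)) :
    rowStart Ks a.1 + a.2 = (finSigmaFinEquiv a : ℕ) := by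
  rw [finSigmaFinEquiv_apply, rowStart, dif_pos a.1.2]

/-- The table of all entries, row by row. -/
def table {Ks : Fin J → ℕ} (x : (j : Fin J) → Fin (Ks j) → Fin b → Bool) (q : ℕ) : Fin b → Bool :=
  if h : q < ∑ j, Ks j then
    x (finSigmaFinEquiv.symm ⟨q, h⟩).1 (finSigmaFinEquiv.symm ⟨q, h⟩).2
  else 0

theorem table_rowStart_add {Ks : Fin J → ℕ} (x : (j : Fin J) → Fin (Ks j) → Fin b → Bool)
    (a : Σ j : Fin J, Fin (Ks j)) : table x (rowStart Ks a.1 + a.2) = x a.1 a.2 := by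
  have h (u : Fin (∑ j, Ks j)) : table x u =
      x (finSigmaFinEquiv.symm u).1 (finSigmaFinEquiv.symm u).2 := dif_pos u.2
  rw [rowStart_add, h, Equiv.symm_apply_apply]

/-! ### The multiplexed oracle -/

open Classical in
/-- The number of ancillas, and of Toffoli gates per qubit of the flat index, that are spent on a
division by `1 + μ`. -/
noncomputable def divCost (μ : ℕ) : ℕ := if IsPowTwo (1 + μ) then 0 else 8 * (1 + μ)

theorem exists_flatAddress (e : LookupQubits J K b Q N) {W M μ b' : ℕ}
    {out : Fin b' → ℕ} (hout : Injective out) (hout' : ∀ i, out i < b) (hW : Nat.clog 2 Q ≤ W)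
    (hN : W + M + divCost μ ≤ N) (hM : μ * b' ≤ M) :
    ∃ f : FlatAddress e out,
      (f.cost : ℝ) ≤ Q / (1 + μ) + μ * b' + divCost μ * (Nat.clog 2 Q : ℕ) := by
  by_cases h : IsPowTwo (1 + μ)
  · obtain ⟨p, hp⟩ := h
    rw [divCost, if_pos ⟨p, hp⟩] at hN ⊢
    simpa using exists_flatAddress_two_pow e hout hout' hW hN hM hp
  · rw [divCost, if_neg h] at hN ⊢
    exact exists_flatAddress_div e hout hout' hW hN hM

variable {lam n : ℕ} {Ks : Fin J → ℕ}

theorem clog_sum_pos (h : 0 < Nat.clog 2 (∑ j, Ks j)) : 0 < J := by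
  rcases Nat.eq_zero_or_pos J with rfl | hJ
  · simp at h
  · exact hJ

theorem exists_computesLookup (hK : ∀ j, Ks j ≤ K) (x : (j : Fin J) → Fin (Ks j) → Fin b → Bool)
    (hQ : Q = ∑ j, Ks j) (hn : n = 1 + b * (1 + lam)) {μ : ℕ} (hμ : μ ≤ lam) :
    ∃ circ : QCircuit
        (LookupQubits J K b Q (max (Nat.clog 2 Q) (Nat.clog 2 J) + lam * b + divCost μ)),
      ComputesLookup x circ ∧
      (circ.toffoliCount : ℝ) ≤ dirtyCost J (Nat.clog 2 Q) n + dirtyUncost J (Nat.clog 2 Q) n +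
        (Q / (1 + μ) + μ * b + divCost μ * (Nat.clog 2 Q : ℕ)) + 2 * (Nat.clog 2 Q : ℕ) := by
  have h1 := dirtyCost_nonneg J (Nat.clog 2 Q) n
  have h2 := dirtyUncost_nonneg J (Nat.clog 2 Q) n
  rcases Nat.eq_zero_or_pos b with rfl | hb
  · refine ⟨.done, QCircuit.Acts.implements (QCircuit.acts_done.congr (fun _ => rfl)
      (fun a => ?_) fun _ => rfl), ?_⟩
    · congr 1
      exact Subsingleton.elim _ _
    · simp only [QCircuit.toffoliCount, Nat.cast_zero]
      positivity
  set e : LookupQubits J K b Q (max (Nat.clog 2 Q) (Nat.clog 2 J) + lam * b + divCost μ) :=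
    .inr (.inr (.inl ⟨0, hb⟩)) with he
  obtain ⟨f, hf⟩ := exists_flatAddress e
    (W := max (Nat.clog 2 Q) (Nat.clog 2 J)) (M := lam * b) (μ := μ) (b' := b)
    (out := Fin.val) Fin.val_injective (fun i => i.2) (le_max_left _ _) le_rfl
    (Nat.mul_le_mul_right b hμ)
  obtain ⟨d, hd, hacts⟩ := f.exists_xor (fun _ => rfl) (table x)
  obtain ⟨c, hc, hcacts⟩ := exists_conj_flatIndex e (fun h => clog_sum_pos (hQ ▸ h))
    (Nat.le_add_right _ _) hn (rowStart Ks) d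
  have hlt (a : Σ j : Fin J, Fin (Ks j)) : rowStart Ks a.1 + a.2 < Q := by
    rw [rowStart_add, hQ]
    exact Fin.is_lt _
  have hd₀ := hacts (A := (Σ j : Fin J, Fin (Ks j)) × (Fin b → Bool)) (fun a => a.1.1)
    (fun a => a.1.2) (fun a => rowStart Ks a.1.1 + a.1.2) (fun a => a.2) fun a => hlt a.1
  simp only [table_rowStart_add] at hd₀
  have hc₀ := hcacts (A := (Σ j : Fin J, Fin (Ks j)) × (Fin b → Bool)) (fun a => a.1.1)
    (fun a => a.1.2) (fun a => a.2) (fun a => a.2 + x a.1.1 a.1.2) 0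
    (fun a => a.1.1.2) (fun a => a.1.2.2.trans_le (hK _)) (fun a => hlt a.1) hd₀
  refine ⟨c, QCircuit.Acts.implements (hc₀.congr (fun a => lookupLabel_eq _ _ _)
    (fun a => lookupLabel_eq _ _ _) fun _ => rfl), ?_⟩
  have hd' : (d.toffoliCount : ℝ) ≤ f.cost := Nat.cast_le.2 hd
  linarith

theorem exists_uncomputesLookup (hK : ∀ j, Ks j ≤ K) (x : (j : Fin J) → Fin (Ks j) → Fin b → Bool)
    (hQ : Q = ∑ j, Ks j) (hn : n = 1 + b * (1 + lam)) {μ : ℕ} (hμ : μ ≤ lam) :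
    ∃ circ : QCircuit
        (LookupQubits J K b Q (max (Nat.clog 2 Q) (Nat.clog 2 J) + lam * b + divCost μ)),
      UncomputesLookup x circ ∧
      (circ.toffoliCount : ℝ) ≤ dirtyCost J (Nat.clog 2 Q) n + dirtyUncost J (Nat.clog 2 Q) n +
        (Q / (1 + μ) + μ + divCost μ * (Nat.clog 2 Q : ℕ)) + 2 * (Nat.clog 2 Q : ℕ) := by
  have h1 := dirtyCost_nonneg J (Nat.clog 2 Q) n
  have h2 := dirtyUncost_nonneg J (Nat.clog 2 Q) n
  rcases Nat.eq_zero_or_pos b with rfl | hb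
  · refine ⟨.done, QCircuit.Acts.implements (QCircuit.acts_done.congr (fun _ => rfl)
      (fun a => ?_) fun _ => rfl), ?_⟩
    · congr 1
      exact Subsingleton.elim _ _
    · simp only [QCircuit.toffoliCount, Nat.cast_zero]
      positivity
  set e : LookupQubits J K b Q (max (Nat.clog 2 Q) (Nat.clog 2 J) + lam * b + divCost μ) :=
    .inr (.inr (.inl ⟨0, hb⟩)) with he
  obtain ⟨f, hf⟩ := exists_flatAddress e
    (W := max (Nat.clog 2 Q) (Nat.clog 2 J)) (M := lam * b) (μ := μ) (b' := 1)
    (out := fun _ => 0) (injective_of_subsingleton _) (fun _ => hb) (le_max_left _ _) le_rfl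
    (Nat.mul_le_mul hμ hb)
  choose d hd hacts using fun o : ℕ → Bool => f.exists_sign hb fun q =>
    ∑ i ∈ Finset.range b, o i * if h : i < b then table x q ⟨i, h⟩ else false
  choose c hc hcacts using fun o => exists_conj_flatIndex e (fun h => clog_sum_pos (hQ ▸ h))
    (Nat.le_add_right _ _) hn (rowStart Ks) (d o)
  have hlt (a : Σ j : Fin J, Fin (Ks j)) : rowStart Ks a.1 + a.2 < Q := by
    rw [rowStart_add, hQ]
    exact Fin.is_lt _
  refine ⟨QCircuit.eraseAll (pos e .data) b c, QCircuit.Acts.implements (QCircuit.acts_eraseAll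
    (mid := fun a => lab a.1 a.2 0 0 0)
    (fun i hi i' hi' => pos_ne' (show i' < b from hi'.trans hi) hi hi'.ne)
    (fun a i hi => lab_data hi) (fun a r hr => ?_) fun o => ?_), ?_⟩
  · rw [lookupLabel_eq]
    exact lab_eq_lab e (.inr hr) (.inl rfl) fun _ _ _ => rfl
  · refine (hcacts o (A := Σ j : Fin J, Fin (Ks j))
      (fun a => a.1) (fun a => a.2) 0 0 _ (fun a => a.1.2) (fun a => a.2.2.trans_le (hK _)) hlt
      (hacts o _ _ _ hlt)).congr (fun _ => rfl) (fun a => lookupLabel_eq _ _ _) fun a => ?_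
    rw [Pi.zero_apply]
    refine (zero_add _).trans (Finset.sum_congr rfl fun i hi => ?_)
    rw [lookupLabel_eq, lab_data (Finset.mem_range.1 hi), dif_pos (Finset.mem_range.1 hi),
      table_rowStart_add]
  · have h0 : 0 ≤ dirtyCost J (Nat.clog 2 Q) n + dirtyUncost J (Nat.clog 2 Q) n +
        (Q / (1 + μ) + μ + divCost μ * (Nat.clog 2 Q : ℕ)) + 2 * (Nat.clog 2 Q : ℕ) := by
      positivity
    refine (Nat.le_floor_iff h0).1 (QCircuit.toffoliCount_eraseAll fun o => Nat.le_floor ?_)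
    have hd' : ((d o).toffoliCount : ℝ) ≤ f.cost := Nat.cast_le.2 (hd o)
    have := hc o
    push_cast at hf
    linarith

end Lookup

/-- `C` is the absolute constant of the `O(1)` terms. `c` accounts for the extra Toffoli gates
(`O(log Q)`) and clean qubits (`O(1)`) that are needed only when `1 + μ` is not a power of two.
The bounds hold for every `μ ∈ [0, lam]`, hence for the minimum over `μ`. -/
theorem mainTheorem4 :
    ∃ (C : ℕ) (c : ℕ → ℕ), (∀ μ : ℕ, IsPowTwo (1 + μ) → c μ = 0) ∧
      ∀ (J K b lam : ℕ) (Ks : Fin J → ℕ) (_hK : ∀ j, Ks j ≤ K)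
        (x : (j : Fin J) → Fin (Ks j) → Fin b → Bool)
        (Q n w : ℕ) (_hQ : Q = ∑ j, Ks j) (_hn : n = 1 + b * (1 + lam)) (_hw : w = Nat.clog 2 Q)
        (μ : ℕ) (_hμ : μ ≤ lam),
        (∃ circ : QCircuit
            (LookupQubits J K b Q (max (Nat.clog 2 Q) (Nat.clog 2 J) + lam * b + c μ)),
          ComputesLookup x circ ∧
          (circ.toffoliCount : ℝ) ≤
            dirtyCost J w n + dirtyUncost J w n + cleanCost Q b μ + 2 * w + C + c μ * w) ∧
        (∃ circ : QCircuit
            (LookupQubits J K b Q (max (Nat.clog 2 Q) (Nat.clog 2 J) + lam * b + c μ)),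
          UncomputesLookup x circ ∧
          (circ.toffoliCount : ℝ) ≤
            dirtyCost J w n + dirtyUncost J w n + cleanUncost Q μ + 2 * w + C + c μ * w) := by
  refine ⟨0, Lookup.divCost, fun μ hμ => if_pos hμ, ?_⟩
  rintro J K b lam Ks hK x Q n _ hQ hn rfl μ hμ
  obtain ⟨c, hc, hcost⟩ := Lookup.exists_computesLookup hK x hQ hn hμ
  obtain ⟨c', hc', hcost'⟩ := Lookup.exists_uncomputesLookup hK x hQ hn hμ
  refine ⟨⟨c, hc, hcost.trans_eq ?_⟩, c', hc', hcost'.trans_eq ?_⟩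
  · simp only [cleanCost, Nat.cast_zero]
    ring
  · simp only [cleanUncost, Nat.cast_zero]
    ring
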